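/- Let $\gamma_n$ be the standard Gaussian measure on $\mathbb{R}^n$. For $-1<\rho<1$ let $(X,Y)$ be jointly Gaussian random vectors in $\mathbb{R}^n$, each of law $\gamma_n$, with $\mathbb{E}X_iY_j=\rho\,\delta_{ij}$, and write $\Pr_\rho$, $\mathbb{E}_\rho$ for their joint law and expectation. Let $\Phi$ be the standard normal distribution function, $\Phi^{-1}:[0,1]\to[-\infty,\infty]$ its inverse, and for $x,y\in[0,1]$ put $$J(x,y;\rho)=\Pr(X_1\le\Phi^{-1}(x),\ Y_1\le\Phi^{-1}(y)),$$ where $(X_1,Y_1)$ is a pair of jointly Gaussian standard normal real random variables with correlation $\rho$. Write $\mathbb{E}f=\int f\,d\gamma_n$. "Almost surely" is with respect to $\gamma_n$. Let $-1<\rho<1$, $\rho\neq 0$. (i) Let $f,g:\mathbb{R}^n\to[0,1]$ be measurable, neither of them almost surely equal to $0$ or almost surely equal to $1$. Suppose that equality holds in the functional Borell inequality, i.e. $$\mathbb{E}_\rho J(f(X),g(Y);\rho)=J(\mathbb{E}f,\mathbb{E}g;\rho).$$ Then either $f$ and $g$ are both almost surely constant, or there exist $a,b,d\in\mathbb{R}^n$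 with $a\neq0$ such that either $$f(x)=\Phi(\langle a,x-b\rangle)\quad\text{and}\quad g(x)=\Phi(\langle a,x-d\rangle)\quad\text{almost surely},$$ or $$f(x)=1_{\{\langle a,x-b\rangle\ge0\}}\quad\text{and}\quad g(x)=1_{\{\langle a,x-d\rangle\ge0\}}\quad\text{almost surely}.$$ (ii) In particular, half-spaces are the unique optimizers in Borell's theorem: let $n\ge1$, let $A_1,A_2\subset\mathbb{R}^n$ be measurable with $0<\gamma_n(A_i)<1$, and let $B_i=\{x\in\mathbb{R}^n:x_1\le\Phi^{-1}(\gamma_n(A_i))\}$ for $i=1,2$. Then $$\Pr_\rho(X\in A_1,\,Y\in A_2)=\Pr_\rho(X\in B_1,\,Y\in B_2)$$ if and only if there are $a,b,d\in\mathbb{R}^n$ with $a\ne0$ such that, up to $\gamma_n$-null sets, $A_1=\{x:\langle a,x-b\rangle\ge0\}$ and $A_2=\{x:\langle a,x-d\rangle\ge0\}$. -/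

import Mathlib

open MeasureTheory ProbabilityTheory

noncomputable section

namespace GaussianStability

/-- The standard Gaussian measure `γ_n` on Euclidean space `ℝⁿ`. -/
abbrev gammaN (n : ℕ) : Measure (EuclideanSpace ℝ (Fin n)) :=
  stdGaussian (EuclideanSpace ℝ (Fin n))

/-- For `γ` a standard Gaussian measure, the joint law of the pair
`(X, Y) = (X, ρ X + √(1 - ρ²) Z)` with `X`, `Z` independent of law `γ`.  This pair is jointly
Gaussian, both marginals are `γ`, and `E Xᵢ Yⱼ = δᵢⱼ ρ`. -/
def correlatedPair {E : Type*} [AddCommGroup E] [Module ℝ E] [MeasurableSpace E]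
    (γ : Measure E) (ρ : ℝ) : Measure (E × E) :=
  (γ.prod γ).map (fun p => (p.1, ρ • p.1 + Real.sqrt (1 - ρ ^ 2) • p.2))

/-- `Pr_ρ`: the joint law of `ρ`-correlated standard Gaussian vectors on `ℝⁿ`. -/
abbrev correlatedGaussian (n : ℕ) (ρ : ℝ) :
    Measure (EuclideanSpace ℝ (Fin n) × EuclideanSpace ℝ (Fin n)) :=
  correlatedPair (gammaN n) ρ

/-- The standard normal distribution function `Φ`. -/
def Phi (x : ℝ) : ℝ := (gaussianReal 0 1).real (Set.Iic x)

/-- The inverse `Φ⁻¹ : [0, 1] → [-∞, ∞]`, as the quantile function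
`p ↦ inf {t : p ≤ Φ t}`; it has value `-∞` at `0` and `∞` at `1`. -/
def PhiInv (p : ℝ) : EReal := ⨅ t ∈ {t : ℝ | p ≤ Phi t}, (t : EReal)

/-- `J(x, y; ρ) = Pr_ρ (X₁ ≤ Φ⁻¹(x), Y₁ ≤ Φ⁻¹(y))`. -/
def J (ρ x y : ℝ) : ℝ :=
  (correlatedPair (gaussianReal 0 1) ρ).real
    {z : ℝ × ℝ | (z.1 : EReal) ≤ PhiInv x ∧ (z.2 : EReal) ≤ PhiInv y}

/-- The half-space `{x : ⟨a, x - b⟩ ≥ 0}` (a genuine half-space when `a ≠ 0`). -/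
def halfSpace {n : ℕ} (a b : EuclideanSpace ℝ (Fin n)) : Set (EuclideanSpace ℝ (Fin n)) :=
  {x | 0 ≤ inner ℝ a (x - b)}

/-- The half-space `{x : x₁ ≤ Φ⁻¹(γ_n(A))}` orthogonal to the first coordinate axis, which has
the same Gaussian measure as `A`. -/
def borellHalfSpace {n : ℕ} (hn : 0 < n) (A : Set (EuclideanSpace ℝ (Fin n))) :
    Set (EuclideanSpace ℝ (Fin n)) :=
  {x | (x ⟨0, hn⟩ : EReal) ≤ PhiInv ((gammaN n).real A)}

end GaussianStability

end

/-!
For `0 < ρ < 1` Borell's inequality `Pr_ρ(X ∈ A, Y ∈ B) ≤ J(γ A, γ B; ρ)` and its equality case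
are obtained for sets in an arbitrary finite-dimensional inner product space; functions and
negative correlations are reduced to that case.

*The inequality.* `J` has a second-order Taylor expansion with uniform remainder on compact subsets
of the open square (`exists_J_taylor`), and the quadratic form
`J_xx u² + 2 ρ J_xy u v + J_yy v²` is nonpositive (`ddJ_form_nonpos`). Hence
`E_ρ J(f(x + δ X), g(y + δ Y)) ≤ J(E f(x + δ X), E g(y + δ Y))` for smooth `f`, `g`, up to an error
of third order in the step `δ` (`borellUpTo_small`). Composing two independent increments doubles
both the variance and the error (`BorellUpTo.double`), so the increment of size one, built from
steps of variance `2⁻ᵏ`, has an error that tends to zero with `k`. Approximation of indicators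
gives the inequality for sets (`correlatedPair_prod_le_J`).

*Polarization.* Add an independent coordinate `t` and let `flip` change its sign. The two-point
symmetrization `polarize`, applied to both sets at once, preserves the measures and, because the
joint density of `(t, t')` is larger at points with `t t' > 0` than at their reflections, does not
decrease `Pr_ρ`. For optimizers it cannot increase it either, by Borell's inequality. So the two
sets cannot prefer opposite sides of the reflection, up to null sets (`gain_null_of_eq`).

*Half-spaces.* For a unit vector `e` the cylinder over `A` is rotated by `tilt e` before polarizing,
so that the reflection moves points along `e`. The result (`descends_or_descends`) is that for every
`e` either `A` is stable under all translations by `-r e` or `B` is stable under all translations by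
`r e`, with `r > 0`. The sign of `⟨e, ∫_A x dγ⟩` excludes one of the alternatives. If the barycentre
of `A` were zero, `E` would be the union of the directions of invariance of `A` and of those of
`B`, hence equal to one of them, and `A` or `B` would be trivial (`setIntegral_id_ne_zero`). So both
barycentres are nonzero, they are positive multiples of each other, and both sets are stable under
all translations into the open half-space that they determine. By Fubini such a set is a
half-space (`exists_ae_eq_halfspace`).

*Functions.* `E_ρ J(f(X), g(Y))` is the probability that the correlated pair in `E × ℝ` lies in
the product of the regions below `Φ⁻¹ ∘ f` and `Φ⁻¹ ∘ g`, and `E f`, `E g` are the measures of these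
regions. Hence they are parallel half-spaces of `E × ℝ`. A vertical boundary makes
`f` and `g` indicators of half-spaces, a horizontal one makes them constant, and any other one
makes them `Φ` of an affine function (`functional_equality_of_pos`). For `ρ < 0` the pair
`(f, y ↦ 1 - g (-y))` is an equality case for `-ρ`, since `J(x, y; ρ) = x - J(x, 1 - y; -ρ)`.
-/

noncomputable section

namespace GaussianStability

open Set Filter Topology

/-! ### The standard normal distribution function and its quantiles -/

/-- The standard Gaussian measure on the real line. -/
local notation "N₁" => gaussianReal 0 1

/-- The standard normal density. -/
local notation "φ₁" => gaussianPDFReal 0 1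

lemma continuous_stdPDF : Continuous φ₁ := by
  unfold gaussianPDFReal
  fun_prop

lemma contDiff_stdPDF {n : WithTop ℕ∞} : ContDiff ℝ n φ₁ := by
  unfold gaussianPDFReal
  fun_prop

lemma stdPDF_pos (x : ℝ) : 0 < φ₁ x := gaussianPDFReal_pos 0 1 x one_ne_zero

instance : NullSingletonClass N₁ := nullSingletonClass_gaussianReal one_ne_zero

lemma hasDerivAt_integral_Iic_gaussian {h : ℝ → ℝ} (hc : Continuous h) {C : ℝ}
    (hC : ∀ x, |h x| ≤ C) (v : ℝ) :
    HasDerivAt (fun v => ∫ s in Iic v, h s ∂N₁) (φ₁ v * h v) v := by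
  have hint : Integrable (fun s => φ₁ s * h s) := by
    refine (integrable_gaussianPDFReal 0 1).mul_bdd (c := C) hc.aestronglyMeasurable ?_
    exact Eventually.of_forall hC
  have key : ∀ v, ∫ s in Iic v, h s ∂N₁ =
      (∫ s in Iic (0 : ℝ), φ₁ s * h s) + ∫ s in (0 : ℝ)..v, φ₁ s * h s := by
    intro v
    rw [← intervalIntegral.integral_Iic_sub_Iic hint.integrableOn hint.integrableOn,
      ← integral_indicator measurableSet_Iic, integral_gaussianReal_eq_integral_smul one_ne_zero]
    rw [add_sub_cancel, ← integral_indicator measurableSet_Iic]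
    congr 1 with s
    simp [indicator_apply]
  simp_rw [key]
  have hcont : Continuous (fun s => φ₁ s * h s) := continuous_stdPDF.mul hc
  exact (intervalIntegral.integral_hasDerivAt_right hint.intervalIntegrable
    (hcont.stronglyMeasurableAtFilter _ _) hcont.continuousAt).const_add _

lemma hasDerivAt_Phi (v : ℝ) : HasDerivAt Phi (φ₁ v) v := by
  have := hasDerivAt_integral_Iic_gaussian (h := fun _ => 1) continuous_const (C := 1)
    (by simp) v
  have h2 : Phi = fun v => (N₁).real (Iic v) := rfl
  simpa [h2] using this

lemma continuous_Phi : Continuous Phi :=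
  continuous_iff_continuousAt.2 fun v => (hasDerivAt_Phi v).continuousAt

lemma contDiff_Phi : ContDiff ℝ 3 Phi := by
  have h : deriv Phi = φ₁ := funext fun v => (hasDerivAt_Phi v).deriv
  rw [show (3 : WithTop ℕ∞) = 2 + 1 by norm_num, contDiff_succ_iff_deriv, h]
  exact ⟨fun v => (hasDerivAt_Phi v).differentiableAt, by simp, contDiff_stdPDF⟩

lemma strictMono_Phi : StrictMono Phi := by
  apply strictMono_of_deriv_pos
  intro v
  rw [(hasDerivAt_Phi v).deriv]
  exact stdPDF_pos v

lemma Phi_eq_cdf : Phi = cdf N₁ := by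
  ext v
  rw [cdf_eq_real, Phi]

lemma Phi_mem (v : ℝ) : Phi v ∈ Ioo (0 : ℝ) 1 := by
  constructor
  · exact lt_of_le_of_lt measureReal_nonneg (strictMono_Phi (sub_one_lt v))
  · exact lt_of_lt_of_le (strictMono_Phi (lt_add_one v)) measureReal_le_one

lemma Phi_nonneg (v : ℝ) : 0 ≤ Phi v := (Phi_mem v).1.le

lemma Phi_le_one (v : ℝ) : Phi v ≤ 1 := (Phi_mem v).2.le

lemma exists_Phi_eq {p : ℝ} (hp : p ∈ Ioo (0 : ℝ) 1) : ∃ v, Phi v = p := by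
  have h0 : Tendsto Phi atBot (𝓝 0) := Phi_eq_cdf ▸ tendsto_cdf_atBot N₁
  have h1 : Tendsto Phi atTop (𝓝 1) := Phi_eq_cdf ▸ tendsto_cdf_atTop N₁
  obtain ⟨a, ha⟩ := (h0.eventually (gt_mem_nhds hp.1)).exists
  obtain ⟨b, hb⟩ := (h1.eventually (lt_mem_nhds hp.2)).exists
  exact mem_range_of_exists_le_of_exists_ge continuous_Phi ⟨a, ha.le⟩ ⟨b, hb.le⟩

lemma PhiInv_Phi (v : ℝ) : PhiInv (Phi v) = v := by
  unfold PhiInv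
  apply le_antisymm
  · exact iInf₂_le v (by simp)
  · refine le_iInf₂ fun t ht => ?_
    exact_mod_cast strictMono_Phi.le_iff_le.1 ht

/-- The real-valued quantile function of the standard normal law (with junk values outside
`(0, 1)`). -/
def quantile (p : ℝ) : ℝ := (PhiInv p).toReal

@[simp]
lemma quantile_Phi (v : ℝ) : quantile (Phi v) = v := by simp [quantile, PhiInv_Phi]

lemma Phi_quantile {p : ℝ} (hp : p ∈ Ioo (0 : ℝ) 1) : Phi (quantile p) = p := by
  obtain ⟨v, rfl⟩ := exists_Phi_eq hp
  simp

lemma PhiInv_eq_quantile {p : ℝ} (hp : p ∈ Ioo (0 : ℝ) 1) : PhiInv p = quantile p := by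
  obtain ⟨v, rfl⟩ := exists_Phi_eq hp
  simp [PhiInv_Phi]

lemma PhiInv_zero : PhiInv 0 = ⊥ := by
  refine (EReal.eq_bot_iff_forall_lt _).2 fun z => ?_
  refine lt_of_le_of_lt (iInf₂_le (z - 1) (Phi_nonneg (z - 1))) ?_
  exact_mod_cast sub_one_lt z

lemma PhiInv_one : PhiInv 1 = ⊤ := by
  unfold PhiInv
  simp only [iInf_eq_top]
  intro t ht
  exact absurd (Phi_mem t).2 (not_lt.2 ht)

lemma monotone_PhiInv : Monotone PhiInv := by
  intro x y h
  refine le_iInf₂ fun t ht => ?_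
  have ht' : t ∈ {t : ℝ | x ≤ Phi t} := by
    rw [mem_ofPred_eq] at ht ⊢
    exact h.trans ht
  exact iInf₂_le t ht'

lemma measurable_PhiInv : Measurable PhiInv := monotone_PhiInv.measurable

lemma mem_Icc_cases {p : ℝ} (hp : p ∈ Icc (0 : ℝ) 1) : p = 0 ∨ p ∈ Ioo (0 : ℝ) 1 ∨ p = 1 := by
  rcases hp.1.eq_or_lt with h | h
  · exact Or.inl h.symm
  rcases hp.2.eq_or_lt with h' | h'
  · exact Or.inr (Or.inr h')
  · exact Or.inr (Or.inl ⟨h, h'⟩)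

/-- The ray `{s | s ≤ Φ⁻¹(p)}`, of standard Gaussian measure `p` when `0 ≤ p ≤ 1`. -/
def lowerRay (p : ℝ) : Set ℝ := {s | (s : EReal) ≤ PhiInv p}

lemma lowerRay_zero : lowerRay 0 = ∅ := by simp [lowerRay, PhiInv_zero]

lemma lowerRay_one : lowerRay 1 = univ := by simp [lowerRay, PhiInv_one]

lemma lowerRay_of_mem {p : ℝ} (hp : p ∈ Ioo (0 : ℝ) 1) : lowerRay p = Iic (quantile p) := by
  simp [lowerRay, PhiInv_eq_quantile hp, Iic_def]

lemma measurableSet_lowerRay (p : ℝ) : MeasurableSet (lowerRay p) :=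
  measurableSet_le measurable_coe_real_ereal measurable_const

lemma lowerRay_mono {p p' : ℝ} (h : p ≤ p') : lowerRay p ⊆ lowerRay p' :=
  fun _ hs => le_trans hs (monotone_PhiInv h)

lemma real_lowerRay {p : ℝ} (hp : p ∈ Icc (0 : ℝ) 1) : (N₁).real (lowerRay p) = p := by
  rcases mem_Icc_cases hp with rfl | h | rfl
  · simp [lowerRay_zero]
  · rw [lowerRay_of_mem h, ← Phi, Phi_quantile h]
  · simp [lowerRay_one]

lemma quantile_contDiffAt {p : ℝ} (hp : p ∈ Ioo (0 : ℝ) 1) : ContDiffAt ℝ 3 quantile p := by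
  have hmono : StrictMonoOn quantile (Ioo 0 1) := by
    intro x hx y hy hxy
    rw [← strictMono_Phi.lt_iff_lt, Phi_quantile hx, Phi_quantile hy]
    exact hxy
  have himg : quantile '' (Ioo 0 1) = univ :=
    eq_univ_of_forall fun v => ⟨Phi v, Phi_mem v, quantile_Phi v⟩
  have hcont : ContinuousOn quantile (Ioo 0 1) := fun x hx =>
    (hmono.continuousAt_of_image_mem_nhds (isOpen_Ioo.mem_nhds hx)
      (himg ▸ univ_mem)).continuousWithinAt
  let e : OpenPartialHomeomorph ℝ ℝ :=
    { toFun := Phi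
      invFun := quantile
      source := univ
      target := Ioo 0 1
      map_source' := fun v _ => Phi_mem v
      map_target' := fun _ _ => mem_univ _
      left_inv' := fun v _ => quantile_Phi v
      right_inv' := fun p hp => Phi_quantile hp
      open_source := isOpen_univ
      open_target := isOpen_Ioo
      continuousOn_toFun := continuous_Phi.continuousOn
      continuousOn_invFun := hcont }
  exact e.contDiffAt_symm_deriv (stdPDF_pos (quantile p)).ne' hp (hasDerivAt_Phi _)
    contDiff_Phi.contDiffAt

lemma hasDerivAt_quantile {p : ℝ} (hp : p ∈ Ioo (0 : ℝ) 1) :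
    HasDerivAt quantile (φ₁ (quantile p))⁻¹ p := by
  refine HasDerivAt.of_local_left_inverse (quantile_contDiffAt hp).continuousAt
    (hasDerivAt_Phi _) (stdPDF_pos _).ne' ?_
  filter_upwards [isOpen_Ioo.mem_nhds hp] with y hy using Phi_quantile hy

lemma PhiInv_one_sub {p : ℝ} (hp : p ∈ Icc (0 : ℝ) 1) : PhiInv (1 - p) = -PhiInv p := by
  rcases mem_Icc_cases hp with rfl | h | rfl
  · simp [PhiInv_zero, PhiInv_one]
  · obtain ⟨v, rfl⟩ := exists_Phi_eq h
    have : 1 - Phi v = Phi (-v) := by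
      have h1 : (N₁).real (Ici v) = Phi (-v) := by
        rw [Phi, ← show (N₁).map (fun x => -x) = N₁ by
          simpa using gaussianReal_map_neg (μ := 0) (v := 1),
          map_measureReal_apply measurable_neg measurableSet_Iic, gaussianReal_map_neg]
        simp
      rw [← h1, measureReal_congr Ioi_ae_eq_Ici.symm, ← compl_Iic,
        probReal_compl_eq_one_sub measurableSet_Iic, Phi]
    rw [this, PhiInv_Phi, PhiInv_Phi]
    simp
  · simp [PhiInv_zero, PhiInv_one]

/-! ### Correlated pairs of centred Gaussian vectors -/

section Copula

section CorrelatedPair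

variable {E : Type*} [NormedAddCommGroup E] [NormedSpace ℝ E] [MeasurableSpace E] [BorelSpace E]
  [SecondCountableTopology E]

lemma measurable_correlate (ρ : ℝ) :
    Measurable (fun p : E × E => (p.1, ρ • p.1 + Real.sqrt (1 - ρ ^ 2) • p.2)) := by
  fun_prop

instance isProbabilityMeasure_correlatedPair (γ : Measure E) [IsProbabilityMeasure γ] (ρ : ℝ) :
    IsProbabilityMeasure (correlatedPair γ ρ) :=
  Measure.isProbabilityMeasure_map (measurable_correlate ρ).aemeasurable

lemma measurePreserving_correlate (γ : Measure E) (ρ : ℝ) :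
    MeasurePreserving (fun p : E × E => (p.1, ρ • p.1 + Real.sqrt (1 - ρ ^ 2) • p.2))
      (γ.prod γ) (correlatedPair γ ρ) :=
  ⟨measurable_correlate ρ, rfl⟩

lemma measurePreserving_correlatedPair_fst (γ : Measure E) [IsProbabilityMeasure γ] (ρ : ℝ) :
    MeasurePreserving Prod.fst (correlatedPair γ ρ) γ := by
  refine ⟨measurable_fst, ?_⟩
  rw [correlatedPair, Measure.map_map measurable_fst (measurable_correlate ρ)]
  exact measurePreserving_fst.map_eq

variable [CompleteSpace E] {γ : Measure E} [IsGaussian γ]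

/-- A pair of independent copies of a centred Gaussian vector is invariant under the rotation of
angle `arccos ρ`. -/
lemma measurePreserving_rotate (hγ : γ[id] = 0) {ρ : ℝ} (h₁ : -1 ≤ ρ) (h₂ : ρ ≤ 1) :
    MeasurePreserving (fun p : E × E => (ρ • p.1 + Real.sqrt (1 - ρ ^ 2) • p.2,
      -Real.sqrt (1 - ρ ^ 2) • p.1 + ρ • p.2)) (γ.prod γ) (γ.prod γ) := by
  refine ⟨by fun_prop, ?_⟩
  have := IsGaussian.map_rotation_eq_self hγ (Real.arccos ρ)
  convert this using 2
  ext p <;> simp [ContinuousLinearMap.rotation, Real.cos_arccos h₁ h₂, Real.sin_arccos]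

lemma measurePreserving_neg_gaussian (hγ : γ[id] = 0) :
    MeasurePreserving (fun x : E => -x) γ γ := by
  have h := measurePreserving_rotate (γ := γ) hγ (ρ := -1) le_rfl (by norm_num)
  have h2 := (measurePreserving_fst (μ := γ) (ν := γ)).comp h
  refine ⟨measurable_neg, ?_⟩
  have h3 : (γ.prod γ).map ((fun x : E => -x) ∘ Prod.fst) = γ := by
    convert h2.map_eq using 2
    ext p
    simp
  rwa [← Measure.map_map measurable_neg measurable_fst, measurePreserving_fst.map_eq] at h3

lemma measurePreserving_correlatedPair_swap (hγ : γ[id] = 0) {ρ : ℝ} (h₁ : -1 ≤ ρ) (h₂ : ρ ≤ 1) :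
    MeasurePreserving Prod.swap (correlatedPair γ ρ) (correlatedPair γ ρ) := by
  refine ⟨measurable_swap, ?_⟩
  have h := ((MeasurePreserving.id γ).prod (measurePreserving_neg_gaussian hγ)).comp
    (measurePreserving_rotate hγ h₁ h₂)
  have h' := (measurePreserving_correlate γ ρ).comp h
  rw [correlatedPair, Measure.map_map measurable_swap (measurable_correlate ρ), ← correlatedPair,
    ← h'.map_eq]
  congr 1
  have hs : Real.sqrt (1 - ρ ^ 2) * Real.sqrt (1 - ρ ^ 2) = 1 - ρ ^ 2 :=
    Real.mul_self_sqrt (by nlinarith)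
  ext p
  · simp
  · simp only [Function.comp_apply, Prod.swap_prod_mk, Prod.map_apply, id_eq, smul_add, smul_smul,
      smul_neg, neg_add, neg_smul, neg_neg, hs]
    rw [mul_comm ρ (Real.sqrt _)]
    module

lemma measurePreserving_correlatedPair_snd (hγ : γ[id] = 0) {ρ : ℝ} (h₁ : -1 ≤ ρ) (h₂ : ρ ≤ 1) :
    MeasurePreserving Prod.snd (correlatedPair γ ρ) γ := by
  have := (measurePreserving_correlatedPair_fst γ ρ).comp
    (measurePreserving_correlatedPair_swap hγ h₁ h₂)
  exact this

end CorrelatedPair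

lemma integral_id_stdNormal : (N₁)[id] = 0 := by simp

/-! ### The copula `J` -/

lemma J_eq (ρ x y : ℝ) :
    J ρ x y = (correlatedPair N₁ ρ).real (lowerRay x ×ˢ lowerRay y) := rfl

lemma J_nonneg (ρ x y : ℝ) : 0 ≤ J ρ x y := measureReal_nonneg

lemma J_le_one (ρ x y : ℝ) : J ρ x y ≤ 1 := measureReal_le_one

lemma J_comm {ρ : ℝ} (h₁ : -1 ≤ ρ) (h₂ : ρ ≤ 1) (x y : ℝ) : J ρ x y = J ρ y x := by
  rw [J_eq, J_eq, ← (measurePreserving_correlatedPair_swap integral_id_stdNormal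
    h₁ h₂).measureReal_preimage
    ((measurableSet_lowerRay x).prod (measurableSet_lowerRay y)).nullMeasurableSet,
    preimage_swap_prod]

lemma J_zero_left (ρ y : ℝ) : J ρ 0 y = 0 := by simp [J_eq, lowerRay_zero]

lemma J_zero_right (ρ x : ℝ) : J ρ x 0 = 0 := by simp [J_eq, lowerRay_zero]

lemma J_one_one (ρ : ℝ) : J ρ 1 1 = 1 := by simp [J_eq, lowerRay_one]

lemma J_mono_left {ρ x x' : ℝ} (h : x ≤ x') (y : ℝ) : J ρ x y ≤ J ρ x' y := by
  rw [J_eq, J_eq]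
  exact measureReal_mono (prod_mono_left (lowerRay_mono h))

lemma J_sub_le_left {ρ x x' : ℝ} (hx : x ∈ Icc (0 : ℝ) 1) (hx' : x' ∈ Icc (0 : ℝ) 1) (h : x ≤ x')
    (y : ℝ) : J ρ x' y - J ρ x y ≤ x' - x := by
  have hm := measurableSet_lowerRay
  calc J ρ x' y - J ρ x y
      ≤ (correlatedPair N₁ ρ).real
          ((lowerRay x' ×ˢ lowerRay y) \ (lowerRay x ×ˢ lowerRay y)) := by
        rw [J_eq, J_eq]
        have := measureReal_sdiff (μ := correlatedPair N₁ ρ)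
          (prod_mono_left (t := lowerRay y) (lowerRay_mono h)) ((hm x).prod (hm y))
        exact this.ge
    _ ≤ (correlatedPair N₁ ρ).real (Prod.fst ⁻¹' (lowerRay x' \ lowerRay x)) := by
        refine measureReal_mono ?_
        rintro ⟨s, t⟩ ⟨⟨h1, h2⟩, h3⟩
        exact ⟨h1, fun h4 => h3 ⟨h4, h2⟩⟩
    _ = x' - x := by
        rw [(measurePreserving_correlatedPair_fst N₁ ρ).measureReal_preimage
          ((hm x').diff (hm x)).nullMeasurableSet,
          measureReal_sdiff (lowerRay_mono h) (hm x), real_lowerRay hx', real_lowerRay hx]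

lemma abs_J_sub_le_left {ρ x x' : ℝ} (hx : x ∈ Icc (0 : ℝ) 1) (hx' : x' ∈ Icc (0 : ℝ) 1)
    (y : ℝ) : |J ρ x' y - J ρ x y| ≤ |x' - x| := by
  rcases le_total x x' with h | h
  · rw [abs_of_nonneg (sub_nonneg.2 (J_mono_left h y)), abs_of_nonneg (sub_nonneg.2 h)]
    exact J_sub_le_left hx hx' h y
  · rw [abs_sub_comm, abs_sub_comm x', abs_of_nonneg (sub_nonneg.2 (J_mono_left h y)),
      abs_of_nonneg (sub_nonneg.2 h)]
    exact J_sub_le_left hx' hx h y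

/-- `J` is Lipschitz on the closed unit square. -/
lemma abs_J_sub_le {ρ : ℝ} (h₁ : -1 ≤ ρ) (h₂ : ρ ≤ 1) {x x' y y' : ℝ} (hx : x ∈ Icc (0 : ℝ) 1)
    (hx' : x' ∈ Icc (0 : ℝ) 1) (hy : y ∈ Icc (0 : ℝ) 1) (hy' : y' ∈ Icc (0 : ℝ) 1) :
    |J ρ x' y' - J ρ x y| ≤ |x' - x| + |y' - y| := by
  have h1 := abs_J_sub_le_left (ρ := ρ) hx hx' y'
  have h2 := abs_J_sub_le_left (ρ := ρ) hy hy' x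
  rw [J_comm h₁ h₂ y' x, J_comm h₁ h₂ y x] at h2
  calc |J ρ x' y' - J ρ x y| = |(J ρ x' y' - J ρ x y') + (J ρ x y' - J ρ x y)| := by ring_nf
    _ ≤ _ := (abs_add_le _ _).trans (add_le_add h1 h2)

lemma measureReal_prod_eq_integral {α β : Type*} [MeasurableSpace α] [MeasurableSpace β]
    (μ : Measure α) (ν : Measure β) [IsProbabilityMeasure μ] [IsProbabilityMeasure ν]
    {s : Set (α × β)} (hs : MeasurableSet s) :
    (μ.prod ν).real s = ∫ x, ν.real (Prod.mk x ⁻¹' s) ∂μ := by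
  rw [Measure.real, Measure.prod_apply hs]
  refine (integral_toReal (measurable_measure_prodMk_left hs).aemeasurable ?_).symm
  exact Eventually.of_forall fun x => measure_lt_top _ _

variable {ρ : ℝ}

lemma sqrt_one_sub_sq_pos (h₁ : -1 < ρ) (h₂ : ρ < 1) : 0 < Real.sqrt (1 - ρ ^ 2) :=
  Real.sqrt_pos.2 (by nlinarith)

lemma J_Phi_eq_integral (h₁ : -1 < ρ) (h₂ : ρ < 1) (v w : ℝ) :
    J ρ (Phi v) (Phi w) = ∫ s in Iic v, Phi ((w - ρ * s) / Real.sqrt (1 - ρ ^ 2)) ∂N₁ := by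
  have hr := sqrt_one_sub_sq_pos h₁ h₂
  have hms : MeasurableSet (Iic v ×ˢ Iic w : Set (ℝ × ℝ)) :=
    measurableSet_Iic.prod measurableSet_Iic
  rw [J_eq, lowerRay_of_mem (Phi_mem v), lowerRay_of_mem (Phi_mem w), quantile_Phi, quantile_Phi,
    ← (measurePreserving_correlate N₁ ρ).measureReal_preimage hms.nullMeasurableSet,
    measureReal_prod_eq_integral _ _ (measurable_correlate ρ hms),
    ← integral_indicator measurableSet_Iic]
  congr 1 with s
  by_cases hs : s ≤ v
  · rw [indicator_of_mem (by exact hs), Phi]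
    congr 1
    ext z
    simp only [mem_preimage, mem_prod, mem_Iic, smul_eq_mul, hs, true_and]
    rw [le_div_iff₀ hr]
    constructor <;> intro h <;> linarith
  · rw [indicator_of_notMem (by simpa using hs)]
    convert measureReal_empty
    ext z
    simp [hs]

/-- The partial derivative of `J` in its first variable, as a function on the unit square. -/
def dJ (ρ : ℝ) (z : ℝ × ℝ) : ℝ :=
  Phi ((quantile z.2 - ρ * quantile z.1) / Real.sqrt (1 - ρ ^ 2))

lemma hasDerivAt_J_left (h₁ : -1 < ρ) (h₂ : ρ < 1) {x y : ℝ} (hx : x ∈ Ioo (0 : ℝ) 1)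
    (hy : y ∈ Ioo (0 : ℝ) 1) : HasDerivAt (fun x => J ρ x y) (dJ ρ (x, y)) x := by
  have h := hasDerivAt_integral_Iic_gaussian
    (h := fun s => Phi ((quantile y - ρ * s) / Real.sqrt (1 - ρ ^ 2)))
    (continuous_Phi.comp (by fun_prop)) (C := 1)
    (fun s => by rw [abs_of_nonneg (Phi_nonneg _)]; exact Phi_le_one _) (quantile x)
  have h' := HasDerivAt.comp x h (hasDerivAt_quantile hx)
  have h3 : φ₁ (quantile x) * Phi ((quantile y - ρ * quantile x) / Real.sqrt (1 - ρ ^ 2)) *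
      (φ₁ (quantile x))⁻¹ = dJ ρ (x, y) := by
    have := (stdPDF_pos (quantile x)).ne'
    rw [dJ]
    field_simp
  rw [h3] at h'
  refine h'.congr_of_eventuallyEq ?_
  filter_upwards [isOpen_Ioo.mem_nhds hx] with t ht
  simp only [Function.comp_apply]
  rw [← J_Phi_eq_integral h₁ h₂, Phi_quantile ht, Phi_quantile hy]

lemma hasDerivAt_J_right (h₁ : -1 < ρ) (h₂ : ρ < 1) {x y : ℝ} (hx : x ∈ Ioo (0 : ℝ) 1)
    (hy : y ∈ Ioo (0 : ℝ) 1) : HasDerivAt (fun y => J ρ x y) (dJ ρ (y, x)) y := by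
  simp_rw [J_comm h₁.le h₂.le x]
  exact hasDerivAt_J_left h₁ h₂ hy hx

end Copula

/-! ### Second-order Taylor expansion of `J` -/

section Taylor

variable {ρ : ℝ}

lemma contDiffOn_dJ : ContDiffOn ℝ 3 (dJ ρ) (Ioo 0 1 ×ˢ Ioo 0 1) := by
  intro z hz
  refine ContDiffAt.contDiffWithinAt ?_
  refine contDiff_Phi.contDiffAt.comp z ?_
  refine ContDiffAt.div_const ?_ _
  exact ((quantile_contDiffAt hz.2).comp z contDiffAt_snd).sub
    (contDiffAt_const.mul ((quantile_contDiffAt hz.1).comp z contDiffAt_fst))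

/-- The second derivative `∂ₓₓ J`. -/
def ddJxx (ρ x y : ℝ) : ℝ := fderiv ℝ (dJ ρ) (x, y) (1, 0)

/-- The mixed second derivative `∂ₓᵧ J`. -/
def ddJxy (ρ x y : ℝ) : ℝ := fderiv ℝ (dJ ρ) (x, y) (0, 1)

lemma differentiableAt_dJ {z : ℝ × ℝ} (hz : z ∈ Ioo (0 : ℝ) 1 ×ˢ Ioo (0 : ℝ) 1) :
    DifferentiableAt ℝ (dJ ρ) z :=
  ((contDiffOn_dJ z hz).contDiffAt ((isOpen_Ioo.prod isOpen_Ioo).mem_nhds hz)).differentiableAt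
    (by norm_num)

lemma fderiv_dJ_apply (x y a b : ℝ) :
    fderiv ℝ (dJ ρ) (x, y) (a, b) = ddJxx ρ x y * a + ddJxy ρ x y * b := by
  have : ((a, b) : ℝ × ℝ) = a • (1, 0) + b • (0, 1) := by simp
  rw [this, map_add, map_smul, map_smul, ddJxx, ddJxy]
  simp [mul_comm]

lemma ddJxx_eq {x y : ℝ} (hx : x ∈ Ioo (0 : ℝ) 1) (hy : y ∈ Ioo (0 : ℝ) 1) :
    ddJxx ρ x y = -(ρ / Real.sqrt (1 - ρ ^ 2)) *
      φ₁ ((quantile y - ρ * quantile x) / Real.sqrt (1 - ρ ^ 2)) / φ₁ (quantile x) := by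
  have h1 : HasDerivAt (fun t => dJ ρ (t, y)) (ddJxx ρ x y) x := by
    have h2 : HasDerivAt (fun t : ℝ => (t, y)) (1, 0) x :=
      (hasDerivAt_id x).prodMk (hasDerivAt_const x y)
    exact HasFDerivAt.comp_hasDerivAt x
      (differentiableAt_dJ (z := (x, y)) ⟨hx, hy⟩).hasFDerivAt h2
  have h3 : HasDerivAt (fun t => dJ ρ (t, y)) _ x :=
    HasDerivAt.comp x (hasDerivAt_Phi _)
      ((((hasDerivAt_quantile hx).const_mul ρ).const_sub (quantile y)).div_const
        (Real.sqrt (1 - ρ ^ 2)))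
  rw [h1.unique h3]
  ring

lemma ddJxy_eq {x y : ℝ} (hx : x ∈ Ioo (0 : ℝ) 1) (hy : y ∈ Ioo (0 : ℝ) 1) :
    ddJxy ρ x y = (1 / Real.sqrt (1 - ρ ^ 2)) *
      φ₁ ((quantile y - ρ * quantile x) / Real.sqrt (1 - ρ ^ 2)) / φ₁ (quantile y) := by
  have h1 : HasDerivAt (fun t => dJ ρ (x, t)) (ddJxy ρ x y) y := by
    have h2 : HasDerivAt (fun t : ℝ => (x, t)) (0, 1) y :=
      (hasDerivAt_const y x).prodMk (hasDerivAt_id y)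
    exact HasFDerivAt.comp_hasDerivAt y
      (differentiableAt_dJ (z := (x, y)) ⟨hx, hy⟩).hasFDerivAt h2
  have h3 : HasDerivAt (fun t => dJ ρ (x, t)) _ y :=
    HasDerivAt.comp y (hasDerivAt_Phi _)
      (((hasDerivAt_quantile hy).sub_const (ρ * quantile x)).div_const
        (Real.sqrt (1 - ρ ^ 2)))
  rw [h1.unique h3]
  ring

/-- The conditional density of `Y` given `X = v` at `w`, divided by the density of `Y`, is
symmetric in `v` and `w`. -/
lemma stdPDF_ratio_symm (h₁ : -1 < ρ) (h₂ : ρ < 1) (v w : ℝ) :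
    φ₁ ((w - ρ * v) / Real.sqrt (1 - ρ ^ 2)) * φ₁ v =
      φ₁ ((v - ρ * w) / Real.sqrt (1 - ρ ^ 2)) * φ₁ w := by
  have hr : 0 < 1 - ρ ^ 2 := by nlinarith
  simp only [gaussianPDFReal, NNReal.coe_one, sub_zero, mul_one, div_pow, Real.sq_sqrt hr.le]
  simp only [mul_mul_mul_comm _ (Real.exp _), ← Real.exp_add]
  congr 2
  field_simp
  ring

/-- The matrix `(J_xx, ρ J_xy; ρ J_xy, J_yy)` is negative semidefinite. -/
lemma ddJ_form_nonpos (h₀ : 0 ≤ ρ) (h₂ : ρ < 1) {x y : ℝ} (hx : x ∈ Ioo (0 : ℝ) 1)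
    (hy : y ∈ Ioo (0 : ℝ) 1) {α β t : ℝ} (ht : t ≤ α * β) :
    ddJxx ρ x y * α ^ 2 + 2 * (ρ * ddJxy ρ x y * t) + ddJxx ρ y x * β ^ 2 ≤ 0 := by
  have h₁ : -1 < ρ := by linarith
  have hr := sqrt_one_sub_sq_pos h₁ h₂
  have hv := stdPDF_pos (quantile x)
  have hw := stdPDF_pos (quantile y)
  have hu := stdPDF_pos ((quantile y - ρ * quantile x) / Real.sqrt (1 - ρ ^ 2))
  have hs := stdPDF_ratio_symm h₁ h₂ (quantile x) (quantile y)
  rw [ddJxx_eq hx hy, ddJxx_eq hy hx, ddJxy_eq hx hy]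
  generalize quantile x = v at *
  generalize quantile y = w at *
  set r := Real.sqrt (1 - ρ ^ 2)
  rw [show φ₁ ((v - ρ * w) / r) = φ₁ ((w - ρ * v) / r) * φ₁ v / φ₁ w by
    rw [eq_div_iff hw.ne']; exact hs.symm]
  generalize φ₁ ((w - ρ * v) / r) = U at *
  generalize φ₁ v = V at *
  generalize φ₁ w = W at *
  have h : ρ * (1 / r * U / W) * t ≤ ρ * (1 / r * U / W) * (α * β) := by gcongr
  calc _ ≤ -(ρ / r) * U / V * α ^ 2 + 2 * (ρ * (1 / r * U / W) * (α * β)) +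
        -(ρ / r) * (U * V / W) / W * β ^ 2 := by linarith
    _ = -((ρ / r) * (U * V) * (α / V - β / W) ^ 2) := by
        field_simp
        ring
    _ ≤ 0 := by
        rw [neg_nonpos]
        positivity

lemma exists_dJ_taylor (ε : ℝ) (hε : 0 < ε) : ∃ C : ℝ, 0 ≤ C ∧
    ∀ z ∈ (Icc ε (1 - ε) ×ˢ Icc ε (1 - ε) : Set (ℝ × ℝ)),
      ‖fderiv ℝ (dJ ρ) z‖ ≤ C ∧
      ∀ z' ∈ (Icc ε (1 - ε) ×ˢ Icc ε (1 - ε) : Set (ℝ × ℝ)),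
        |dJ ρ z' - dJ ρ z| ≤ C * ‖z' - z‖ ∧
        |dJ ρ z' - dJ ρ z - fderiv ℝ (dJ ρ) z (z' - z)| ≤ C * ‖z' - z‖ ^ 2 := by
  set S : Set (ℝ × ℝ) := Icc ε (1 - ε) ×ˢ Icc ε (1 - ε)
  have hS : IsCompact S := isCompact_Icc.prod isCompact_Icc
  have hconv : Convex ℝ S := (convex_Icc _ _).prod (convex_Icc _ _)
  have hsub : S ⊆ Ioo 0 1 ×ˢ Ioo 0 1 :=
    prod_mono (fun x hx => ⟨by linarith [hx.1], by linarith [hx.2]⟩)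
      (fun x hx => ⟨by linarith [hx.1], by linarith [hx.2]⟩)
  have hopen : IsOpen (Ioo (0 : ℝ) 1 ×ˢ Ioo (0 : ℝ) 1) := isOpen_Ioo.prod isOpen_Ioo
  have hf' : ContDiffOn ℝ 2 (fderiv ℝ (dJ ρ)) (Ioo 0 1 ×ˢ Ioo 0 1) :=
    contDiffOn_dJ.fderiv_of_isOpen hopen (by norm_num)
  obtain ⟨K, hK⟩ := (hf'.mono hsub).exists_lipschitzOnWith (by norm_num) hconv hS
  obtain ⟨B, hB⟩ := hS.exists_bound_of_continuousOn (hf'.mono hsub).continuousOn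
  refine ⟨max (max B 0) K, le_max_of_le_left (le_max_right _ _), fun z hz => ⟨?_, fun z' hz' => ?_⟩⟩
  · exact (hB z hz).trans (le_max_of_le_left (le_max_left _ _))
  have hder : ∀ u ∈ S, HasFDerivWithinAt (dJ ρ) (fderiv ℝ (dJ ρ) u) S u := fun u hu =>
    (differentiableAt_dJ (hsub hu)).hasFDerivAt.hasFDerivWithinAt
  constructor
  · refine (hconv.norm_image_sub_le_of_norm_hasFDerivWithin_le hder hB hz hz').trans ?_
    gcongr
    exact le_max_of_le_left (le_max_left _ _)
  · have hconv' : Convex ℝ (S ∩ Metric.closedBall z ‖z' - z‖) :=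
      hconv.inter (convex_closedBall _ _)
    have := hconv'.norm_image_sub_le_of_norm_hasFDerivWithin_le' (f := dJ ρ)
      (f' := fderiv ℝ (dJ ρ)) (φ := fderiv ℝ (dJ ρ) z) (C := K * ‖z' - z‖)
      (fun u hu => (hder u hu.1).mono inter_subset_left) (fun u hu => ?_)
      (x := z) (y := z') ⟨hz, by simp⟩ ⟨hz', by simp [dist_eq_norm]⟩
    · refine this.trans ?_
      rw [mul_assoc, ← sq]
      gcongr
      exact le_max_right _ _
    · refine (hK.norm_sub_le hu.1 hz).trans ?_
      gcongr
      simpa [dist_eq_norm] using hu.2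

lemma abs_sub_affine_le_of_hasDerivAt {h h' : ℝ → ℝ} {x x' α β D : ℝ}
    (hd : ∀ s ∈ uIcc x x', HasDerivAt h (h' s) s)
    (hb : ∀ s ∈ uIcc x x', |h' s - (α + β * (s - x))| ≤ D) :
    |h x' - h x - (α * (x' - x) + β * (x' - x) ^ 2 / 2)| ≤ D * |x' - x| := by
  have := (convex_uIcc x x').norm_image_sub_le_of_norm_hasDerivWithin_le
    (f := fun s => h s - (α * (s - x) + β * (s - x) ^ 2 / 2))
    (f' := fun s => h' s - (α + β * (s - x))) (C := D) (fun s hs => ?_) hb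
    left_mem_uIcc right_mem_uIcc
  · simp only [Real.norm_eq_abs] at this
    convert this using 2
    ring
  · refine ((hd s hs).sub ?_).hasDerivWithinAt
    have h1 : HasDerivAt (fun s => s - x) 1 s := (hasDerivAt_id s).sub_const x
    refine ((h1.const_mul α).add (((h1.pow 2).const_mul β).div_const 2)).congr_deriv ?_
    push_cast
    ring

/-- First and second order Taylor expansions of `J`, uniformly on compact sub-squares. The
increment is split as `(x, y) → (x, y') → (x', y')`, so that only the first-order expansion of
`∂ₓ J` and the symmetry of `J` are used. -/
lemma exists_J_taylor (h₁ : -1 < ρ) (h₂ : ρ < 1) (ε : ℝ) (hε : 0 < ε) : ∃ C : ℝ, 0 ≤ C ∧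
    ∀ x ∈ Icc ε (1 - ε), ∀ y ∈ Icc ε (1 - ε),
      |ddJxx ρ x y| ≤ C ∧ |ddJxy ρ x y| ≤ C ∧ |ddJxx ρ y x| ≤ C ∧
      ∀ x' ∈ Icc ε (1 - ε), ∀ y' ∈ Icc ε (1 - ε), ∀ d : ℝ, |x' - x| ≤ d → |y' - y| ≤ d →
        |J ρ x' y' - J ρ x y - (dJ ρ (x, y) * (x' - x) + dJ ρ (y, x) * (y' - y))| ≤ C * d ^ 2 ∧
        |J ρ x' y' - J ρ x y - (dJ ρ (x, y) * (x' - x) + dJ ρ (y, x) * (y' - y)) -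
          (ddJxx ρ x y * (x' - x) ^ 2 + 2 * (ddJxy ρ x y * ((x' - x) * (y' - y))) +
            ddJxx ρ y x * (y' - y) ^ 2) / 2| ≤ C * d ^ 3 := by
  obtain ⟨C, hC, hT⟩ := exists_dJ_taylor (ρ := ρ) ε hε
  refine ⟨2 * C, by positivity, fun x hx y hy => ?_⟩
  have hsub : ∀ {u}, u ∈ Icc ε (1 - ε) → u ∈ Ioo (0 : ℝ) 1 := fun hu =>
    ⟨by linarith [hu.1], by linarith [hu.2]⟩
  have hbd : ∀ {u v : ℝ}, u ∈ Icc ε (1 - ε) → v ∈ Icc ε (1 - ε) →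
      |ddJxx ρ u v| ≤ 2 * C ∧ |ddJxy ρ u v| ≤ 2 * C := by
    intro u v hu hv
    have hn := (hT (u, v) ⟨hu, hv⟩).1
    constructor
    · have := (fderiv ℝ (dJ ρ) (u, v)).le_opNorm (1, 0)
      simp only [Prod.norm_mk, norm_one, norm_zero, zero_le_one, sup_of_le_left, mul_one] at this
      rw [Real.norm_eq_abs, ← ddJxx] at this
      linarith
    · have := (fderiv ℝ (dJ ρ) (u, v)).le_opNorm (0, 1)
      simp only [Prod.norm_mk, norm_one, norm_zero, zero_le_one, sup_of_le_right, mul_one] at this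
      rw [Real.norm_eq_abs, ← ddJxy] at this
      linarith
  refine ⟨(hbd hx hy).1, (hbd hx hy).2, (hbd hy hx).1, fun x' hx' y' hy' d hdx hdy => ?_⟩
  have hd : 0 ≤ d := (abs_nonneg _).trans hdx
  have hsx : ∀ s ∈ uIcc x x', s ∈ Icc ε (1 - ε) ∧ |s - x| ≤ d := fun s hs =>
    ⟨(ordConnected_Icc.uIcc_subset hx hx') hs, (abs_sub_left_of_mem_uIcc hs).trans hdx⟩
  have hsy : ∀ s ∈ uIcc y y', s ∈ Icc ε (1 - ε) ∧ |s - y| ≤ d := fun s hs =>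
    ⟨(ordConnected_Icc.uIcc_subset hy hy') hs, (abs_sub_left_of_mem_uIcc hs).trans hdy⟩
  have hderx : ∀ s ∈ uIcc x x', HasDerivAt (fun x => J ρ x y') (dJ ρ (s, y')) s := fun s hs =>
    hasDerivAt_J_left h₁ h₂ (hsub (hsx s hs).1) (hsub hy')
  have hdery : ∀ s ∈ uIcc y y', HasDerivAt (fun y => J ρ x y) (dJ ρ (s, x)) s := fun s hs =>
    hasDerivAt_J_right h₁ h₂ (hsub hx) (hsub (hsy s hs).1)
  have hn1 : ∀ s ∈ uIcc x x', ‖((s, y') : ℝ × ℝ) - (x, y)‖ ≤ d := fun s hs => by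
    simp [Prod.norm_def, (hsx s hs).2, hdy]
  have hn2 : ∀ s ∈ uIcc y y', ‖((s, x) : ℝ × ℝ) - (y, x)‖ ≤ d := fun s hs => by
    simp [Prod.norm_def, (hsy s hs).2]
  constructor
  · have e1 := abs_sub_affine_le_of_hasDerivAt (α := dJ ρ (x, y)) (β := 0) (D := C * d) hderx
      (fun s hs => by
        have := ((hT (x, y) ⟨hx, hy⟩).2 (s, y') ⟨(hsx s hs).1, hy'⟩).1
        simpa using this.trans (mul_le_mul_of_nonneg_left (hn1 s hs) hC))
    have e2 := abs_sub_affine_le_of_hasDerivAt (α := dJ ρ (y, x)) (β := 0) (D := C * d) hdery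
      (fun s hs => by
        have := ((hT (y, x) ⟨hy, hx⟩).2 (s, x) ⟨(hsy s hs).1, hx⟩).1
        simpa using this.trans (mul_le_mul_of_nonneg_left (hn2 s hs) hC))
    have e3 : C * d * |x' - x| ≤ C * d * d := by gcongr
    have e4 : C * d * |y' - y| ≤ C * d * d := by gcongr
    refine le_trans (le_of_eq_of_le ?_ (abs_add_le _ _))
      ((add_le_add (e1.trans e3) (e2.trans e4)).trans (by linarith))
    congr 1
    ring
  · have e1 := abs_sub_affine_le_of_hasDerivAt (α := dJ ρ (x, y) + ddJxy ρ x y * (y' - y))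
      (β := ddJxx ρ x y) (D := C * d ^ 2) hderx
      (fun s hs => by
        have := ((hT (x, y) ⟨hx, hy⟩).2 (s, y') ⟨(hsx s hs).1, hy'⟩).2
        rw [Prod.mk_sub_mk, fderiv_dJ_apply, ← Prod.mk_sub_mk] at this
        have h4 : C * ‖((s, y') : ℝ × ℝ) - (x, y)‖ ^ 2 ≤ C * d ^ 2 := by
          gcongr
          exact hn1 s hs
        refine le_of_eq_of_le ?_ (this.trans h4)
        congr 1
        ring)
    have e2 := abs_sub_affine_le_of_hasDerivAt (α := dJ ρ (y, x))
      (β := ddJxx ρ y x) (D := C * d ^ 2) hdery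
      (fun s hs => by
        have := ((hT (y, x) ⟨hy, hx⟩).2 (s, x) ⟨(hsy s hs).1, hx⟩).2
        rw [Prod.mk_sub_mk, fderiv_dJ_apply, ← Prod.mk_sub_mk] at this
        have h4 : C * ‖((s, x) : ℝ × ℝ) - (y, x)‖ ^ 2 ≤ C * d ^ 2 := by
          gcongr
          exact hn2 s hs
        refine le_of_eq_of_le ?_ (this.trans h4)
        congr 1
        ring)
    have e3 : C * d ^ 2 * |x' - x| ≤ C * d ^ 2 * d := by gcongr
    have e4 : C * d ^ 2 * |y' - y| ≤ C * d ^ 2 * d := by gcongr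
    refine le_trans (le_of_eq_of_le ?_ (abs_add_le _ _))
      ((add_le_add (e1.trans e3) (e2.trans e4)).trans (by linarith))
    congr 1
    ring

end Taylor

/-! ### Second moments and averaging -/

section Moments

lemma integral_comp_measurePreserving {α β F : Type*} [MeasurableSpace α] [MeasurableSpace β]
    [NormedAddCommGroup F] [NormedSpace ℝ F] {μ : Measure α} {ν : Measure β} {f : α → β}
    (h : MeasurePreserving f μ ν) {g : β → F} (hg : AEStronglyMeasurable g ν) :
    ∫ x, g (f x) ∂μ = ∫ y, g y ∂ν := by
  rw [← h.map_eq, integral_map h.aemeasurable (h.map_eq.symm ▸ hg)]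

lemma measurable_J (ρ : ℝ) : Measurable (fun z : ℝ × ℝ => J ρ z.1 z.2) := by
  have hs : MeasurableSet {p : (ℝ × ℝ) × (ℝ × ℝ) |
      (p.2.1 : EReal) ≤ PhiInv p.1.1 ∧ (p.2.2 : EReal) ≤ PhiInv p.1.2} := by
    refine MeasurableSet.inter ?_ ?_
    · exact measurableSet_le (measurable_coe_real_ereal.comp (by fun_prop))
        (measurable_PhiInv.comp (by fun_prop))
    · exact measurableSet_le (measurable_coe_real_ereal.comp (by fun_prop))
        (measurable_PhiInv.comp (by fun_prop))
  exact (measurable_measure_prodMk_left (ν := correlatedPair N₁ ρ) hs).ennreal_toReal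

lemma integrable_of_mem_Icc {α : Type*} [MeasurableSpace α] {μ : Measure α} [IsFiniteMeasure μ]
    {f : α → ℝ} (hf : Measurable f) {a b : ℝ} (hb : ∀ x, f x ∈ Icc a b) : Integrable f μ :=
  Integrable.of_mem_Icc a b hf.aemeasurable (Eventually.of_forall hb)

lemma integral_mem_Icc {α : Type*} [MeasurableSpace α] {μ : Measure α} [IsProbabilityMeasure μ]
    {f : α → ℝ} (hf : Measurable f) {a b : ℝ} (hb : ∀ x, f x ∈ Icc a b) :
    ∫ x, f x ∂μ ∈ Icc a b := by
  have hi := integrable_of_mem_Icc (μ := μ) hf hb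
  constructor
  · simpa using integral_mono (integrable_const a) hi (fun x => (hb x).1)
  · simpa using integral_mono hi (integrable_const b) (fun x => (hb x).2)

lemma measurable_J_comp {α : Type*} [MeasurableSpace α] (ρ : ℝ) {f g : α → ℝ} (hf : Measurable f)
    (hg : Measurable g) : Measurable (fun z => J ρ (f z) (g z)) := by
  have h := (measurable_J ρ).comp (hf.prodMk hg)
  simpa only [Function.comp_def] using h

lemma integrable_J_comp {α : Type*} [MeasurableSpace α] {μ : Measure α} [IsFiniteMeasure μ]
    (ρ : ℝ) {f g : α → ℝ} (hf : Measurable f) (hg : Measurable g) :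
    Integrable (fun z => J ρ (f z) (g z)) μ :=
  integrable_of_mem_Icc (measurable_J_comp ρ hf hg) fun _ => ⟨J_nonneg _ _ _, J_le_one _ _ _⟩

section Average

variable {E : Type*} [NormedAddCommGroup E] [NormedSpace ℝ E] [MeasurableSpace E] [BorelSpace E]
  [SecondCountableTopology E] [CompleteSpace E]

/-- If `Z`, `W` are independent copies of a centred Gaussian vector, then so is
`(Z + W) / √2`. -/
lemma measurePreserving_half_add {γ : Measure E} [IsGaussian γ] (hγ : γ[id] = 0) :
    MeasurePreserving (fun p : E × E => (Real.sqrt 2)⁻¹ • (p.1 + p.2)) (γ.prod γ) γ := by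
  have h2 : (1 : ℝ) ≤ Real.sqrt 2 := Real.one_le_sqrt.2 one_le_two
  have h0 : (0 : ℝ) ≤ (Real.sqrt 2)⁻¹ := by positivity
  have h := (measurePreserving_fst (μ := γ) (ν := γ)).comp
    (measurePreserving_rotate hγ (ρ := (Real.sqrt 2)⁻¹) (by linarith) (inv_le_one_of_one_le₀ h2))
  convert h using 1
  ext p
  have : Real.sqrt (1 - (Real.sqrt 2)⁻¹ ^ 2) = (Real.sqrt 2)⁻¹ := by
    rw [Real.sqrt_eq_iff_mul_self_eq (by rw [inv_pow]; norm_num) h0, ← sq, inv_pow,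
      Real.sq_sqrt zero_le_two]
    norm_num
  simp only [Function.comp_apply, this, smul_add]

/-- The average of `f` over a Gaussian cloud of width `δ` around `x`. -/
def average {F : Type*} [NormedAddCommGroup F] [NormedSpace ℝ F] (γ : Measure E) (δ : ℝ)
    (f : E → F) (x : E) : F := ∫ z, f (x + δ • z) ∂γ

lemma average_average {γ : Measure E} [IsGaussian γ] (hγ : γ[id] = 0) (δ : ℝ) {f : E → ℝ}
    (hf : Measurable f) {a b : ℝ} (hb : ∀ x, f x ∈ Icc a b) (x : E) :
    average γ δ (average γ δ f) x = average γ (Real.sqrt 2 * δ) f x := by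
  unfold average
  rw [← integral_comp_measurePreserving (measurePreserving_half_add hγ)
    (g := fun z => f (x + (Real.sqrt 2 * δ) • z)) (hf.comp (by fun_prop)).aestronglyMeasurable,
    integral_prod]
  · congr 1 with z
    congr 1 with w
    congr 1
    rw [smul_smul, mul_right_comm, mul_inv_cancel₀ (by positivity), one_mul, smul_add, add_assoc]
  · exact integrable_of_mem_Icc (hf.comp (by fun_prop)) fun _ => hb _

end Average

variable {E : Type*} [NormedAddCommGroup E] [InnerProductSpace ℝ E] [FiniteDimensional ℝ E]
  [MeasurableSpace E] [BorelSpace E]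

lemma integral_inner_stdGaussian (c : E) : ∫ z, inner ℝ c z ∂(stdGaussian E) = 0 :=
  integral_strongDual_stdGaussian (innerSL ℝ c)

lemma integrable_inner_stdGaussian (c : E) : Integrable (fun z => inner ℝ c z) (stdGaussian E) :=
  (innerSL ℝ c).integrable_comp IsGaussian.integrable_id

lemma memLp_inner_stdGaussian (c : E) : MemLp (fun z => inner ℝ c z) 2 (stdGaussian E) :=
  (innerSL ℝ c).comp_memLp' IsGaussian.memLp_two_id

lemma integral_inner_mul_inner_stdGaussian (c d : E) :
    ∫ z, inner ℝ c z * inner ℝ d z ∂(stdGaussian E) = inner ℝ c d := by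
  have h := covarianceBilin_apply (μ := stdGaussian E) IsGaussian.memLp_two_id c d
  rw [covarianceBilin_stdGaussian, innerSL_apply_apply] at h
  simpa using h.symm

lemma measurePreserving_stdPair_snd {ρ : ℝ} (h₁ : -1 ≤ ρ) (h₂ : ρ ≤ 1) :
    MeasurePreserving Prod.snd (correlatedPair (stdGaussian E) ρ) (stdGaussian E) :=
  measurePreserving_correlatedPair_snd (by simp) h₁ h₂

lemma integral_inner_mul_inner_correlatedPair (ρ : ℝ) (c d : E) :
    ∫ z, inner ℝ c z.1 * inner ℝ d z.2 ∂(correlatedPair (stdGaussian E) ρ) =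
      ρ * inner ℝ c d := by
  rw [← integral_comp_measurePreserving (measurePreserving_correlate _ ρ)
    (by fun_prop : Measurable _).aestronglyMeasurable]
  have h1 : Integrable (fun z : E × E => ρ * (inner ℝ c z.1 * inner ℝ d z.1))
      ((stdGaussian E).prod (stdGaussian E)) :=
    (((memLp_inner_stdGaussian c).integrable_mul
      (memLp_inner_stdGaussian d)).comp_fst _).const_mul _
  have h2 : Integrable (fun z : E × E => Real.sqrt (1 - ρ ^ 2) * (inner ℝ c z.1 * inner ℝ d z.2))
      ((stdGaussian E).prod (stdGaussian E)) :=
    ((integrable_inner_stdGaussian c).mul_prod (integrable_inner_stdGaussian d)).const_mul _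
  have h3 : ∀ z : E × E, inner ℝ c z.1 * inner ℝ d (ρ • z.1 + Real.sqrt (1 - ρ ^ 2) • z.2) =
      ρ * (inner ℝ c z.1 * inner ℝ d z.1) +
        Real.sqrt (1 - ρ ^ 2) * (inner ℝ c z.1 * inner ℝ d z.2) := by
    intro z
    rw [inner_add_right, inner_smul_right, inner_smul_right]
    ring
  simp only [h3]
  rw [integral_add h1 h2, integral_const_mul, integral_const_mul,
    integral_prod_mul (fun x => inner ℝ c x) (fun x => inner ℝ d x), integral_inner_stdGaussian,
    integral_fun_fst (fun x : E => inner ℝ c x * inner ℝ d x),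
    integral_inner_mul_inner_stdGaussian]
  simp

instance isGaussian_correlatedPair (ρ : ℝ) : IsGaussian (correlatedPair (stdGaussian E) ρ) :=
  isGaussian_map (μ := (stdGaussian E).prod (stdGaussian E))
    ((ContinuousLinearMap.fst ℝ E E).prod
      (ρ • ContinuousLinearMap.fst ℝ E E + Real.sqrt (1 - ρ ^ 2) • ContinuousLinearMap.snd ℝ E E))

lemma integral_id_correlatedPair {ρ : ℝ} (h₁ : -1 ≤ ρ) (h₂ : ρ ≤ 1) :
    (correlatedPair (stdGaussian E) ρ)[id] = 0 := by
  have hi : Integrable (id : E × E → E × E) (correlatedPair (stdGaussian E) ρ) :=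
    IsGaussian.integrable_id
  ext
  · rw [fst_integral hi]
    simpa using integral_comp_measurePreserving
      (measurePreserving_correlatedPair_fst (stdGaussian E) ρ) (g := id) (by fun_prop)
  · rw [snd_integral hi]
    simpa using integral_comp_measurePreserving
      (measurePreserving_stdPair_snd (E := E) h₁ h₂) (g := id) (by fun_prop)

end Moments

/-! ### Borell's inequality -/

section Borell

variable {E : Type*} [NormedAddCommGroup E] [InnerProductSpace ℝ E] [FiniteDimensional ℝ E]
  [MeasurableSpace E] [BorelSpace E]

/-- `f` takes values in `[ε, 1 - ε]` and has first-order expansions with gradient `c`, where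
`‖c‖ ≤ L` and the error is at most `M ‖h‖ ^ 2`. This is a form of `C^{1,1}` regularity that
passes to averages without differentiating under the integral sign. -/
structure HasExpansion (ε L M : ℝ) (f : E → ℝ) (c : E → E) : Prop where
  mem : ∀ x, f x ∈ Icc ε (1 - ε)
  measurable : Measurable f
  measurable_grad : Measurable c
  norm_grad_le : ∀ x, ‖c x‖ ≤ L
  expansion : ∀ x h, |f (x + h) - f x - inner ℝ (c x) h| ≤ M * ‖h‖ ^ 2

lemma measurable_average {F : Type*} [NormedAddCommGroup F] [NormedSpace ℝ F] [MeasurableSpace F]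
    [BorelSpace F] [SecondCountableTopology F] (γ : Measure E) [SFinite γ] (δ : ℝ) {f : E → F}
    (hf : Measurable f) : Measurable (average γ δ f) := by
  refine StronglyMeasurable.measurable ?_
  unfold average
  refine StronglyMeasurable.integral_prod_right (f := fun x z => f (x + δ • z)) ?_
  exact (hf.comp (by fun_prop : Measurable fun p : E × E => p.1 + δ • p.2)).stronglyMeasurable

lemma HasExpansion.average {ε L M : ℝ} {f : E → ℝ} {c : E → E} (hf : HasExpansion ε L M f c)
    (γ : Measure E) [IsProbabilityMeasure γ] (δ : ℝ) :
    HasExpansion ε L M (average γ δ f) (average γ δ c) := by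
  have hfi : ∀ x, Integrable (fun z => f (x + δ • z)) γ := fun x =>
    integrable_of_mem_Icc (hf.measurable.comp (by fun_prop)) fun z => hf.mem _
  have hci : ∀ x, Integrable (fun z => c (x + δ • z)) γ := fun x =>
    Integrable.of_bound (hf.measurable_grad.comp (by fun_prop)).aestronglyMeasurable L
      (Eventually.of_forall fun z => hf.norm_grad_le _)
  refine ⟨fun x => integral_mem_Icc (hf.measurable.comp (by fun_prop)) fun z => hf.mem _,
    measurable_average γ δ hf.measurable, measurable_average γ δ hf.measurable_grad, fun x => ?_,
    fun x h => ?_⟩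
  · have := norm_integral_le_of_norm_le_const (μ := γ) (f := fun z => c (x + δ • z)) (C := L)
      (Eventually.of_forall fun z => hf.norm_grad_le _)
    rwa [probReal_univ, mul_one] at this
  · have h1 : ∫ z, inner ℝ (c (x + δ • z)) h ∂γ = inner ℝ (∫ z, c (x + δ • z) ∂γ) h := by
      simp_rw [real_inner_comm h]
      rw [integral_inner (hci x)]
    have hii : Integrable (fun z => inner ℝ (c (x + δ • z)) h) γ := (hci x).inner_const h
    unfold GaussianStability.average
    rw [← h1, ← integral_sub (hfi (x + h)) (hfi x),
      ← integral_sub (f := fun z => f (x + h + δ • z) - f (x + δ • z))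
      ((hfi (x + h)).sub (hfi x)) hii]
    have := norm_integral_le_of_norm_le_const (μ := γ) (C := M * ‖h‖ ^ 2)
      (f := fun z => f (x + h + δ • z) - f (x + δ • z) - inner ℝ (c (x + δ • z)) h)
      (Eventually.of_forall fun z => by
        have := hf.expansion (x + δ • z) h
        rwa [Real.norm_eq_abs, add_right_comm x h])
    simpa using this

/-- The functional Borell inequality for increments of size `δ` and up to an error `e`, on the
class of functions with controlled expansions. -/
def BorellUpTo (E : Type*) [NormedAddCommGroup E] [InnerProductSpace ℝ E] [FiniteDimensional ℝ E]
    [MeasurableSpace E] (ρ ε L M δ e : ℝ) : Prop :=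
  ∀ (f g : E → ℝ) (c d : E → E), HasExpansion ε L M f c → HasExpansion ε L M g d → ∀ x y : E,
    ∫ z, J ρ (f (x + δ • z.1)) (g (y + δ • z.2)) ∂(correlatedPair (stdGaussian E) ρ) ≤
      J ρ (average (stdGaussian E) δ f x) (average (stdGaussian E) δ g y) + e

omit [FiniteDimensional ℝ E] [BorelSpace E] in
lemma HasExpansion.increment_bounds {ε L M : ℝ} {f : E → ℝ} {c : E → E}
    (hf : HasExpansion ε L M f c) (hL : 0 ≤ L) (hM : 0 ≤ M) {δ : ℝ} (hδ : 0 ≤ δ) (hδ' : δ ≤ 1)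
    (x z : E) {W : ℝ} (hW : 1 ≤ W) (hz : ‖z‖ ≤ W) :
    |f (x + δ • z) - f x| ≤ δ * (L + M) * W ^ 2 ∧
    |δ * inner ℝ (c x) z| ≤ δ * (L + M) * W ^ 2 ∧
    |f (x + δ • z) - f x - δ * inner ℝ (c x) z| ≤ δ ^ 2 * (L + M) * W ^ 2 := by
  have hz2 : ‖z‖ ^ 2 ≤ W ^ 2 := by gcongr
  have hWW : W ≤ W ^ 2 := by nlinarith
  have h1 : |f (x + δ • z) - f x - δ * inner ℝ (c x) z| ≤ δ ^ 2 * M * W ^ 2 := by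
    have := hf.expansion x (δ • z)
    rw [inner_smul_right, norm_smul, Real.norm_of_nonneg hδ, mul_pow] at this
    calc _ ≤ _ := this
      _ = δ ^ 2 * M * ‖z‖ ^ 2 := by ring
      _ ≤ _ := by gcongr
  have h2 : |δ * inner ℝ (c x) z| ≤ δ * L * W ^ 2 := by
    rw [abs_mul, abs_of_nonneg hδ, mul_assoc]
    gcongr
    calc |inner ℝ (c x) z| ≤ ‖c x‖ * ‖z‖ := abs_real_inner_le_norm _ _
      _ ≤ L * W ^ 2 := mul_le_mul (hf.norm_grad_le x) (hz.trans hWW) (norm_nonneg _) hL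
  have h3 : δ ^ 2 * M * W ^ 2 ≤ δ * M * W ^ 2 := by
    gcongr
    nlinarith
  refine ⟨?_, h2.trans ?_, h1.trans ?_⟩
  · calc |f (x + δ • z) - f x|
        = |(f (x + δ • z) - f x - δ * inner ℝ (c x) z) + δ * inner ℝ (c x) z| := by ring_nf
      _ ≤ _ := abs_add_le _ _
      _ ≤ δ * M * W ^ 2 + δ * L * W ^ 2 := add_le_add (h1.trans h3) h2
      _ = _ := by ring
  · gcongr
    linarith
  · gcongr
    linarith

/-- Quadratic terms in the increments may be replaced by those in their linear parts. -/
lemma abs_quadratic_sub_le {a b e B u v l k s t : ℝ} (ha : |a| ≤ B) (hb : |b| ≤ B) (he : |e| ≤ B)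
    (hu : |u| ≤ s) (hv : |v| ≤ s) (hl : |l| ≤ s) (hk : |k| ≤ s) (hul : |u - l| ≤ t)
    (hvk : |v - k| ≤ t) :
    |(a * u ^ 2 + 2 * (b * (u * v)) + e * v ^ 2) - (a * l ^ 2 + 2 * (b * (l * k)) + e * k ^ 2)| ≤
      8 * B * s * t := by
  have hB : 0 ≤ B := (abs_nonneg _).trans ha
  have ht : 0 ≤ t := (abs_nonneg _).trans hul
  have hs : 0 ≤ s := (abs_nonneg _).trans hu
  have e1 : |a * ((u - l) * (u + l))| ≤ B * (t * (s + s)) := by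
    rw [abs_mul, abs_mul]
    gcongr
    exact (abs_add_le _ _).trans (add_le_add hu hl)
  have e2 : |e * ((v - k) * (v + k))| ≤ B * (t * (s + s)) := by
    rw [abs_mul, abs_mul]
    gcongr
    exact (abs_add_le _ _).trans (add_le_add hv hk)
  have e3 : |2 * b * ((u - l) * v + l * (v - k))| ≤ 2 * B * (t * s + s * t) := by
    rw [abs_mul, abs_mul, abs_two]
    gcongr
    refine (abs_add_le _ _).trans ?_
    rw [abs_mul, abs_mul]
    gcongr
  calc _ = |a * ((u - l) * (u + l)) + 2 * b * ((u - l) * v + l * (v - k)) +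
        e * ((v - k) * (v + k))| := by ring_nf
    _ ≤ _ := abs_add_three _ _ _
    _ ≤ B * (t * (s + s)) + 2 * B * (t * s + s * t) + B * (t * (s + s)) := by gcongr
    _ = _ := by ring

variable {ρ : ℝ}

lemma integrable_cloud_weight (h₁ : -1 ≤ ρ) (h₂ : ρ ≤ 1) :
    Integrable (fun z : E × E => (1 + ‖z.1‖ + ‖z.2‖) ^ 6) (correlatedPair (stdGaussian E) ρ) := by
  have mp1 := measurePreserving_correlatedPair_fst (stdGaussian E) ρ
  have mp2 := measurePreserving_stdPair_snd (E := E) h₁ h₂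
  have m : MemLp (fun z : E => ‖z‖) (6 : ℕ) (stdGaussian E) :=
    (IsGaussian.memLp_id (stdGaussian E) (6 : ℕ) (by simp)).norm
  have m0 : MemLp (fun _ : E × E => (1 : ℝ)) (6 : ℕ) (correlatedPair (stdGaussian E) ρ) :=
    memLp_const 1
  have m1 := m0.add (m.comp_measurePreserving mp1)
  have m2 : MemLp (fun z : E × E => 1 + ‖z.1‖ + ‖z.2‖) (6 : ℕ)
    (correlatedPair (stdGaussian E) ρ) := m1.add (m.comp_measurePreserving mp2)
  refine m2.integrable_norm_pow'.congr (Eventually.of_forall fun z => ?_)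
  have : 0 ≤ 1 + ‖z.1‖ + ‖z.2‖ := by positivity
  simp only [Real.norm_of_nonneg this]

lemma HasExpansion.abs_average_sub_le {ε L M : ℝ} {f : E → ℝ} {c : E → E}
    (hf : HasExpansion ε L M f c) (δ : ℝ) (x : E) :
    |GaussianStability.average (stdGaussian E) δ f x - f x| ≤
      δ ^ 2 * (M * ∫ z, ‖z‖ ^ 2 ∂(stdGaussian E)) := by
  have h2 : Integrable (fun z : E => ‖z‖ ^ 2) (stdGaussian E) :=
    (IsGaussian.memLp_two_id (μ := stdGaussian E)).integrable_norm_pow (p := 2) (by norm_num)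
  have hi : Integrable (fun z => f (x + δ • z)) (stdGaussian E) :=
    integrable_of_mem_Icc (hf.measurable.comp (by fun_prop)) fun z => hf.mem _
  have hl := (integrable_inner_stdGaussian (c x)).const_mul δ
  have h1 : GaussianStability.average (stdGaussian E) δ f x - f x =
      ∫ z, (f (x + δ • z) - f x - δ * inner ℝ (c x) z) ∂(stdGaussian E) := by
    have hfx : Integrable (fun _ => f x) (stdGaussian E) := integrable_const _
    rw [integral_sub (f := fun z => f (x + δ • z) - f x) (hi.sub hfx) hl, integral_const_mul,
      integral_inner_stdGaussian, integral_sub hi hfx, GaussianStability.average]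
    simp
  rw [h1, ← mul_assoc, ← integral_const_mul]
  rw [← Real.norm_eq_abs]
  refine norm_integral_le_of_norm_le (h2.const_mul (δ ^ 2 * M)) (Eventually.of_forall fun z => ?_)
  have := hf.expansion x (δ • z)
  rw [inner_smul_right, norm_smul, mul_pow, Real.norm_eq_abs, sq_abs] at this
  rw [Real.norm_eq_abs]
  linarith

/-- The expectation of the second-order term of the expansion of `J` along a small increment. -/
lemma integral_quadratic (h₁ : -1 ≤ ρ) (h₂ : ρ ≤ 1) (a b e : ℝ) (c d : E) :
    Integrable (fun z : E × E => a * inner ℝ c z.1 ^ 2 + 2 * (b * (inner ℝ c z.1 * inner ℝ d z.2)) +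
      e * inner ℝ d z.2 ^ 2) (correlatedPair (stdGaussian E) ρ) ∧
    ∫ z, (a * inner ℝ c z.1 ^ 2 + 2 * (b * (inner ℝ c z.1 * inner ℝ d z.2)) +
      e * inner ℝ d z.2 ^ 2) ∂(correlatedPair (stdGaussian E) ρ) =
      a * ‖c‖ ^ 2 + 2 * (ρ * b * inner ℝ c d) + e * ‖d‖ ^ 2 := by
  have mp1 := measurePreserving_correlatedPair_fst (stdGaussian E) ρ
  have mp2 := measurePreserving_stdPair_snd (E := E) h₁ h₂
  set μ := correlatedPair (stdGaussian E) ρ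
  have ml : MemLp (fun z : E × E => inner ℝ c z.1) 2 μ :=
    (memLp_inner_stdGaussian c).comp_measurePreserving mp1
  have mk : MemLp (fun z : E × E => inner ℝ d z.2) 2 μ :=
    (memLp_inner_stdGaussian d).comp_measurePreserving mp2
  have ill : Integrable (fun z : E × E => a * inner ℝ c z.1 ^ 2) μ := ml.integrable_sq.const_mul _
  have ikk : Integrable (fun z : E × E => e * inner ℝ d z.2 ^ 2) μ := mk.integrable_sq.const_mul _
  have ilk : Integrable (fun z : E × E => 2 * (b * (inner ℝ c z.1 * inner ℝ d z.2))) μ :=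
    ((ml.integrable_mul mk).const_mul _).const_mul _
  have hsq : ∀ u : E, ∫ z, inner ℝ u z ^ 2 ∂(stdGaussian E) = ‖u‖ ^ 2 := fun u => by
    simp_rw [sq (inner ℝ u _)]
    rw [integral_inner_mul_inner_stdGaussian, real_inner_self_eq_norm_sq]
  have hll : ∫ z : E × E, inner ℝ c z.1 ^ 2 ∂μ = ‖c‖ ^ 2 := by
    rw [integral_comp_measurePreserving mp1 (g := fun z => inner ℝ c z ^ 2)
      (by fun_prop : Measurable _).aestronglyMeasurable, hsq]
  have hkk : ∫ z : E × E, inner ℝ d z.2 ^ 2 ∂μ = ‖d‖ ^ 2 := by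
    rw [integral_comp_measurePreserving mp2 (g := fun z => inner ℝ d z ^ 2)
      (by fun_prop : Measurable _).aestronglyMeasurable, hsq]
  refine ⟨(ill.add ilk).add ikk, ?_⟩
  have i12 : Integrable (fun z : E × E => a * inner ℝ c z.1 ^ 2 +
    2 * (b * (inner ℝ c z.1 * inner ℝ d z.2))) μ := ill.add ilk
  rw [integral_add i12 ikk, integral_add ill ilk, integral_const_mul, integral_const_mul,
    integral_const_mul, integral_const_mul, hll, hkk, integral_inner_mul_inner_correlatedPair]
  ring

/-- The functional Borell inequality for small increments: the second-order term of the
expansion is nonpositive by `ddJ_form_nonpos`. -/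
lemma borellUpTo_small (h₀ : 0 ≤ ρ) (h₂ : ρ < 1) {ε L M : ℝ} (hε : 0 < ε) (hL : 0 ≤ L)
    (hM : 0 ≤ M) : ∃ C : ℝ, ∀ δ : ℝ, 0 < δ → δ ≤ 1 → BorellUpTo E ρ ε L M δ (C * δ ^ 3) := by
  have h₁ : -1 < ρ := by linarith
  obtain ⟨B, hB, hT⟩ := exists_J_taylor h₁ h₂ ε hε
  have mp1 := measurePreserving_correlatedPair_fst (stdGaussian E) ρ
  have mp2 := measurePreserving_stdPair_snd (E := E) h₁.le h₂.le
  have hWint := integrable_cloud_weight (E := E) h₁.le h₂.le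
  have hK0 : 0 ≤ L + M := by positivity
  generalize hI : ∫ z : E × E, (1 + ‖z.1‖ + ‖z.2‖) ^ 6 ∂(correlatedPair (stdGaussian E) ρ) = I
  generalize hC₁ : 4 * B * (L + M) ^ 2 + B * (L + M) ^ 3 = C₁
  generalize hI' : M * ∫ z, ‖z‖ ^ 2 ∂(stdGaussian E) = I'
  refine ⟨C₁ * I + B * I' ^ 2, fun δ hδ hδ' f g c d hf hg x y => ?_⟩
  obtain ⟨ha, hb, he, hT'⟩ := hT (f x) (hf.mem x) (g y) (hg.mem y)
  have hform := ddJ_form_nonpos h₀ h₂ (x := f x) (y := g y)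
    ⟨by linarith [(hf.mem x).1], by linarith [(hf.mem x).2]⟩
    ⟨by linarith [(hg.mem y).1], by linarith [(hg.mem y).2]⟩ (real_inner_le_norm (c x) (d y))
  generalize ddJxx ρ (f x) (g y) = a at *
  generalize ddJxy ρ (f x) (g y) = b at *
  generalize ddJxx ρ (g y) (f x) = e at *
  generalize dJ ρ (f x, g y) = p at *
  generalize dJ ρ (g y, f x) = q at *
  -- the pointwise second-order expansion
  have hpt : ∀ z : E × E, J ρ (f (x + δ • z.1)) (g (y + δ • z.2)) ≤
      J ρ (f x) (g y) - p * f x - q * g y + p * f (x + δ • z.1) + q * g (y + δ • z.2) +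
      δ ^ 2 / 2 * (a * inner ℝ (c x) z.1 ^ 2 + 2 * (b * (inner ℝ (c x) z.1 * inner ℝ (d y) z.2)) +
        e * inner ℝ (d y) z.2 ^ 2) + C₁ * δ ^ 3 * (1 + ‖z.1‖ + ‖z.2‖) ^ 6 := by
    intro z
    have n1 := norm_nonneg z.1
    have n2 := norm_nonneg z.2
    have bU := hf.increment_bounds hL hM hδ.le hδ' x z.1 (W := 1 + ‖z.1‖ + ‖z.2‖) (by linarith)
      (by linarith)
    have bV := hg.increment_bounds hL hM hδ.le hδ' y z.2 (W := 1 + ‖z.1‖ + ‖z.2‖) (by linarith)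
      (by linarith)
    have t3 := (abs_le.1 (hT' _ (hf.mem (x + δ • z.1)) _ (hg.mem (y + δ • z.2)) _ bU.1 bV.1).2).2
    have t4 := (abs_le.1 (abs_quadratic_sub_le ha hb he bU.1 bV.1 bU.2.1 bV.2.1 bU.2.2
      bV.2.2)).2
    have hw1 : 1 ≤ 1 + ‖z.1‖ + ‖z.2‖ := by linarith
    generalize 1 + ‖z.1‖ + ‖z.2‖ = W at *
    have hw4 : 4 * B * (L + M) ^ 2 * δ ^ 3 * W ^ 4 ≤ 4 * B * (L + M) ^ 2 * δ ^ 3 * W ^ 6 := by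
      gcongr
      norm_num
    rw [← hC₁]
    linarith
  have hJi : Integrable (fun z : E × E => J ρ (f (x + δ • z.1)) (g (y + δ • z.2)))
      (correlatedPair (stdGaussian E) ρ) :=
    integrable_J_comp ρ (hf.measurable.comp (by fun_prop)) (hg.measurable.comp (by fun_prop))
  have iU : Integrable (fun z : E × E => p * f (x + δ • z.1)) (correlatedPair (stdGaussian E) ρ) :=
    (integrable_of_mem_Icc (hf.measurable.comp (by fun_prop)) fun z => hf.mem _).const_mul p
  have iV : Integrable (fun z : E × E => q * g (y + δ • z.2)) (correlatedPair (stdGaussian E) ρ) :=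
    (integrable_of_mem_Icc (hg.measurable.comp (by fun_prop)) fun z => hg.mem _).const_mul q
  obtain ⟨iQ, hQ⟩ := integral_quadratic (E := E) h₁.le h₂.le a b e (c x) (d y)
  have i0 : Integrable (fun _ : E × E => J ρ (f x) (g y) - p * f x - q * g y)
    (correlatedPair (stdGaussian E) ρ) := integrable_const _
  have i1 := i0.add iU
  have i2 := i1.add iV
  have i3 := i2.add (iQ.const_mul (δ ^ 2 / 2))
  have i4 := i3.add (hWint.const_mul (C₁ * δ ^ 3))
  have hint := integral_mono hJi i4 hpt
  rw [integral_add' i3 (hWint.const_mul (C₁ * δ ^ 3)), integral_add' i2 (iQ.const_mul (δ ^ 2 / 2)),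
    integral_add' i1 iV, integral_add' i0 iU, integral_const_mul, integral_const_mul,
    integral_const_mul, integral_const_mul, hQ, hI,
    integral_comp_measurePreserving mp1 (g := fun z => f (x + δ • z))
      (hf.measurable.comp (by fun_prop)).aestronglyMeasurable,
    integral_comp_measurePreserving mp2 (g := fun z => g (y + δ • z))
      (hg.measurable.comp (by fun_prop)).aestronglyMeasurable] at hint
  simp only [integral_const, probReal_univ, smul_eq_mul, one_mul] at hint
  have hbm := hf.abs_average_sub_le δ x
  have hbm' := hg.abs_average_sub_le δ y
  rw [hI'] at hbm hbm'
  have hback := (abs_le.1 (hT' _ ((hf.average (stdGaussian E) δ).mem x) _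
    ((hg.average (stdGaussian E) δ).mem y) _ hbm hbm').1).1
  unfold GaussianStability.average at hback ⊢
  have hneg : δ ^ 2 / 2 * (a * ‖c x‖ ^ 2 + 2 * (ρ * b * inner ℝ (c x) (d y)) + e * ‖d y‖ ^ 2) ≤ 0 :=
    mul_nonpos_of_nonneg_of_nonpos (by positivity) hform
  have hδ4 : B * (δ ^ 2 * I') ^ 2 ≤ B * I' ^ 2 * δ ^ 3 := by
    have : δ ^ 4 ≤ δ ^ 3 := pow_le_pow_of_le_one hδ.le hδ' (by norm_num)
    calc B * (δ ^ 2 * I') ^ 2 = B * I' ^ 2 * δ ^ 4 := by ring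
      _ ≤ _ := by gcongr
  linarith

/-- Splitting an increment into two independent ones of equal size. -/
lemma BorellUpTo.double (h₁ : -1 < ρ) (h₂ : ρ < 1) {ε L M δ e : ℝ}
    (h : BorellUpTo E ρ ε L M δ e) : BorellUpTo E ρ ε L M (Real.sqrt 2 * δ) (2 * e) := by
  intro f g c d hf hg x y
  set μ := correlatedPair (stdGaussian E) ρ with hμ
  have hmeas : Measurable (fun z : E × E =>
      J ρ (f (x + (Real.sqrt 2 * δ) • z.1)) (g (y + (Real.sqrt 2 * δ) • z.2))) :=
    measurable_J_comp ρ (hf.measurable.comp (by fun_prop)) (hg.measurable.comp (by fun_prop))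
  have hs : ∀ u v w : E, u + (Real.sqrt 2 * δ) • (Real.sqrt 2)⁻¹ • (v + w) =
      u + δ • v + δ • w := fun u v w => by
    rw [smul_smul, mul_right_comm, mul_inv_cancel₀ (by positivity), one_mul, smul_add, add_assoc]
  rw [← average_average (by simp) δ hf.measurable hf.mem,
    ← average_average (by simp) δ hg.measurable
    hg.mem, ← integral_comp_measurePreserving (measurePreserving_half_add
      (integral_id_correlatedPair h₁.le h₂.le)) hmeas.aestronglyMeasurable, integral_prod]
  · simp only [Prod.smul_fst, Prod.smul_snd, Prod.fst_add, Prod.snd_add, hs]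
    have hfa := hf.average (stdGaussian E) δ
    have hga := hg.average (stdGaussian E) δ
    have i1 : Integrable (fun z : E × E => J ρ (average (stdGaussian E) δ f (x + δ • z.1))
        (average (stdGaussian E) δ g (y + δ • z.2))) μ :=
      integrable_J_comp ρ (hfa.measurable.comp (by fun_prop)) (hga.measurable.comp (by fun_prop))
    calc _ ≤ ∫ z, (J ρ (average (stdGaussian E) δ f (x + δ • z.1))
          (average (stdGaussian E) δ g (y + δ • z.2)) + e) ∂μ := by
          refine integral_mono_of_nonneg (Eventually.of_forall fun z => ?_)
            (i1.add (integrable_const e)) (Eventually.of_forall fun z => ?_)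
          · exact integral_nonneg fun w => J_nonneg _ _ _
          · exact h f g c d hf hg _ _
      _ = ∫ z, J ρ (average (stdGaussian E) δ f (x + δ • z.1))
          (average (stdGaussian E) δ g (y + δ • z.2)) ∂μ + e := by
          rw [integral_add i1 (integrable_const e)]
          simp
      _ ≤ _ := by linarith [h _ _ _ _ hfa hga x y]
  · exact integrable_J_comp ρ (hf.measurable.comp (by fun_prop)) (hg.measurable.comp (by fun_prop))

/-- Halving the increments repeatedly makes the total error vanish. -/
lemma borellUpTo_zero (h₀ : 0 ≤ ρ) (h₂ : ρ < 1) {ε L M : ℝ} (hε : 0 < ε) (hL : 0 ≤ L)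
    (hM : 0 ≤ M) : BorellUpTo E ρ ε L M 1 0 := by
  obtain ⟨C, hC⟩ := borellUpTo_small (E := E) h₀ h₂ hε hL hM
  have h2 : (1 : ℝ) < Real.sqrt 2 := by
    rw [Real.lt_sqrt zero_le_one]
    norm_num
  have hiter : ∀ n : ℕ, ∀ δ : ℝ, 0 < δ → δ ≤ 1 →
      BorellUpTo E ρ ε L M δ (C * (Real.sqrt 2)⁻¹ ^ n * δ ^ 3) := by
    intro n
    induction n with
    | zero => simpa using hC
    | succ n ih =>
      intro δ hδ hδ'
      have h3 : δ / Real.sqrt 2 ≤ 1 := (div_le_self hδ.le h2.le).trans hδ'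
      have := (ih (δ / Real.sqrt 2) (by positivity) h3).double (by linarith) h₂
      convert this using 1
      · field_simp
      · rw [pow_succ, div_pow, show Real.sqrt 2 ^ 3 = 2 * Real.sqrt 2 by
          rw [pow_succ, Real.sq_sqrt zero_le_two]]
        field_simp
  intro f g c d hf hg x y
  have hlim : Tendsto (fun n : ℕ => J ρ (average (stdGaussian E) 1 f x)
      (average (stdGaussian E) 1 g y) + C * (Real.sqrt 2)⁻¹ ^ n * 1 ^ 3) atTop
      (𝓝 (J ρ (average (stdGaussian E) 1 f x) (average (stdGaussian E) 1 g y) + C * 0 * 1 ^ 3)) :=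
    ((((tendsto_pow_atTop_nhds_zero_of_lt_one (by positivity)
      (inv_lt_one_of_one_lt₀ h2)).const_mul C).mul_const _).const_add _)
  have := ge_of_tendsto' hlim fun n => hiter n 1 one_pos le_rfl f g c d hf hg x y
  simpa using this

lemma HasExpansion.borell (h₀ : 0 ≤ ρ) (h₂ : ρ < 1) {ε L M : ℝ} (hε : 0 < ε) (hL : 0 ≤ L)
    (hM : 0 ≤ M) {f g : E → ℝ} {c d : E → E} (hf : HasExpansion ε L M f c)
    (hg : HasExpansion ε L M g d) :
    ∫ z, J ρ (f z.1) (g z.2) ∂(correlatedPair (stdGaussian E) ρ) ≤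
      J ρ (∫ z, f z ∂(stdGaussian E)) (∫ z, g z ∂(stdGaussian E)) := by
  simpa [GaussianStability.average] using borellUpTo_zero h₀ h₂ hε hL hM f g c d hf hg 0 0

end Borell

section BorellSets

variable {E : Type*} [NormedAddCommGroup E] [InnerProductSpace ℝ E] [FiniteDimensional ℝ E]
  [MeasurableSpace E] [BorelSpace E]

omit [FiniteDimensional ℝ E] [BorelSpace E] in
lemma HasExpansion.mono {ε L M L' M' : ℝ} {f : E → ℝ} {c : E → E} (hf : HasExpansion ε L M f c)
    (hL : L ≤ L') (hM : M ≤ M') : HasExpansion ε L' M' f c :=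
  ⟨hf.mem, hf.measurable, hf.measurable_grad, fun x => (hf.norm_grad_le x).trans hL,
    fun x h => (hf.expansion x h).trans (by gcongr)⟩

/-- Smooth compactly supported functions, squeezed into `[ε, 1 - ε]`, have controlled
expansions. -/
lemma exists_hasExpansion {f : E → ℝ} (hf : ContDiff ℝ 2 f) (hc : HasCompactSupport f)
    (h01 : ∀ x, f x ∈ Icc (0 : ℝ) 1) {ε : ℝ} (hε' : ε ≤ 1 / 2) :
    ∃ L M : ℝ, 0 ≤ L ∧ 0 ≤ M ∧ ∃ c : E → E,
      HasExpansion ε L M (fun x => ε + (1 - 2 * ε) * f x) c := by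
  set g : E → ℝ := fun x => ε + (1 - 2 * ε) * f x with hg
  have hf' : ContDiff ℝ 1 (fderiv ℝ f) := hf.fderiv_right (by norm_num)
  obtain ⟨K, hK⟩ := hf'.lipschitzWith_of_hasCompactSupport (hc.fderiv ℝ) one_ne_zero
  obtain ⟨B, hB⟩ := hf'.continuous.bounded_above_of_compact_support (hc.fderiv ℝ)
  have h12 : 0 ≤ 1 - 2 * ε := by linarith
  have hfd : ∀ x, HasFDerivAt f (fderiv ℝ f x) x := fun x =>
    (hf.differentiable (by norm_num) x).hasFDerivAt
  refine ⟨(1 - 2 * ε) * B, (1 - 2 * ε) * K,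
    mul_nonneg h12 ((norm_nonneg _).trans (hB 0)), by positivity,
    fun x => (1 - 2 * ε) • (InnerProductSpace.toDual ℝ E).symm (fderiv ℝ f x), ?_, ?_, ?_, ?_, ?_⟩
  · intro x
    have h0 := h01 x
    have h3 := mul_nonneg h12 h0.1
    have h4 := mul_le_mul_of_nonneg_left h0.2 h12
    constructor <;> simp only [hg] <;> linarith
  · exact (hf.continuous.measurable.const_mul _).const_add _
  · exact (continuous_const.smul ((InnerProductSpace.toDual ℝ E).symm.continuous.comp
      hf'.continuous)).measurable
  · intro x
    rw [norm_smul, Real.norm_of_nonneg h12, LinearIsometryEquiv.norm_map]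
    exact mul_le_mul_of_nonneg_left (hB x) h12
  · intro x h
    have key : ‖f (x + h) - f x - fderiv ℝ f x (x + h - x)‖ ≤ K * ‖h‖ * ‖x + h - x‖ := by
      refine (convex_closedBall x ‖h‖).norm_image_sub_le_of_norm_hasFDerivWithin_le'
        (fun u _ => (hfd u).hasFDerivWithinAt) (fun u hu => ?_) (by simp) (by simp)
      refine (hK.norm_sub_le u x).trans ?_
      gcongr
      simpa [dist_eq_norm] using hu
    rw [add_sub_cancel_left] at key
    rw [inner_smul_left, InnerProductSpace.toDual_symm_apply]
    simp only [hg, conj_trivial]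
    calc _ = (1 - 2 * ε) * |f (x + h) - f x - fderiv ℝ f x h| := by
          rw [← abs_of_nonneg h12, ← abs_mul, abs_of_nonneg h12]
          ring_nf
      _ ≤ (1 - 2 * ε) * (K * ‖h‖ * ‖h‖) := mul_le_mul_of_nonneg_left key h12
      _ = _ := by ring

open scoped Manifold ContDiff in
/-- Indicators are limits in `L¹` of smooth compactly supported functions. -/
lemma exists_contDiff_integral_sub_indicator_le (γ : Measure E) [IsProbabilityMeasure γ]
    {A : Set E} (hA : MeasurableSet A) {η : ℝ} (hη : 0 < η) :
    ∃ f : E → ℝ, ContDiff ℝ 2 f ∧ HasCompactSupport f ∧ (∀ x, f x ∈ Icc (0 : ℝ) 1) ∧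
      ∫ x, |f x - A.indicator (fun _ => 1) x| ∂γ ≤ η := by
  have hη2 : ENNReal.ofReal (η / 2) ≠ 0 := by simpa using hη
  obtain ⟨K, hKA, hK, hKγ⟩ := hA.exists_isCompact_sdiff_lt (measure_ne_top γ A) hη2
  obtain ⟨U, hUA, hU, -, hUγ⟩ := hA.exists_isOpen_sdiff_lt (measure_ne_top γ A) hη2
  obtain ⟨R, hR⟩ := hK.isBounded.subset_ball 0
  have hO : IsOpen (U ∩ Metric.ball 0 R) := hU.inter Metric.isOpen_ball
  obtain ⟨f, hf0, hf1, hf⟩ := exists_contMDiffMap_zero_one_of_isClosed (n := 2) 𝓘(ℝ, E)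
    hO.isClosed_compl hK.isClosed
    (disjoint_compl_left_iff_subset.2 (subset_inter (hKA.trans hUA) hR))
  refine ⟨f, f.contMDiff.contDiff, ?_, hf, ?_⟩
  · refine HasCompactSupport.intro (isCompact_closedBall (0 : E) R) fun x hx => hf0 fun h => hx ?_
    exact Metric.ball_subset_closedBall h.2
  · have hfc : Continuous f := f.contMDiff.contDiff.continuous
    have hm : MeasurableSet (U \ K) := hU.measurableSet.diff hK.measurableSet
    have hle : ∀ x, |f x - A.indicator (fun _ => 1) x| ≤
        (U \ K).indicator (fun _ => (1 : ℝ)) x := by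
      intro x
      have h0 := hf x
      by_cases hxK : x ∈ K
      · have : f x = 1 := hf1 hxK
        simp [this, hKA hxK, hxK]
      by_cases hxU : x ∈ U
      · rw [indicator_of_mem (show x ∈ U \ K from ⟨hxU, hxK⟩)]
        by_cases hxA : x ∈ A <;> simp only [hxA, indicator_of_mem, indicator_of_notMem, abs_le,
          not_false_eq_true] <;> constructor <;> linarith [h0.1, h0.2]
      · have : f x = 0 := hf0 fun h => hxU h.1
        have hxA : x ∉ A := fun h => hxU (hUA h)
        simp [this, hxA, hxU]
    have hi : Integrable (fun x => |f x - A.indicator (fun _ => 1) x|) γ := by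
      refine Integrable.abs ?_
      exact (integrable_of_mem_Icc hfc.measurable hf).sub
        ((integrable_const 1).indicator hA)
    refine (integral_mono hi ((integrable_const 1).indicator hm) hle).trans ?_
    rw [integral_indicator hm]
    simp only [integral_const, smul_eq_mul, mul_one, measureReal_restrict_apply_univ]
    have hsub : U \ K ⊆ (A \ K) ∪ (U \ A) := fun x hx => by
      by_cases hxA : x ∈ A
      · exact Or.inl ⟨hxA, hx.2⟩
      · exact Or.inr ⟨hx.1, hxA⟩
    have h1 : γ (U \ K) ≤ ENNReal.ofReal (η / 2) + ENNReal.ofReal (η / 2) :=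
      (measure_mono hsub).trans ((measure_union_le _ _).trans (add_le_add hKγ.le hUγ.le))
    rw [← ENNReal.ofReal_add (by positivity) (by positivity), add_halves] at h1
    exact ENNReal.toReal_le_of_le_ofReal hη.le h1

lemma indicator_mem_Icc {α : Type*} (A : Set α) (x : α) :
    A.indicator (fun _ => (1 : ℝ)) x ∈ Icc (0 : ℝ) 1 := by
  by_cases hx : x ∈ A <;> simp [hx]

lemma J_indicator {α β : Type*} (ρ : ℝ) (A : Set α) (B : Set β) (x : α) (y : β) :
    J ρ (A.indicator (fun _ => 1) x) (B.indicator (fun _ => 1) y) =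
      (A ×ˢ B).indicator (fun _ => 1) (x, y) := by
  by_cases hx : x ∈ A <;> by_cases hy : y ∈ B <;>
    simp [hx, hy, J_zero_left, J_zero_right, J_one_one]

lemma integral_J_indicator {α β : Type*} [MeasurableSpace α] [MeasurableSpace β]
    (μ : Measure (α × β)) (ρ : ℝ) {A : Set α} {B : Set β}
    (hA : MeasurableSet A) (hB : MeasurableSet B) :
    ∫ z, J ρ (A.indicator (fun _ => 1) z.1) (B.indicator (fun _ => 1) z.2) ∂μ =
      μ.real (A ×ˢ B) := by
  simp_rw [J_indicator]
  exact integral_indicator_one (hA.prod hB)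

/-- **Borell's inequality** for sets: among pairs of sets of given Gaussian measure, parallel
half-spaces maximize the noise stability. -/
theorem correlatedPair_prod_le_J {ρ : ℝ} (h₀ : 0 ≤ ρ) (h₂ : ρ < 1) {A B : Set E}
    (hA : MeasurableSet A) (hB : MeasurableSet B) :
    (correlatedPair (stdGaussian E) ρ).real (A ×ˢ B) ≤
      J ρ ((stdGaussian E).real A) ((stdGaussian E).real B) := by
  have h₁ : -1 < ρ := by linarith
  have mp1 := measurePreserving_correlatedPair_fst (stdGaussian E) ρ
  have mp2 := measurePreserving_stdPair_snd (E := E) h₁.le h₂.le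
  -- approximation of a single set, in the mean and in expectation
  have happrox : ∀ {A : Set E}, MeasurableSet A → ∀ η : ℝ, 0 < η → η ≤ 1 / 2 →
      ∃ (L M : ℝ) (f : E → ℝ) (c : E → E), 0 ≤ L ∧ 0 ≤ M ∧ HasExpansion η L M f c ∧
        ∫ x, |A.indicator (fun _ => 1) x - f x| ∂(stdGaussian E) ≤ 2 * η ∧
        |(∫ x, f x ∂(stdGaussian E)) - (stdGaussian E).real A| ≤ 2 * η := by
    intro A hA η hη hη'
    obtain ⟨f, hf, hfc, hf01, hfA⟩ :=
      exists_contDiff_integral_sub_indicator_le (stdGaussian E) hA hη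
    obtain ⟨L, M, hL, hM, c, hfe⟩ := exists_hasExpansion hf hfc hf01 hη'
    have i1 : Integrable f (stdGaussian E) := integrable_of_mem_Icc hf.continuous.measurable hf01
    have i2 : Integrable (A.indicator (fun _ => (1 : ℝ))) (stdGaussian E) :=
      (integrable_const 1).indicator hA
    have i3 : Integrable (fun x => η + (1 - 2 * η) * f x) (stdGaussian E) :=
      integrable_of_mem_Icc hfe.measurable hfe.mem
    have h1 : ∫ x, |A.indicator (fun _ => 1) x - (η + (1 - 2 * η) * f x)| ∂(stdGaussian E) ≤
        2 * η := by
      have : ∫ x, |A.indicator (fun _ => 1) x - (η + (1 - 2 * η) * f x)| ∂(stdGaussian E) ≤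
          ∫ x, (|f x - A.indicator (fun _ => 1) x| + η) ∂(stdGaussian E) := by
        refine integral_mono (i2.sub i3).abs ((i1.sub i2).abs.add (integrable_const η)) fun x => ?_
        have h0 := hf01 x
        have e1 : |η - 2 * η * f x| ≤ η := by
          rw [abs_le]
          constructor <;> nlinarith [h0.1, h0.2]
        calc |A.indicator (fun _ => 1) x - (η + (1 - 2 * η) * f x)|
            = |-(f x - A.indicator (fun _ => 1) x) - (η - 2 * η * f x)| := by ring_nf
          _ ≤ _ := (abs_sub _ _).trans (by rw [abs_neg]; gcongr)
      refine this.trans ?_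
      have i4 : Integrable (fun x => |f x - A.indicator (fun _ => 1) x|) (stdGaussian E) :=
        (i1.sub i2).abs
      rw [integral_add i4 (integrable_const η)]
      simp only [integral_const, probReal_univ, one_smul]
      linarith
    refine ⟨L, M, _, c, hL, hM, hfe, h1, ?_⟩
    have hA1 : (stdGaussian E).real A = ∫ x, A.indicator (fun _ => 1) x ∂(stdGaussian E) :=
      (integral_indicator_one hA).symm
    rw [hA1, ← integral_sub i3 i2]
    rw [← Real.norm_eq_abs]
    refine (norm_integral_le_integral_norm _).trans (le_trans (le_of_eq ?_) h1)
    congr 1 with x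
    rw [Real.norm_eq_abs, abs_sub_comm]
  -- the inequality up to an arbitrarily small error
  have hclose : ∀ η : ℝ, 0 < η → η ≤ 1 / 2 → (correlatedPair (stdGaussian E) ρ).real (A ×ˢ B) ≤
      J ρ ((stdGaussian E).real A) ((stdGaussian E).real B) + 8 * η := by
    intro η hη hη'
    obtain ⟨L, M, f, c, hL, hM, hf, hfA, hfA'⟩ := happrox hA η hη hη'
    obtain ⟨L', M', g, d, hL', hM', hg, hgB, hgB'⟩ := happrox hB η hη hη'
    have hJ := (hf.mono (le_max_left L L') (le_max_left M M')).borell h₀ h₂ hη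
      (le_max_of_le_left hL) (le_max_of_le_left hM)
      (hg.mono (le_max_right L L') (le_max_right M M'))
    have hsub : ∀ {u}, u ∈ Icc η (1 - η) → u ∈ Icc (0 : ℝ) 1 := fun hu =>
      ⟨by linarith [hu.1], by linarith [hu.2]⟩
    have hfm : Measurable (A.indicator (fun _ => (1 : ℝ))) := measurable_const.indicator hA
    have hgm : Measurable (B.indicator (fun _ => (1 : ℝ))) := measurable_const.indicator hB
    have iA : Integrable (fun z : E × E => |A.indicator (fun _ => 1) z.1 - f z.1|)
        (correlatedPair (stdGaussian E) ρ) :=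
      ((integrable_of_mem_Icc (hfm.comp measurable_fst) fun z => indicator_mem_Icc A _).sub
        (integrable_of_mem_Icc (hf.measurable.comp measurable_fst) fun z => hf.mem _)).abs
    have iB : Integrable (fun z : E × E => |B.indicator (fun _ => 1) z.2 - g z.2|)
        (correlatedPair (stdGaussian E) ρ) :=
      ((integrable_of_mem_Icc (hgm.comp measurable_snd) fun z => indicator_mem_Icc B _).sub
        (integrable_of_mem_Icc (hg.measurable.comp measurable_snd) fun z => hg.mem _)).abs
    have iJ : Integrable (fun z : E × E => J ρ (f z.1) (g z.2))
        (correlatedPair (stdGaussian E) ρ) :=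
      integrable_J_comp ρ (hf.measurable.comp measurable_fst) (hg.measurable.comp measurable_snd)
    have h1 : (correlatedPair (stdGaussian E) ρ).real (A ×ˢ B) ≤
        ∫ z, (J ρ (f z.1) (g z.2) + (|A.indicator (fun _ => 1) z.1 - f z.1| +
          |B.indicator (fun _ => 1) z.2 - g z.2|)) ∂(correlatedPair (stdGaussian E) ρ) := by
      rw [← integral_J_indicator _ ρ hA hB]
      refine integral_mono (integrable_J_comp ρ (hfm.comp measurable_fst)
        (hgm.comp measurable_snd)) (iJ.add (iA.add iB)) fun z => ?_
      have := abs_J_sub_le (ρ := ρ) h₁.le h₂.le (hsub (hf.mem z.1)) (indicator_mem_Icc A z.1)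
        (hsub (hg.mem z.2)) (indicator_mem_Icc B z.2)
      linarith [(abs_le.1 this).2]
    have iAB : Integrable (fun z : E × E => |A.indicator (fun _ => 1) z.1 - f z.1| +
      |B.indicator (fun _ => 1) z.2 - g z.2|) (correlatedPair (stdGaussian E) ρ) := iA.add iB
    rw [integral_add iJ iAB, integral_add iA iB,
      integral_comp_measurePreserving mp1 (g := fun x => |A.indicator (fun _ => 1) x - f x|)
        (hfm.sub hf.measurable).abs.aestronglyMeasurable,
      integral_comp_measurePreserving mp2 (g := fun x => |B.indicator (fun _ => 1) x - g x|)
        (hgm.sub hg.measurable).abs.aestronglyMeasurable] at h1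
    have h3 := abs_J_sub_le (ρ := ρ) h₁.le h₂.le (x := (stdGaussian E).real A)
      (y := (stdGaussian E).real B) ⟨measureReal_nonneg, measureReal_le_one⟩
      (hsub (integral_mem_Icc (μ := stdGaussian E) hf.measurable hf.mem))
      ⟨measureReal_nonneg, measureReal_le_one⟩
      (hsub (integral_mem_Icc (μ := stdGaussian E) hg.measurable hg.mem))
    linarith [(abs_le.1 h3).2]
  refine le_of_forall_pos_le_add fun e he => ?_
  have h := hclose (min (1 / 2) (e / 8)) (by positivity) (min_le_left _ _)
  linarith [min_le_right (1 / 2) (e / 8)]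

end BorellSets

/-! ### Products, densities and null sets -/

section Densities

lemma measurePreserving_prodProdComm {α β α' β' : Type*} [MeasurableSpace α] [MeasurableSpace β]
    [MeasurableSpace α'] [MeasurableSpace β'] (μ : Measure α) (ν : Measure β) (μ' : Measure α')
    (ν' : Measure β') [SFinite μ] [SFinite ν] [SFinite μ'] [SFinite ν'] :
    MeasurePreserving (fun p : (α × β) × (α' × β') => ((p.1.1, p.2.1), (p.1.2, p.2.2)))
      ((μ.prod ν).prod (μ'.prod ν')) ((μ.prod μ').prod (ν.prod ν')) := by
  have h1 := measurePreserving_prodAssoc μ ν (μ'.prod ν')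
  have h2 := (MeasurePreserving.id μ).prod (measurePreserving_prodAssoc ν μ' ν').symm
  have h3 := (MeasurePreserving.id μ).prod
    ((Measure.measurePreserving_swap (μ := ν) (ν := μ')).prod (MeasurePreserving.id ν'))
  have h4 := (MeasurePreserving.id μ).prod (measurePreserving_prodAssoc μ' ν ν')
  have h5 := (measurePreserving_prodAssoc μ μ' (ν.prod ν')).symm
  exact h5.comp (h4.comp (h3.comp (h2.comp h1)))

section Linear

variable {E F : Type*} [NormedAddCommGroup E] [NormedSpace ℝ E] [MeasurableSpace E] [BorelSpace E]
  [SecondCountableTopology E] [NormedAddCommGroup F] [NormedSpace ℝ F] [MeasurableSpace F]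
  [BorelSpace F] [SecondCountableTopology F]

/-- Linear maps act on correlated pairs. -/
lemma measurePreserving_correlatedPair_map {γ : Measure E} {γ' : Measure F} [SFinite γ]
    [SFinite γ'] (L : E →ₗ[ℝ] F) (hL : MeasurePreserving L γ γ') (ρ : ℝ) :
    MeasurePreserving (Prod.map L L) (correlatedPair γ ρ) (correlatedPair γ' ρ) := by
  refine ⟨hL.measurable.prodMap hL.measurable, ?_⟩
  rw [correlatedPair, Measure.map_map (hL.measurable.prodMap hL.measurable)
    (measurable_correlate ρ), ← ((measurePreserving_correlate γ' ρ).comp (hL.prod hL)).map_eq]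
  congr 1
  ext p <;> simp

/-- A correlated pair with law a product measure consists of independent correlated pairs. -/
lemma measurePreserving_correlatedPair_prod (γ : Measure E) (γ' : Measure F)
    [IsProbabilityMeasure γ] [IsProbabilityMeasure γ'] (ρ : ℝ) :
    MeasurePreserving (fun p : (E × E) × (F × F) => ((p.1.1, p.2.1), (p.1.2, p.2.2)))
      ((correlatedPair γ ρ).prod (correlatedPair γ' ρ)) (correlatedPair (γ.prod γ') ρ) := by
  have h1 := (measurePreserving_correlate (γ.prod γ') ρ).comp
    (measurePreserving_prodProdComm γ γ γ' γ')
  have h2 := (measurePreserving_correlate γ ρ).prod (measurePreserving_correlate γ' ρ)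
  refine ⟨by fun_prop, ?_⟩
  rw [← h2.map_eq, Measure.map_map (by fun_prop) h2.measurable, ← h1.map_eq]
  congr 1

end Linear

section StdGaussian

variable {E : Type*} [NormedAddCommGroup E] [InnerProductSpace ℝ E] [FiniteDimensional ℝ E]
  [MeasurableSpace E] [BorelSpace E]

lemma measurePreserving_ofLp_stdGaussian (F : Type*) [NormedAddCommGroup F]
    [InnerProductSpace ℝ F] [FiniteDimensional ℝ F] [MeasurableSpace F] [BorelSpace F] :
    MeasurePreserving (WithLp.ofLp : WithLp 2 (E × F) → E × F) (stdGaussian (WithLp 2 (E × F)))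
      ((stdGaussian E).prod (stdGaussian F)) := by
  have h : ((stdGaussian E).prod (stdGaussian F)).map (WithLp.toLp 2) =
      stdGaussian (WithLp 2 (E × F)) := by
    refine Measure.ext_of_charFun (funext fun t => ?_)
    rw [charFun_prod, charFun_stdGaussian, charFun_stdGaussian, charFun_stdGaussian,
      ← Complex.exp_add]
    have ht : (‖t‖ : ℂ) ^ 2 = ‖t.fst‖ ^ 2 + ‖t.snd‖ ^ 2 := by
      exact_mod_cast WithLp.prod_norm_sq_eq_of_L2 t
    congr 1
    rw [ht]
    simp only [WithLp.ofLp_fst, WithLp.ofLp_snd]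
    ring
  refine ⟨by fun_prop, ?_⟩
  rw [← h, Measure.map_map (by fun_prop) (by fun_prop)]
  exact Measure.map_id

lemma stdGaussian_real : stdGaussian ℝ = N₁ := by
  refine Measure.ext_of_charFun (funext fun t => ?_)
  rw [charFun_stdGaussian, charFun_gaussianReal]
  congr 1
  simp [neg_div, ← Complex.ofReal_pow]

/-- Borell's inequality on a product space. -/
lemma correlatedPair_prod_le_J_of_prod {ρ : ℝ} (h₀ : 0 ≤ ρ) (h₂ : ρ < 1) {A B : Set (ℝ × E)}
    (hA : MeasurableSet A) (hB : MeasurableSet B) :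
    (correlatedPair ((N₁).prod (stdGaussian E)) ρ).real (A ×ˢ B) ≤
      J ρ (((N₁).prod (stdGaussian E)).real A) (((N₁).prod (stdGaussian E)).real B) := by
  have mp := measurePreserving_ofLp_stdGaussian (E := ℝ) E
  rw [stdGaussian_real] at mp
  have h := correlatedPair_prod_le_J h₀ h₂ (mp.measurable hA) (mp.measurable hB)
  rw [mp.measureReal_preimage hA.nullMeasurableSet,
    mp.measureReal_preimage hB.nullMeasurableSet] at h
  have mp' := measurePreserving_correlatedPair_map
    (WithLp.linearEquiv 2 ℝ (ℝ × E)).toLinearMap mp ρ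
  rw [← mp'.measureReal_preimage (hA.prod hB).nullMeasurableSet]
  exact h

lemma pi_absolutelyContinuous_pi : ∀ {n : ℕ} (μ ν : Measure ℝ) [SigmaFinite μ] [SigmaFinite ν],
    μ ≪ ν → Measure.pi (fun _ : Fin n => μ) ≪ Measure.pi (fun _ : Fin n => ν) := by
  intro n
  induction n with
  | zero =>
    intro μ ν _ _ _
    rw [Measure.pi_of_empty, Measure.pi_of_empty]
  | succ n ih =>
    intro μ ν _ _ h
    have e1 := (measurePreserving_piFinSuccAbove (fun _ : Fin (n + 1) => μ) 0).symm
    have e2 := (measurePreserving_piFinSuccAbove (fun _ : Fin (n + 1) => ν) 0).symm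
    rw [← e1.map_eq, ← e2.map_eq]
    exact (h.prod (ih μ ν h)).map (MeasurableEquiv.measurable _)

lemma measurePreserving_sum_smul_stdOrthonormalBasis :
    MeasurePreserving (fun x : Fin (Module.finrank ℝ E) → ℝ => ∑ i, x i • stdOrthonormalBasis ℝ E i)
      volume volume := by
  have h := (stdOrthonormalBasis ℝ E).measurePreserving_repr_symm.comp
    (EuclideanSpace.volume_preserving_symm_measurableEquiv_toLp (Fin (Module.finrank ℝ E))).symm
  have heq : (fun x : Fin (Module.finrank ℝ E) → ℝ => ∑ i, x i • stdOrthonormalBasis ℝ E i) =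
      (stdOrthonormalBasis ℝ E).repr.symm ∘ (MeasurableEquiv.toLp 2 _).symm.symm := by
    ext x
    exact (stdOrthonormalBasis ℝ E).sum_repr_symm (WithLp.toLp 2 x)
  rw [heq]
  exact h

lemma stdGaussian_absolutelyContinuous : stdGaussian E ≪ volume := by
  rw [← (measurePreserving_sum_smul_stdOrthonormalBasis (E := E)).map_eq, stdGaussian]
  exact (pi_absolutelyContinuous_pi _ _ (gaussianReal_absolutelyContinuous 0 one_ne_zero)).map
    (by fun_prop)

lemma volume_absolutelyContinuous_stdGaussian : volume ≪ stdGaussian E := by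
  rw [← (measurePreserving_sum_smul_stdOrthonormalBasis (E := E)).map_eq, stdGaussian]
  exact (pi_absolutelyContinuous_pi _ _ (gaussianReal_absolutelyContinuous' 0 one_ne_zero)).map
    (by fun_prop)

/-- Independent pairs are absolutely continuous with respect to correlated ones. -/
lemma prod_absolutelyContinuous_correlatedPair {ρ : ℝ} (h₁ : -1 < ρ) (h₂ : ρ < 1) :
    (stdGaussian E).prod (stdGaussian E) ≪ correlatedPair (stdGaussian E) ρ := by
  refine Measure.AbsolutelyContinuous.mk fun s hs h => ?_
  have hr := (sqrt_one_sub_sq_pos h₁ h₂).ne'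
  rw [← (measurePreserving_correlate (stdGaussian E) ρ).measure_preimage hs.nullMeasurableSet,
    Measure.measure_prod_null (measurable_correlate ρ hs)] at h
  rw [Measure.measure_prod_null hs]
  filter_upwards [h] with x hx
  refine stdGaussian_absolutelyContinuous ?_
  have h3 := volume_absolutelyContinuous_stdGaussian (E := E) hx
  have h4 : Prod.mk x ⁻¹' ((fun p : E × E => (p.1, ρ • p.1 + Real.sqrt (1 - ρ ^ 2) • p.2)) ⁻¹' s) =
      (fun z => Real.sqrt (1 - ρ ^ 2) • z) ⁻¹' ((fun z => ρ • x + z) ⁻¹' (Prod.mk x ⁻¹' s)) := rfl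
  rw [h4, Measure.addHaar_preimage_smul _ hr, measure_preimage_add] at h3
  simpa [hr] using h3

end StdGaussian

/-- The density of a pair of correlated standard normal variables. -/
def pairDensity (ρ : ℝ) (z : ℝ × ℝ) : ℝ :=
  gaussianPDFReal 0 1 z.1 * gaussianPDFReal (ρ * z.1) (1 - ρ ^ 2).toNNReal z.2

variable {ρ : ℝ}

lemma measurable_pairDensity : Measurable (pairDensity ρ) := by
  unfold pairDensity gaussianPDFReal
  fun_prop

lemma pairDensity_nonneg (z : ℝ × ℝ) : 0 ≤ pairDensity ρ z :=
  mul_nonneg (gaussianPDFReal_nonneg _ _ _) (gaussianPDFReal_nonneg _ _ _)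

lemma correlatedPair_eq_withDensity (h₁ : -1 < ρ) (h₂ : ρ < 1) :
    correlatedPair N₁ ρ = volume.withDensity (fun z => ENNReal.ofReal (pairDensity ρ z)) := by
  have hr : 0 < 1 - ρ ^ 2 := by nlinarith
  have hv : (1 - ρ ^ 2).toNNReal ≠ 0 := by simpa using hr
  ext s hs
  rw [← (measurePreserving_correlate N₁ ρ).measure_preimage hs.nullMeasurableSet,
    Measure.prod_apply (measurable_correlate ρ hs), withDensity_apply _ hs,
    ← lintegral_indicator hs, Measure.volume_eq_prod, lintegral_prod _
      ((measurable_pairDensity.ennreal_ofReal).indicator hs).aemeasurable,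
    gaussianReal_of_var_ne_zero 0 one_ne_zero,
    lintegral_withDensity_eq_lintegral_mul _ (measurable_gaussianPDF 0 1)]
  · refine lintegral_congr fun x => ?_
    have hmap : (N₁).map (fun z => ρ * x + Real.sqrt (1 - ρ ^ 2) * z) =
        gaussianReal (ρ * x) (1 - ρ ^ 2).toNNReal := by
      have : (fun z => ρ * x + Real.sqrt (1 - ρ ^ 2) * z) =
          (fun z => ρ * x + z) ∘ (fun z => Real.sqrt (1 - ρ ^ 2) * z) := rfl
      rw [this, ← Measure.map_map (by fun_prop) (by fun_prop), gaussianReal_map_const_mul,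
        gaussianReal_map_const_add]
      congr 1
      · ring
      · ext
        simp [Real.sq_sqrt hr.le, hr.le]
    have hpre : Prod.mk x ⁻¹'
        ((fun p : ℝ × ℝ => (p.1, ρ • p.1 + Real.sqrt (1 - ρ ^ 2) • p.2)) ⁻¹' s)
        = (fun z => ρ * x + Real.sqrt (1 - ρ ^ 2) * z) ⁻¹' (Prod.mk x ⁻¹' s) := rfl
    have hsx : MeasurableSet (Prod.mk x ⁻¹' s) := measurable_prodMk_left hs
    rw [Pi.mul_apply, ← gaussianReal_of_var_ne_zero 0 one_ne_zero, hpre,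
      ← Measure.map_apply (by fun_prop) hsx, hmap, gaussianReal_apply _ hv,
      ← lintegral_indicator hsx, ← lintegral_const_mul _
        ((measurable_gaussianPDF _ _).indicator hsx)]
    refine lintegral_congr fun y => ?_
    by_cases hy : (x, y) ∈ s
    · rw [indicator_of_mem hy, indicator_of_mem (by exact hy), pairDensity,
        ENNReal.ofReal_mul (gaussianPDFReal_nonneg _ _ _)]
      rfl
    · rw [indicator_of_notMem hy, indicator_of_notMem (by exact hy), mul_zero]
  · rw [← gaussianReal_of_var_ne_zero 0 one_ne_zero]
    exact measurable_measure_prodMk_left (measurable_correlate ρ hs)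

lemma pairDensity_neg_neg (s t : ℝ) : pairDensity ρ (-s, -t) = pairDensity ρ (s, t) := by
  simp only [pairDensity, gaussianPDFReal]
  congr 3 <;> ring_nf

lemma pairDensity_neg_right (s t : ℝ) : pairDensity ρ (s, -t) = pairDensity ρ (-s, t) := by
  rw [← pairDensity_neg_neg, neg_neg]

/-- Positively correlated normal variables are more likely to have equal signs. -/
lemma pairDensity_neg_lt (h₀ : 0 < ρ) (h₂ : ρ < 1) {s t : ℝ} (hst : 0 < s * t) :
    pairDensity ρ (-s, t) < pairDensity ρ (s, t) := by
  have hr : 0 < 1 - ρ ^ 2 := by nlinarith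
  have hv : 0 < (1 - ρ ^ 2).toNNReal := by simpa using hr
  simp only [pairDensity, gaussianPDFReal]
  rw [show (-s - 0) ^ 2 = (s - 0) ^ 2 by ring]
  have h1 : 0 < ((1 - ρ ^ 2).toNNReal : ℝ) := hv
  have h2 : -(t - ρ * -s) ^ 2 < -(t - ρ * s) ^ 2 := by nlinarith [mul_pos h₀ hst]
  gcongr

end Densities

/-! ### Polarization and its equality case -/

section Polarization

variable {E : Type*}

/-- Reflection of the first coordinate. -/
def flip (p : ℝ × E) : ℝ × E := (-p.1, p.2)


lemma flip_flip (p : ℝ × E) : flip (flip p) = p := by simp [flip]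

/-- The two-point symmetrization of `A`, moving mass from `{t < 0}` to `{t > 0}`. A point with
`t = 0` is its own reflection and stays in place. -/
def polarize (A : Set (ℝ × E)) : Set (ℝ × E) :=
  {p | (0 < p.1 ∧ (p ∈ A ∨ flip p ∈ A)) ∨ (p.1 ≤ 0 ∧ p ∈ A ∧ flip p ∈ A)}

/-- The points of `A` in `{t > 0}` whose reflection is not in `A`. -/
def gain (A : Set (ℝ × E)) : Set (ℝ × E) := {p | 0 < p.1 ∧ p ∈ A ∧ flip p ∉ A}

lemma indicator_polarize_add (A : Set (ℝ × E)) (p : ℝ × E) :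
    (polarize A).indicator (fun _ => (1 : ℝ)) p +
      (polarize A).indicator (fun _ => (1 : ℝ)) (flip p) =
    A.indicator (fun _ => (1 : ℝ)) p + A.indicator (fun _ => (1 : ℝ)) (flip p) := by
  classical
  have hf : flip (flip p) = p := flip_flip p
  rcases lt_trichotomy p.1 0 with h | h | h
  · have h' : 0 < (flip p).1 := by simpa [flip] using h
    by_cases h1 : p ∈ A <;> by_cases h2 : flip p ∈ A <;>
      simp [polarize, h1, h2, hf, h', h.le, not_lt.2 h.le, not_le.2 h']
  · have h' : flip p = p := by ext <;> simp [flip, h]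
    by_cases h1 : p ∈ A <;> simp [polarize, h1, h', h]
  · have h' : (flip p).1 < 0 := by simpa [flip] using h
    by_cases h1 : p ∈ A <;> by_cases h2 : flip p ∈ A <;>
      simp [polarize, h1, h2, hf, h, h'.le, not_lt.2 h'.le, not_le.2 h]

variable [MeasurableSpace E]

lemma measurable_flip : Measurable (flip : ℝ × E → ℝ × E) := by unfold flip; fun_prop

lemma measurableSet_polarize {A : Set (ℝ × E)} (hA : MeasurableSet A) :
    MeasurableSet (polarize A) := by
  have h := measurable_flip hA
  exact ((measurableSet_lt measurable_const measurable_fst).inter (hA.union h)).union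
    ((measurableSet_le measurable_fst measurable_const).inter (hA.inter h))

lemma measurableSet_gain {A : Set (ℝ × E)} (hA : MeasurableSet A) : MeasurableSet (gain A) :=
  (measurableSet_lt measurable_const measurable_fst).inter (hA.inter (measurable_flip hA).compl)

variable [NormedAddCommGroup E] [InnerProductSpace ℝ E] [FiniteDimensional ℝ E] [BorelSpace E]

lemma measurePreserving_flip :
    MeasurePreserving (flip : ℝ × E → ℝ × E) ((N₁).prod (stdGaussian E))
      ((N₁).prod (stdGaussian E)) :=
  (measurePreserving_neg_gaussian integral_id_stdNormal).prod (MeasurePreserving.id _)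

lemma real_polarize {A : Set (ℝ × E)} (hA : MeasurableSet A) :
    ((N₁).prod (stdGaussian E)).real (polarize A) = ((N₁).prod (stdGaussian E)).real A := by
  have key : ∀ B : Set (ℝ × E), MeasurableSet B →
      2 * ((N₁).prod (stdGaussian E)).real B =
        ∫ p, (B.indicator (fun _ => (1 : ℝ)) p + B.indicator (fun _ => (1 : ℝ)) (flip p))
          ∂((N₁).prod (stdGaussian E)) := by
    intro B hB
    have i : Integrable (fun p => B.indicator (fun _ => (1 : ℝ)) p) ((N₁).prod (stdGaussian E)) :=
      (integrable_const _).indicator hB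
    have i' : Integrable (fun p => B.indicator (fun _ => (1 : ℝ)) (flip p))
        ((N₁).prod (stdGaussian E)) := measurePreserving_flip.integrable_comp_of_integrable i
    rw [integral_add i i', integral_comp_measurePreserving measurePreserving_flip
      i.aestronglyMeasurable, integral_indicator_const _ hB]
    simp; ring
  have h1 := key _ (measurableSet_polarize hA)
  simp_rw [indicator_polarize_add] at h1
  linarith [key A hA]

/-- The measure `dt dt' ⊗ Π_E`, with respect to which the correlated pair on `ℝ × E` has density
`pairDensity ρ (t, t')`. -/
def refMeasure (E : Type*) [NormedAddCommGroup E] [InnerProductSpace ℝ E] [FiniteDimensional ℝ E]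
    [MeasurableSpace E] [BorelSpace E] (ρ : ℝ) : Measure ((ℝ × ℝ) × (E × E)) :=
  (volume : Measure (ℝ × ℝ)).prod (correlatedPair (stdGaussian E) ρ)

/-- The integrand obtained by averaging `pairDensity ρ (t, t') 1_A(t, z) 1_B(t', z')` over the
four sign changes of `t` and `t'` (and multiplying by four). -/
def foldedIntegrand (ρ : ℝ) (A B : Set (ℝ × E)) (w : (ℝ × ℝ) × (E × E)) : ℝ :=
  pairDensity ρ w.1 *
    (A.indicator (fun _ => (1 : ℝ)) (w.1.1, w.2.1) * B.indicator (fun _ => (1 : ℝ)) (w.1.2, w.2.2) +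
      A.indicator (fun _ => (1 : ℝ)) (flip (w.1.1, w.2.1)) *
        B.indicator (fun _ => (1 : ℝ)) (flip (w.1.2, w.2.2))) +
  pairDensity ρ (-w.1.1, w.1.2) *
    (A.indicator (fun _ => (1 : ℝ)) (flip (w.1.1, w.2.1)) *
        B.indicator (fun _ => (1 : ℝ)) (w.1.2, w.2.2) +
      A.indicator (fun _ => (1 : ℝ)) (w.1.1, w.2.1) *
        B.indicator (fun _ => (1 : ℝ)) (flip (w.1.2, w.2.2)))

variable {ρ : ℝ}

lemma integrable_and_integral_density (h₁ : -1 < ρ) (h₂ : ρ < 1) {A B : Set (ℝ × E)}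
    (hA : MeasurableSet A) (hB : MeasurableSet B) :
    Integrable (fun w => pairDensity ρ w.1 * (A.indicator (fun _ => (1 : ℝ)) (w.1.1, w.2.1) *
      B.indicator (fun _ => (1 : ℝ)) (w.1.2, w.2.2))) (refMeasure E ρ) ∧
    ∫ w, pairDensity ρ w.1 * (A.indicator (fun _ => (1 : ℝ)) (w.1.1, w.2.1) *
      B.indicator (fun _ => (1 : ℝ)) (w.1.2, w.2.2)) ∂(refMeasure E ρ) =
      (correlatedPair ((N₁).prod (stdGaussian E)) ρ).real (A ×ˢ B) := by
  have mp := measurePreserving_correlatedPair_prod N₁ (stdGaussian E) ρ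
  have hk : Measurable fun w : (ℝ × ℝ) × (E × E) => ENNReal.ofReal (pairDensity ρ w.1) :=
    (measurable_pairDensity.comp measurable_fst).ennreal_ofReal
  have hw : (correlatedPair N₁ ρ).prod (correlatedPair (stdGaussian E) ρ) =
      (refMeasure E ρ).withDensity (fun w => ENNReal.ofReal (pairDensity ρ w.1)) := by
    rw [correlatedPair_eq_withDensity h₁ h₂, refMeasure,
      prod_withDensity_left measurable_pairDensity.ennreal_ofReal]
  let S : Set ((ℝ × ℝ) × (E × E)) := {w | (w.1.1, w.2.1) ∈ A ∧ (w.1.2, w.2.2) ∈ B}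
  have hS : MeasurableSet S := by
    have m := mp.measurable (hA.prod hB)
    exact m
  have e : ∀ w : (ℝ × ℝ) × (E × E), A.indicator (fun _ => (1 : ℝ)) (w.1.1, w.2.1) *
      B.indicator (fun _ => (1 : ℝ)) (w.1.2, w.2.2) = S.indicator (fun _ => (1 : ℝ)) w := by
    classical
    intro w
    simp only [indicator_apply, S, Set.mem_ofPred_eq]
    split_ifs <;> simp_all
  simp_rw [e]
  have i : Integrable (S.indicator fun _ => (1 : ℝ))
      ((correlatedPair N₁ ρ).prod (correlatedPair (stdGaussian E) ρ)) :=
    (integrable_const _).indicator hS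
  have hm : (correlatedPair ((N₁).prod (stdGaussian E)) ρ).real (A ×ˢ B) =
      ((correlatedPair N₁ ρ).prod (correlatedPair (stdGaussian E) ρ)).real S :=
    (mp.measureReal_preimage (hA.prod hB).nullMeasurableSet).symm
  have hi : ∫ w, S.indicator (fun _ => (1 : ℝ)) w
      ∂((correlatedPair N₁ ρ).prod (correlatedPair (stdGaussian E) ρ)) =
      ((correlatedPair N₁ ρ).prod (correlatedPair (stdGaussian E) ρ)).real S := by
    rw [integral_indicator_const _ hS]; simp
  rw [hm, ← hi]
  rw [hw] at i ⊢
  constructor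
  · rw [integrable_withDensity_iff_integrable_smul' hk (by simp)] at i
    refine i.congr (ae_of_all _ fun w => ?_)
    simp [ENNReal.toReal_ofReal (pairDensity_nonneg w.1)]
  · rw [integral_withDensity_eq_integral_toReal_smul hk (by simp)]
    refine integral_congr_ae (ae_of_all _ fun w => ?_)
    simp [ENNReal.toReal_ofReal (pairDensity_nonneg w.1)]

lemma measurePreserving_flip_left : MeasurePreserving
    (fun w : (ℝ × ℝ) × (E × E) => ((-w.1.1, w.1.2), w.2)) (refMeasure E ρ) (refMeasure E ρ) :=
  ((Measure.measurePreserving_neg volume).prod (MeasurePreserving.id volume)).prod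
    (MeasurePreserving.id _)

lemma measurePreserving_flip_right : MeasurePreserving
    (fun w : (ℝ × ℝ) × (E × E) => ((w.1.1, -w.1.2), w.2)) (refMeasure E ρ) (refMeasure E ρ) :=
  ((MeasurePreserving.id volume).prod (Measure.measurePreserving_neg volume)).prod
    (MeasurePreserving.id _)

lemma integral_add_add_add {α : Type*} [MeasurableSpace α] {μ : Measure α} {f₁ f₂ f₃ f₄ : α → ℝ}
    (h₁ : Integrable f₁ μ) (h₂ : Integrable f₂ μ) (h₃ : Integrable f₃ μ) (h₄ : Integrable f₄ μ) :
    ∫ w, (f₁ w + f₂ w) + (f₃ w + f₄ w) ∂μ =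
      (∫ w, f₁ w ∂μ + ∫ w, f₂ w ∂μ) + (∫ w, f₃ w ∂μ + ∫ w, f₄ w ∂μ) := by
  rw [← integral_add h₁ h₂, ← integral_add h₃ h₄]
  exact integral_add (h₁.add h₂) (h₃.add h₄)

lemma integral_foldedIntegrand (h₁ : -1 < ρ) (h₂ : ρ < 1) {A B : Set (ℝ × E)}
    (hA : MeasurableSet A) (hB : MeasurableSet B) :
    Integrable (foldedIntegrand ρ A B) (refMeasure E ρ) ∧
    ∫ w, foldedIntegrand ρ A B w ∂(refMeasure E ρ) =
      4 * (correlatedPair ((N₁).prod (stdGaussian E)) ρ).real (A ×ˢ B) := by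
  obtain ⟨i, hi⟩ := integrable_and_integral_density h₁ h₂ hA hB
  have ml := measurePreserving_flip_left (E := E) (ρ := ρ)
  have mr := measurePreserving_flip_right (E := E) (ρ := ρ)
  have il := ml.integrable_comp_of_integrable i
  have ir := mr.integrable_comp_of_integrable i
  have ilr := (ml.comp mr).integrable_comp_of_integrable i
  have el := integral_comp_measurePreserving ml i.aestronglyMeasurable
  have er := integral_comp_measurePreserving mr i.aestronglyMeasurable
  have elr := integral_comp_measurePreserving (ml.comp mr) i.aestronglyMeasurable
  have e : foldedIntegrand ρ A B = fun w => (pairDensity ρ w.1 *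
      (A.indicator (fun _ => (1 : ℝ)) (w.1.1, w.2.1) *
        B.indicator (fun _ => (1 : ℝ)) (w.1.2, w.2.2)) +
      pairDensity ρ (-w.1.1, w.1.2) * (A.indicator (fun _ => (1 : ℝ)) (-w.1.1, w.2.1) *
        B.indicator (fun _ => (1 : ℝ)) (w.1.2, w.2.2))) +
      (pairDensity ρ (w.1.1, -w.1.2) * (A.indicator (fun _ => (1 : ℝ)) (w.1.1, w.2.1) *
        B.indicator (fun _ => (1 : ℝ)) (-w.1.2, w.2.2)) +
      pairDensity ρ (-w.1.1, -w.1.2) * (A.indicator (fun _ => (1 : ℝ)) (-w.1.1, w.2.1) *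
        B.indicator (fun _ => (1 : ℝ)) (-w.1.2, w.2.2))) := by
    ext w
    rw [pairDensity_neg_neg, pairDensity_neg_right]
    simp only [foldedIntegrand, flip]
    ring
  rw [e]
  refine ⟨(i.add il).add (ir.add ilr), ?_⟩
  simp only [Function.comp_def] at el er elr il ir ilr
  rw [integral_add_add_add i il ir ilr, el, er, elr, hi]
  ring

omit [MeasurableSpace E] [NormedAddCommGroup E] [InnerProductSpace ℝ E] [FiniteDimensional ℝ E]
  [BorelSpace E] in
/-- Polarization does not decrease the folded integrand, and increases it strictly where the two
sets prefer opposite sides. -/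
lemma foldedIntegrand_polarize (h₀ : 0 < ρ) (h₂ : ρ < 1) (A B : Set (ℝ × E))
    (w : (ℝ × ℝ) × (E × E)) :
    foldedIntegrand ρ A B w ≤ foldedIntegrand ρ (polarize A) (polarize B) w ∧
    (foldedIntegrand ρ A B w = foldedIntegrand ρ (polarize A) (polarize B) w →
      ¬ ((w.1.1, w.2.1) ∈ gain A ∧ (w.1.2, w.2.2) ∈ gain Bᶜ) ∧
      ¬ ((w.1.1, w.2.1) ∈ gain Aᶜ ∧ (w.1.2, w.2.2) ∈ gain B)) := by
  classical
  obtain ⟨⟨t, t'⟩, ⟨z, z'⟩⟩ := w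
  -- The first summand is the same for the polarized sets, so only the second one matters.
  have e (A B : Set (ℝ × E)) : foldedIntegrand ρ A B ((t, t'), (z, z')) =
      pairDensity ρ (-t, t') *
        ((A.indicator (fun _ => (1 : ℝ)) (t, z) + A.indicator (fun _ => (1 : ℝ)) (flip (t, z))) *
        (B.indicator (fun _ => (1 : ℝ)) (t', z') +
          B.indicator (fun _ => (1 : ℝ)) (flip (t', z')))) +
      (pairDensity ρ (t, t') - pairDensity ρ (-t, t')) *
        (A.indicator (fun _ => (1 : ℝ)) (t, z) * B.indicator (fun _ => (1 : ℝ)) (t', z') +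
        A.indicator (fun _ => (1 : ℝ)) (flip (t, z)) *
          B.indicator (fun _ => (1 : ℝ)) (flip (t', z'))) := by
    simp only [foldedIntegrand]; ring
  rw [e, e, indicator_polarize_add, indicator_polarize_add, add_le_add_iff_left, add_right_inj]
  simp only [gain, polarize, indicator_apply, Set.mem_ofPred_eq, mem_compl_iff, not_not]
  have hp : flip (flip (t, z)) = (t, z) := flip_flip _
  have hq : flip (flip (t', z')) = (t', z') := flip_flip _
  have hp1 : (flip (t, z)).1 = -t := rfl
  have hq1 : (flip (t', z')).1 = -t' := rfl
  simp only [hp, hq, hp1, hq1]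
  have hpos : 0 < t * t' → 0 < pairDensity ρ (t, t') - pairDensity ρ (-t, t') := fun h =>
    sub_pos.2 (pairDensity_neg_lt h₀ h₂ h)
  have hneg : t * t' < 0 → pairDensity ρ (t, t') - pairDensity ρ (-t, t') < 0 := fun h => by
    have := pairDensity_neg_lt h₀ h₂ (s := -t) (t := t') (by linarith)
    rw [neg_neg] at this
    linarith
  have hzero : t * t' = 0 → pairDensity ρ (t, t') - pairDensity ρ (-t, t') = 0 := fun h => by
    rcases mul_eq_zero.1 h with rfl | rfl
    · simp
    · rw [← pairDensity_neg_right]; simp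
  generalize pairDensity ρ (t, t') - pairDensity ρ (-t, t') = k at *
  rcases eq_or_ne k 0 with rfl | hk
  · have h0 : ¬ (0 < t ∧ 0 < t') := fun h => (hpos (mul_pos h.1 h.2)).ne' rfl
    simp only [zero_mul, le_refl, true_and]
    exact fun _ => ⟨fun h => h0 ⟨h.1.1, h.2.1⟩, fun h => h0 ⟨h.1.1, h.2.1⟩⟩
  have ht : t ≠ 0 := by rintro rfl; exact hk (hzero (zero_mul _))
  have ht' : t' ≠ 0 := by rintro rfl; exact hk (hzero (mul_zero _))
  rcases ht.lt_or_gt with h | h <;> rcases ht'.lt_or_gt with h' | h'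
  · have hk := hpos (mul_pos_of_neg_of_neg h h')
    by_cases a1 : (t, z) ∈ A <;> by_cases a2 : flip (t, z) ∈ A <;> by_cases b1 : (t', z') ∈ B <;>
      by_cases b2 : flip (t', z') ∈ B <;>
      simp [a1, a2, b1, b2, h, h', h.le, h'.le, not_lt.2 h.le, not_lt.2 h'.le, not_le.2 h,
        not_le.2 h', hk.le]
  · have hk := hneg (mul_neg_of_neg_of_pos h h')
    by_cases a1 : (t, z) ∈ A <;> by_cases a2 : flip (t, z) ∈ A <;> by_cases b1 : (t', z') ∈ B <;>
      by_cases b2 : flip (t', z') ∈ B <;>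
      simp [a1, a2, b1, b2, h, h', h.le, h'.le, not_lt.2 h.le, not_lt.2 h'.le, not_le.2 h,
        not_le.2 h', hk.le]
  · have hk := hneg (mul_neg_of_pos_of_neg h h')
    by_cases a1 : (t, z) ∈ A <;> by_cases a2 : flip (t, z) ∈ A <;> by_cases b1 : (t', z') ∈ B <;>
      by_cases b2 : flip (t', z') ∈ B <;>
      simp [a1, a2, b1, b2, h, h', h.le, h'.le, not_lt.2 h.le, not_lt.2 h'.le, not_le.2 h,
        not_le.2 h', hk.le]
  · have hk := hpos (mul_pos h h')
    by_cases a1 : (t, z) ∈ A <;> by_cases a2 : flip (t, z) ∈ A <;> by_cases b1 : (t', z') ∈ B <;>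
      by_cases b2 : flip (t', z') ∈ B <;>
      simp [a1, a2, b1, b2, h, h', h.le, h'.le, not_lt.2 h.le, not_lt.2 h'.le, not_le.2 h,
        not_le.2 h', hk.le, hk.ne]

/-- Equality in Borell's inequality forces two sets to prefer the same side of a reflection. -/
lemma gain_null_of_eq (h₀ : 0 < ρ) (h₂ : ρ < 1) {A B : Set (ℝ × E)}
    (hA : MeasurableSet A) (hB : MeasurableSet B)
    (heq : (correlatedPair ((N₁).prod (stdGaussian E)) ρ).real (A ×ˢ B) =
      J ρ (((N₁).prod (stdGaussian E)).real A) (((N₁).prod (stdGaussian E)).real B)) :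
    (((N₁).prod (stdGaussian E)) (gain A) = 0 ∨ ((N₁).prod (stdGaussian E)) (gain Bᶜ) = 0) ∧
    (((N₁).prod (stdGaussian E)) (gain Aᶜ) = 0 ∨ ((N₁).prod (stdGaussian E)) (gain B) = 0) := by
  have h₁ : -1 < ρ := by linarith
  obtain ⟨i, hi⟩ := integral_foldedIntegrand h₁ h₂ hA hB
  have hA' := measurableSet_polarize hA
  have hB' := measurableSet_polarize hB
  obtain ⟨i', hi'⟩ := integral_foldedIntegrand h₁ h₂ hA' hB'
  have hle := correlatedPair_prod_le_J_of_prod h₀.le h₂ hA' hB'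
  rw [real_polarize hA, real_polarize hB, ← heq] at hle
  have hae : foldedIntegrand ρ A B =ᵐ[refMeasure E ρ]
      foldedIntegrand ρ (polarize A) (polarize B) := by
    rw [← integral_eq_iff_of_ae_le i i'
      (ae_of_all _ fun w => (foldedIntegrand_polarize h₀ h₂ A B w).1)]
    refine le_antisymm (integral_mono i i' fun w => (foldedIntegrand_polarize h₀ h₂ A B w).1) ?_
    rw [hi, hi']; linarith
  have ac : ((N₁).prod N₁).prod ((stdGaussian E).prod (stdGaussian E)) ≪ refMeasure E ρ :=
    ((gaussianReal_absolutelyContinuous 0 one_ne_zero).prod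
      (gaussianReal_absolutelyContinuous 0 one_ne_zero)).prod
      (prod_absolutelyContinuous_correlatedPair h₁ h₂)
  have mp := measurePreserving_prodProdComm N₁ N₁ (stdGaussian E) (stdGaussian E)
  have key : ∀ S T : Set (ℝ × E), MeasurableSet S → MeasurableSet T →
      (∀ᵐ w ∂(refMeasure E ρ), ¬ ((w.1.1, w.2.1) ∈ S ∧ (w.1.2, w.2.2) ∈ T)) →
      ((N₁).prod (stdGaussian E)) S = 0 ∨ ((N₁).prod (stdGaussian E)) T = 0 := by
    intro S T hS hT h
    rw [← mul_eq_zero, ← Measure.prod_prod, ← mp.measure_preimage (hS.prod hT).nullMeasurableSet]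
    have h' := ac h
    convert h' using 2
    ext w; simp
  have hw := hae.mono fun w h => (foldedIntegrand_polarize h₀ h₂ A B w).2 h
  exact ⟨key _ _ (measurableSet_gain hA) (measurableSet_gain hB.compl) (hw.mono fun w h => h.1),
    key _ _ (measurableSet_gain hA.compl) (measurableSet_gain hB) (hw.mono fun w h => h.2)⟩

end Polarization

/-! ### Translations preserving a set, and half-spaces -/

section Translations

variable {E : Type*} [NormedAddCommGroup E] [InnerProductSpace ℝ E] [FiniteDimensional ℝ E]
  [MeasurableSpace E] [BorelSpace E]

/-- The vectors `v` with `A + v ⊆ A` up to null sets. -/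
def translations (A : Set E) : AddSubmonoid E where
  carrier := {v | ∀ᵐ x ∂(volume : Measure E), x ∈ A → x + v ∈ A}
  zero_mem' := ae_of_all _ fun x hx => by simpa using hx
  add_mem' {v w} hv hw := by
    have hw' := (measurePreserving_add_right (volume : Measure E) v).quasiMeasurePreserving.ae hw
    filter_upwards [hv, hw'] with x h1 h2 h3
    rw [← add_assoc]
    exact h2 (h1 h3)

/-- Fubini turns invariance under each translation in `S` into a statement about almost all
pairs of points. -/
lemma ae_mem_of_sub_mem {A S : Set E} (hA : MeasurableSet A) (hS : MeasurableSet S)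
    (h : S ⊆ translations A) :
    ∀ᵐ p ∂((stdGaussian E).prod (stdGaussian E)), p.2 - p.1 ∈ S → p.1 ∈ A → p.2 ∈ A := by
  refine (stdGaussian_absolutelyContinuous (E := E)).prod stdGaussian_absolutelyContinuous
    (?_ : ∀ᵐ p ∂((volume : Measure E).prod (volume : Measure E)),
      p.2 - p.1 ∈ S → p.1 ∈ A → p.2 ∈ A)
  have mp := measurePreserving_prod_add (volume : Measure E) (volume : Measure E)
  have hm : MeasurableSet {p : E × E | p.2 - p.1 ∈ S → p.1 ∈ A → p.2 ∈ A} := by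
    have h1 : MeasurableSet {p : E × E | p.2 - p.1 ∈ S} :=
      (measurable_snd.sub measurable_fst) hS
    exact h1.imp ((measurable_fst hA).imp (measurable_snd hA))
  rw [← mp.map_eq, ae_map_iff mp.measurable.aemeasurable hm]
  have hm' : MeasurableSet {p : E × E | p.2 ∈ S → p.1 ∈ A → p.1 + p.2 ∈ A} :=
    (measurable_snd hS).imp ((measurable_fst hA).imp ((measurable_fst.add measurable_snd) hA))
  simp only [add_sub_cancel_left]
  have sw := Measure.measurePreserving_swap (μ := (volume : Measure E)) (ν := (volume : Measure E))
  rw [← sw.map_eq, ae_map_iff sw.measurable.aemeasurable hm']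
  refine (Measure.ae_prod_iff_ae_ae (sw.measurable hm')).2 (ae_of_all _ fun v => ?_)
  by_cases hv : v ∈ S
  · filter_upwards [h hv] with x hx _ hxA using hx hxA
  · exact ae_of_all _ fun x h => absurd h hv

/-- A set invariant under all translations has measure `0` or `1`. -/
lemma measure_of_translations_eq_top {A : Set E} (hA : MeasurableSet A)
    (h : translations A = ⊤) : stdGaussian E A = 0 ∨ stdGaussian E A = 1 := by
  have hae := ae_mem_of_sub_mem hA (S := univ) MeasurableSet.univ (by rw [h]; simp)
  have h0 : ((stdGaussian E).prod (stdGaussian E)) (A ×ˢ Aᶜ) = 0 := by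
    rw [ae_iff] at hae
    convert hae using 2
    ext p; simp
  rw [Measure.prod_prod, mul_eq_zero] at h0
  exact h0.imp_right fun h => (prob_compl_eq_zero_iff hA).1 h

lemma map_inner_stdGaussian {u : E} (hu : ‖u‖ = 1) :
    MeasurePreserving (fun x => inner ℝ u x) (stdGaussian E) N₁ := by
  refine ⟨by fun_prop, ?_⟩
  refine Measure.ext_of_charFun (funext fun t => ?_)
  have h : charFun ((stdGaussian E).map fun x => inner ℝ u x) t =
      charFun (stdGaussian E) (t • u) := by
    rw [charFun_apply, charFun_apply, integral_map (by fun_prop) (by fun_prop)]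
    simp [inner_smul_right, real_inner_comm, mul_comm]
  rw [h, charFun_stdGaussian, charFun_gaussianReal]
  simp [norm_smul, hu, neg_div, ← Complex.ofReal_pow]

/-- A set preserved by all translations pointing into a half-space is a half-space. -/
lemma exists_ae_eq_halfspace {A : Set E} (hA : MeasurableSet A) {u : E} (hu : ‖u‖ = 1)
    (h0 : stdGaussian E A ≠ 0) (h1 : stdGaussian E A ≠ 1)
    (h : {v | 0 < inner ℝ u v} ⊆ (translations A : Set E)) :
    ∃ c : ℝ, A =ᵐ[stdGaussian E] {x | c ≤ inner ℝ u x} := by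
  have hp : (stdGaussian E).real Aᶜ ∈ Ioo 0 1 := by
    rw [probReal_compl_eq_one_sub hA]
    have a1 : (stdGaussian E).real A ≠ 0 := by
      simpa [measureReal_def, ENNReal.toReal_eq_zero_iff] using h0
    have a2 : (stdGaussian E).real A ≠ 1 := by
      simpa [measureReal_def, ENNReal.toReal_eq_one_iff] using h1
    have a3 : 0 ≤ (stdGaussian E).real A := measureReal_nonneg
    have a4 : (stdGaussian E).real A ≤ 1 := measureReal_le_one
    have a5 := lt_of_le_of_ne a3 a1.symm
    have a6 := lt_of_le_of_ne a4 a2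
    constructor <;> linarith
  obtain ⟨c, hc⟩ := exists_Phi_eq hp
  let H : Set E := {x | c ≤ inner ℝ u x}
  have hHm : MeasurableSet H := measurableSet_le measurable_const (by fun_prop)
  have hH : (stdGaussian E).real H = (stdGaussian E).real A := by
    have e1 : (stdGaussian E).real H = (N₁).real (Ici c) :=
      (map_inner_stdGaussian hu).measureReal_preimage measurableSet_Ici.nullMeasurableSet
    have e2 : (N₁).real (Ici c) = 1 - Phi c := by
      rw [← measureReal_congr Ioi_ae_eq_Ici, ← compl_Iic,
        probReal_compl_eq_one_sub measurableSet_Iic]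
      rfl
    rw [e1, e2, hc, probReal_compl_eq_one_sub hA]; ring
  have hae := ae_mem_of_sub_mem hA (measurableSet_lt measurable_const (by fun_prop)) h
  have h0 : ((stdGaussian E).prod (stdGaussian E)) ((A \ H) ×ˢ (H \ A)) = 0 := by
    refine measure_mono_null ?_ (ae_iff.1 hae)
    rintro ⟨x, y⟩ ⟨⟨hx1, hx2⟩, hy1, hy2⟩
    simp only [H, Set.mem_ofPred_eq, not_le] at hx2 hy1
    simp only [Set.mem_ofPred_eq, inner_sub_right, Classical.not_imp]
    exact ⟨by linarith, hx1, hy2⟩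
  have e1 := measureReal_sdiff_add_inter (μ := stdGaussian E) (s := A) hHm
  have e2 := measureReal_sdiff_add_inter (μ := stdGaussian E) (s := H) hA
  rw [inter_comm] at e2
  have e3 : (stdGaussian E).real (A \ H) = 0 ∧ (stdGaussian E).real (H \ A) = 0 := by
    rw [Measure.prod_prod, mul_eq_zero] at h0
    rcases h0 with h0 | h0
    · have : (stdGaussian E).real (A \ H) = 0 := by simp [measureReal_def, h0]
      constructor <;> linarith
    · have : (stdGaussian E).real (H \ A) = 0 := by simp [measureReal_def, h0]
      constructor <;> linarith
  refine ⟨c, ?_⟩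
  rw [measureReal_eq_zero_iff, measureReal_eq_zero_iff] at e3
  exact ae_eq_set.2 e3

end Translations

section Tilt

variable {E : Type*} [NormedAddCommGroup E] [InnerProductSpace ℝ E]

/-- A linear map of `ℝ × E` which, for a unit vector `e`, is a reflection in the plane spanned by
the first coordinate and `e`. The coefficients come from the triple `(3, 4, 5)`; any reflection that
mixes the two directions would do. -/
def tilt (e : E) : ℝ × E →ₗ[ℝ] ℝ × E :=
  LinearMap.prod ((-4 / 5 : ℝ) • LinearMap.fst ℝ ℝ E +
      (3 / 5 : ℝ) • (innerₛₗ ℝ e ∘ₗ LinearMap.snd ℝ ℝ E))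
    (LinearMap.snd ℝ ℝ E + ((3 / 5 : ℝ) • LinearMap.fst ℝ ℝ E -
      (1 / 5 : ℝ) • (innerₛₗ ℝ e ∘ₗ LinearMap.snd ℝ ℝ E)).smulRight e)

lemma tilt_apply (e : E) (p : ℝ × E) :
    tilt e p = (-4 / 5 * p.1 + 3 / 5 * inner ℝ e p.2,
      p.2 + (3 / 5 * p.1 - 1 / 5 * inner ℝ e p.2) • e) := by
  simp [tilt]

lemma tilt_tilt {e : E} (he : ‖e‖ = 1) (p : ℝ × E) : tilt e (tilt e p) = p := by
  have h : inner ℝ e e = 1 := by simp [he]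
  ext
  · simp only [tilt_apply, inner_add_right, inner_smul_right, h]; ring
  · simp only [tilt_apply, inner_add_right, inner_smul_right, h]
    module

variable [FiniteDimensional ℝ E] [MeasurableSpace E] [BorelSpace E]

lemma measurable_tilt (e : E) : Measurable (tilt e) := by
  have : (tilt e : ℝ × E → ℝ × E) = fun p => _ := funext (tilt_apply e)
  rw [this]
  fun_prop

lemma measurePreserving_tilt {e : E} (he : ‖e‖ = 1) :
    MeasurePreserving (tilt e) ((N₁).prod (stdGaussian E)) ((N₁).prod (stdGaussian E)) := by
  have h : inner ℝ e e = 1 := by simp [he]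
  have mp := measurePreserving_ofLp_stdGaussian (E := ℝ) E
  rw [stdGaussian_real] at mp
  let f : WithLp 2 (ℝ × E) →ₗ[ℝ] WithLp 2 (ℝ × E) :=
    (WithLp.linearEquiv 2 ℝ (ℝ × E)).symm.toLinearMap ∘ₗ tilt e ∘ₗ
      (WithLp.linearEquiv 2 ℝ (ℝ × E)).toLinearMap
  have hf : Function.Involutive f := fun p => by simp [f, tilt_tilt he]
  let R : WithLp 2 (ℝ × E) ≃ₗᵢ[ℝ] WithLp 2 (ℝ × E) :=
    { LinearEquiv.ofInvolutive f hf with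
      norm_map' := fun p => by
        have : ‖f p‖ ^ 2 = ‖p‖ ^ 2 := by
          have hfp : f p = WithLp.toLp 2 (tilt e (WithLp.ofLp p)) := rfl
          rw [WithLp.prod_norm_sq_eq_of_L2, WithLp.prod_norm_sq_eq_of_L2, hfp, tilt_apply]
          have hn (z : E) (c : ℝ) : ‖z + c • e‖ ^ 2 = ‖z‖ ^ 2 + 2 * (c * inner ℝ e z) + c ^ 2 := by
            rw [norm_add_sq_real, norm_smul, he, inner_smul_right, real_inner_comm]
            simp
          simp only [hn, Real.norm_eq_abs, sq_abs, WithLp.ofLp_fst, WithLp.ofLp_snd,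
            WithLp.toLp_fst, WithLp.toLp_snd]
          ring
        exact (sq_eq_sq₀ (norm_nonneg _) (norm_nonneg _)).1 this }
  have hR := stdGaussian_map R
  refine ⟨measurable_tilt e, ?_⟩
  conv_lhs => rw [← mp.map_eq, Measure.map_map (measurable_tilt e) mp.measurable]
  conv_rhs => rw [← mp.map_eq, ← hR, Measure.map_map mp.measurable (by fun_prop)]
  rfl

/-- If `gain S` is null, then `S` leans towards `{t < 0}`: its first moment in `t` is nonpositive,
and it vanishes only if `S` is symmetric. -/
lemma integral_fst_mul_indicator {S : Set (ℝ × E)} (hS : MeasurableSet S)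
    (h : (N₁).prod (stdGaussian E) (gain S) = 0) :
    ∫ p, p.1 * S.indicator (fun _ => (1 : ℝ)) p ∂((N₁).prod (stdGaussian E)) ≤ 0 ∧
    (∫ p, p.1 * S.indicator (fun _ => (1 : ℝ)) p ∂((N₁).prod (stdGaussian E)) = 0 →
      (N₁).prod (stdGaussian E) (gain Sᶜ) = 0) := by
  classical
  have mf := measurePreserving_flip (E := E)
  have i : Integrable (fun p : ℝ × E => p.1 * S.indicator (fun _ => (1 : ℝ)) p)
      ((N₁).prod (stdGaussian E)) := by
    have i1 : Integrable (fun p : ℝ × E => p.1) ((N₁).prod (stdGaussian E)) :=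
      Integrable.comp_fst IsGaussian.integrable_id _
    refine (i1.indicator hS).congr (ae_of_all _ fun p => ?_)
    by_cases hp : p ∈ S <;> simp [hp]
  have i' : Integrable (fun p : ℝ × E => -p.1 * S.indicator (fun _ => (1 : ℝ)) (flip p))
      ((N₁).prod (stdGaussian E)) := mf.integrable_comp_of_integrable i
  have e' : ∫ p : ℝ × E, -p.1 * S.indicator (fun _ => (1 : ℝ)) (flip p)
      ∂((N₁).prod (stdGaussian E)) =
      ∫ p, p.1 * S.indicator (fun _ => (1 : ℝ)) p ∂((N₁).prod (stdGaussian E)) :=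
    integral_comp_measurePreserving mf i.aestronglyMeasurable
  let D : ℝ × E → ℝ := fun p => p.1 * S.indicator (fun _ => (1 : ℝ)) p +
    -p.1 * S.indicator (fun _ => (1 : ℝ)) (flip p)
  have iD : Integrable D ((N₁).prod (stdGaussian E)) := i.add i'
  have hD : ∫ p, D p ∂((N₁).prod (stdGaussian E)) =
      2 * ∫ p, p.1 * S.indicator (fun _ => (1 : ℝ)) p ∂((N₁).prod (stdGaussian E)) := by
    rw [integral_add i i', e']; ring
  have h1 : ∀ᵐ p ∂((N₁).prod (stdGaussian E)), p ∉ gain S := by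
    rw [ae_iff]; simpa using h
  have h2 := mf.quasiMeasurePreserving.ae h1
  have hD0 : D ≤ᵐ[(N₁).prod (stdGaussian E)] 0 := by
    filter_upwards [h1, h2] with p hp hp'
    have hf := flip_flip p
    have hf1 : (flip p).1 = -p.1 := rfl
    simp only [gain, Set.mem_ofPred_eq, not_and, not_not, hf, hf1] at hp hp'
    simp only [D, indicator_apply, Pi.zero_apply]
    rcases lt_trichotomy p.1 0 with h | h | h
    · have := hp' (by linarith)
      split_ifs <;> simp_all
    · simp [h]
    · have := hp h
      split_ifs <;> simp_all
  constructor
  · have := integral_nonpos_of_ae hD0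
    linarith
  · intro h0
    have hz : D =ᵐ[(N₁).prod (stdGaussian E)] 0 := by
      rw [← integral_eq_iff_of_ae_le iD (integrable_zero _ _ _) hD0, hD, h0]
      simp
    have : ∀ᵐ p ∂((N₁).prod (stdGaussian E)), p ∉ gain Sᶜ := by
      filter_upwards [hz] with p hp hg
      have a1 : p ∉ S := hg.2.1
      have a2 : flip p ∈ S := not_not.1 hg.2.2
      have a3 := hg.1
      simp only [D, indicator_of_notMem a1, indicator_of_mem a2, Pi.zero_apply] at hp
      linarith
    rw [ae_iff] at this
    simpa using this

/-- The first moment in `t` of the tilted cylinder over `A` reads off the component along `e` of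
the Gaussian barycentre of `A`. -/
lemma integral_fst_mul_indicator_tilt {A : Set E} (hA : MeasurableSet A) {e : E} (he : ‖e‖ = 1) :
    ∫ p, p.1 * ((fun p => (tilt e p).2) ⁻¹' A).indicator (fun _ => (1 : ℝ)) p
      ∂((N₁).prod (stdGaussian E)) = 3 / 5 * inner ℝ e (∫ x in A, x ∂(stdGaussian E)) := by
  have mt := measurePreserving_tilt he
  have i1 : Integrable (fun p : ℝ × E => -4 / 5 * (p.1 * A.indicator (fun _ => (1 : ℝ)) p.2))
      ((N₁).prod (stdGaussian E)) :=
    (Integrable.mul_prod (f := fun t : ℝ => t) (g := A.indicator fun _ => (1 : ℝ))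
      IsGaussian.integrable_id ((integrable_const _).indicator hA)).const_mul _
  have i0 : Integrable (fun x => inner ℝ e x * A.indicator (fun _ => (1 : ℝ)) x)
      (stdGaussian E) := by
    refine ((integrable_inner_stdGaussian e).indicator hA).congr (ae_of_all _ fun x => ?_)
    by_cases hx : x ∈ A <;> simp [hx]
  have i2 : Integrable (fun p : ℝ × E => 3 / 5 * (inner ℝ e p.2 *
      A.indicator (fun _ => (1 : ℝ)) p.2)) ((N₁).prod (stdGaussian E)) :=
    (i0.comp_snd _).const_mul _
  have key := integral_comp_measurePreserving mt (i1.add i2).aestronglyMeasurable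
  have e1 : ∀ p : ℝ × E, p.1 * ((fun p => (tilt e p).2) ⁻¹' A).indicator (fun _ => (1 : ℝ)) p =
      ((fun p : ℝ × E => -4 / 5 * (p.1 * A.indicator (fun _ => (1 : ℝ)) p.2)) +
      (fun p : ℝ × E => 3 / 5 * (inner ℝ e p.2 * A.indicator (fun _ => (1 : ℝ)) p.2)))
      (tilt e p) := by
    intro p
    have h1 : p.1 = -4 / 5 * (tilt e p).1 + 3 / 5 * inner ℝ e (tilt e p).2 := by
      conv_lhs => rw [← tilt_tilt he p]
      rw [tilt_apply e (tilt e p)]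
    have h2 : ((fun p => (tilt e p).2) ⁻¹' A).indicator (fun _ => (1 : ℝ)) p =
      A.indicator (fun _ => (1 : ℝ)) (tilt e p).2 := rfl
    rw [h2, h1, Pi.add_apply]; ring
  simp_rw [e1]
  rw [key, integral_add' i1 i2, integral_const_mul, integral_const_mul,
    integral_prod_mul (fun t : ℝ => t) (A.indicator fun _ => (1 : ℝ)),
    integral_fun_snd (fun x => inner ℝ e x * A.indicator (fun _ => (1 : ℝ)) x)]
  have e2 : ∫ t : ℝ, t ∂N₁ = 0 := integral_id_stdNormal
  have e3 : inner ℝ e (∫ x in A, x ∂(stdGaussian E)) =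
      ∫ x, inner ℝ e x * A.indicator (fun _ => (1 : ℝ)) x ∂(stdGaussian E) := by
    have hid : Integrable (fun x : E => x) (stdGaussian E) := IsGaussian.integrable_id
    rw [← integral_inner hid.integrableOn,
      ← integral_indicator hA]
    refine integral_congr_ae (ae_of_all _ fun x => ?_)
    by_cases hx : x ∈ A <;> simp [hx]
  rw [e2, e3]
  simp

/-- In the coordinates `x = (tilt e (t, z)).2`, the reflection `t ↦ -t` moves `x` by a negative
multiple of `e` when `t > 0`, so nullity of `gain` says that `A` is stable under such moves. -/
lemma neg_smul_mem_translations {A : Set E} {e : E} (he : ‖e‖ = 1)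
    (h : (N₁).prod (stdGaussian E) (gain ((fun p => (tilt e p).2) ⁻¹' A)) = 0) {r : ℝ}
    (hr : 0 < r) : -(r • e) ∈ translations A := by
  have hee : inner ℝ e e = 1 := by simp [he]
  -- `Ψ (r, x)` is the point `(t, z)` with `(tilt e (t, z)).2 = x` for which the reflection
  -- moves `x` by `-r e`.
  let Ψ : ℝ × E →ₗ[ℝ] ℝ × E := LinearMap.prod ((5 / 6 : ℝ) • LinearMap.fst ℝ ℝ E)
    (LinearMap.snd ℝ ℝ E + ((1 / 4 : ℝ) • (innerₛₗ ℝ e ∘ₗ LinearMap.snd ℝ ℝ E) -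
      (5 / 8 : ℝ) • LinearMap.fst ℝ ℝ E).smulRight e)
  have hΨ (p : ℝ × E) : Ψ p = (5 / 6 * p.1, p.2 + (1 / 4 * inner ℝ e p.2 - 5 / 8 * p.1) • e) := by
    simp [Ψ]
  have h1 (p : ℝ × E) : (tilt e (Ψ p)).2 = p.2 := by
    simp only [hΨ, tilt_apply, inner_add_right, inner_smul_right, hee]
    module
  have h2 (p : ℝ × E) : (tilt e (flip (Ψ p))).2 = p.2 - p.1 • e := by
    simp only [hΨ, tilt_apply, inner_add_right, inner_smul_right, hee, flip]
    module
  have hinj : Function.Injective Ψ := by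
    intro p q hpq
    have a1 : p.1 = q.1 := by
      have := congrArg Prod.fst hpq
      simp only [hΨ] at this
      linarith
    have a2 : p.2 = q.2 := by rw [← h1 p, ← h1 q, hpq]
    exact Prod.ext a1 a2
  have hdet : LinearMap.det Ψ ≠ 0 := by
    have : Ψ = (LinearEquiv.ofInjectiveEndo Ψ hinj).toLinearMap := by
      ext1 <;> rfl
    rw [this]
    exact (LinearEquiv.isUnit_det' _).ne_zero
  have : (volume : Measure (ℝ × E)).IsAddHaarMeasure :=
    Measure.prod.instIsAddHaarMeasure (volume : Measure ℝ) (volume : Measure E)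
  have q := Measure.LinearMap.quasiMeasurePreserving (volume : Measure (ℝ × E)) Ψ hdet
  have hvol : ∀ᵐ p ∂(volume : Measure (ℝ × E)), p ∉ gain ((fun p => (tilt e p).2) ⁻¹' A) := by
    have ac : (volume : Measure (ℝ × E)) ≪ (N₁).prod (stdGaussian E) :=
      (gaussianReal_absolutelyContinuous' 0 one_ne_zero).prod
        volume_absolutelyContinuous_stdGaussian
    refine ac (?_ : ∀ᵐ p ∂((N₁).prod (stdGaussian E)), _)
    rw [ae_iff]
    simpa using h
  have hq : ∀ᵐ t : ℝ, 0 < t → -(t • e) ∈ translations A := by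
    have := Measure.ae_ae_of_ae_prod (q.ae hvol)
    filter_upwards [this] with t ht ht0
    filter_upwards [ht] with x hx hxA
    by_contra hc
    refine hx ⟨?_, ?_, ?_⟩
    · rw [hΨ]; simpa using ht0
    · simpa only [mem_preimage, h1] using hxA
    · simpa only [mem_preimage, h2, sub_eq_add_neg] using hc
  -- Only almost every length is available, but every length is a sum of two generic ones.
  have hq' : ∀ᵐ t : ℝ, 0 < r - t → -((r - t) • e) ∈ translations A :=
    (Measure.measurePreserving_sub_left (volume : Measure ℝ) r).quasiMeasurePreserving.ae hq
  have hpos : ∃ᵐ t : ℝ, t ∈ Ioo 0 r := by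
    rw [frequently_ae_mem_iff]
    simp [hr]
  obtain ⟨t, ht, a1, a2⟩ := (hpos.and_eventually (hq.and hq')).exists
  have := (translations A).add_mem (a1 ht.1) (a2 (sub_pos.2 ht.2))
  convert this using 1
  module

omit [FiniteDimensional ℝ E] [MeasurableSpace E] [BorelSpace E] in
lemma snd_tilt_neg (e : E) (p : ℝ × E) : (tilt (-e) p).2 = (tilt e (flip p)).2 := by
  simp only [tilt_apply, flip, inner_neg_left]
  module

omit [FiniteDimensional ℝ E] [MeasurableSpace E] [BorelSpace E] in
lemma gain_tilt_neg (A : Set E) (e : E) :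
    gain ((fun p => (tilt (-e) p).2) ⁻¹' A) = gain ((fun p => (tilt e p).2) ⁻¹' A)ᶜ := by
  ext p
  have h := snd_tilt_neg e p
  have h' := snd_tilt_neg e (flip p)
  rw [flip_flip] at h'
  simp only [gain, Set.mem_ofPred_eq, mem_preimage, mem_compl_iff, not_not, h, h']
  tauto

end Tilt

/-! ### Equality in Borell's inequality for sets -/

section EqualityCase

variable {E : Type*} [NormedAddCommGroup E] [InnerProductSpace ℝ E] [FiniteDimensional ℝ E]
  [MeasurableSpace E] [BorelSpace E]

/-- Up to null sets, the tilted cylinder over `A` contains, with each of its points in `{t > 0}`,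
the reflected point. This implies that `A` is stable under the translations by `-r e`, `r > 0`. -/
def Descends (A : Set E) (e : E) : Prop :=
  (N₁).prod (stdGaussian E) (gain ((fun p => (tilt e p).2) ⁻¹' A)) = 0

lemma Descends.inner_nonpos {A : Set E} {e : E} (h : Descends A e) (hA : MeasurableSet A)
    (he : ‖e‖ = 1) : inner ℝ e (∫ x in A, x ∂(stdGaussian E)) ≤ 0 := by
  have := (integral_fst_mul_indicator
    ((measurable_snd.comp (measurable_tilt e)) hA) h).1
  have h2 := integral_fst_mul_indicator_tilt hA he
  simp only [Function.comp_def] at this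
  rw [h2] at this
  linarith

lemma Descends.neg {A : Set E} {e : E} (h : Descends A e) (hA : MeasurableSet A)
    (he : ‖e‖ = 1) (h0 : inner ℝ e (∫ x in A, x ∂(stdGaussian E)) = 0) : Descends A (-e) := by
  have := (integral_fst_mul_indicator
    ((measurable_snd.comp (measurable_tilt e)) hA) h).2
  have h2 := integral_fst_mul_indicator_tilt hA he
  simp only [Function.comp_def] at this
  rw [h2, h0, mul_zero] at this
  rw [Descends, gain_tilt_neg]
  exact this rfl

lemma Descends.mem_translations {A : Set E} {e : E} (h : Descends A e) (he : ‖e‖ = 1)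
    {r : ℝ} (hr : 0 < r) : -(r • e) ∈ translations A :=
  neg_smul_mem_translations he h hr

/-- For a pair of optimizers, in each direction one of the sets is stable. -/
lemma descends_or_descends {ρ : ℝ} (h₀ : 0 < ρ) (h₂ : ρ < 1) {A B : Set E} (hA : MeasurableSet A)
    (hB : MeasurableSet B) (heq : (correlatedPair (stdGaussian E) ρ).real (A ×ˢ B) =
      J ρ ((stdGaussian E).real A) ((stdGaussian E).real B)) {e : E} (he : ‖e‖ = 1) :
    Descends A e ∨ Descends B (-e) := by
  have mt : MeasurePreserving (fun p => (tilt e p).2) ((N₁).prod (stdGaussian E))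
      (stdGaussian E) := measurePreserving_snd.comp (measurePreserving_tilt he)
  have mp := measurePreserving_correlatedPair_map (LinearMap.snd ℝ ℝ E ∘ₗ tilt e) mt ρ
  rw [← mp.measureReal_preimage (hA.prod hB).nullMeasurableSet,
    ← mt.measureReal_preimage hA.nullMeasurableSet,
    ← mt.measureReal_preimage hB.nullMeasurableSet] at heq
  rw [Descends, Descends, gain_tilt_neg]
  exact (gain_null_of_eq h₀ h₂ (mt.measurable hA) (mt.measurable hB) heq).1

/-- If the first moment of `A` vanishes, then the directions of invariance of `A` and those of `B`
cover `E`. -/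
lemma setIntegral_id_ne_zero {A B : Set E} (hA : MeasurableSet A)
    (hA0 : translations A ≠ ⊤) (hB0 : translations B ≠ ⊤)
    (h : ∀ e : E, ‖e‖ = 1 → Descends A e ∨ Descends B (-e)) :
    ∫ x in A, x ∂(stdGaussian E) ≠ 0 := by
  intro h0
  have hn : ∀ e : E, ‖e‖ = 1 → Descends A e → Descends A (-e) := fun e he h =>
    h.neg hA he (by rw [h0, inner_zero_right])
  have key : ∀ v : E, (v ∈ translations A ∧ -v ∈ translations A) ∨
      (v ∈ translations B ∧ -v ∈ translations B) := by
    intro v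
    rcases eq_or_ne v 0 with rfl | hv
    · simp
    have hr : 0 < ‖v‖ := norm_pos_iff.2 hv
    obtain ⟨e, he, hve⟩ : ∃ e : E, ‖e‖ = 1 ∧ ‖v‖ • e = v :=
      ⟨‖v‖⁻¹ • v, norm_smul_inv_norm hv, smul_inv_smul₀ hr.ne' v⟩
    have hne : ‖-e‖ = 1 := by rwa [norm_neg]
    have hboth : ∀ S : Set E, Descends S e → Descends S (-e) →
        v ∈ translations S ∧ -v ∈ translations S := by
      intro S h1 h2
      have m1 := h1.mem_translations he hr
      have m2 := h2.mem_translations hne hr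
      rw [smul_neg, neg_neg, hve] at m2
      rw [hve] at m1
      exact ⟨m2, m1⟩
    by_cases hd : Descends A e
    · exact Or.inl (hboth A hd (hn e he hd))
    · refine Or.inr (hboth B ?_ ((h e he).resolve_left hd))
      have := (h (-e) hne).resolve_left fun hd' => hd (by simpa using hn _ hne hd')
      simpa using this
  -- A vector space is not the union of two proper subgroups.
  obtain ⟨v, hv⟩ : ∃ v, v ∉ translations A := by
    by_contra! hc; exact hA0 (eq_top_iff.2 fun v _ => hc v)
  obtain ⟨w, hw⟩ : ∃ w, w ∉ translations B := by
    by_contra! hc; exact hB0 (eq_top_iff.2 fun v _ => hc v)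
  have hv' := (key v).resolve_left fun h => hv h.1
  have hw' := (key w).resolve_right fun h => hw h.1
  rcases key (v + w) with h | h
  · exact hv (by simpa using add_mem h.1 hw'.2)
  · exact hw (by simpa using add_mem hv'.2 h.1)

lemma mem_translations_of_inner_pos {A B : Set E} (hA : MeasurableSet A) (hB : MeasurableSet B)
    (h : ∀ e : E, ‖e‖ = 1 → Descends A e ∨ Descends B (-e)) {v : E}
    (hv : 0 < inner ℝ v (∫ x in A, x ∂(stdGaussian E))) :
    v ∈ translations B ∧ 0 ≤ inner ℝ v (∫ x in B, x ∂(stdGaussian E)) := by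
  have hv0 : v ≠ 0 := by rintro rfl; simp at hv
  have hr : 0 < ‖v‖ := norm_pos_iff.2 hv0
  obtain ⟨e, he, hve⟩ : ∃ e : E, ‖e‖ = 1 ∧ ‖v‖ • e = v :=
    ⟨‖v‖⁻¹ • v, norm_smul_inv_norm hv0, smul_inv_smul₀ hr.ne' v⟩
  have hne : ‖-e‖ = 1 := by rwa [norm_neg]
  generalize ‖v‖ = r at *
  subst hve
  rw [inner_smul_left] at hv ⊢
  have hd : Descends B (-e) := (h e he).resolve_left fun hd =>
    absurd (hd.inner_nonpos hA he) (not_le.2 (pos_of_mul_pos_right hv hr.le))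
  constructor
  · simpa using hd.mem_translations hne hr
  · have := hd.inner_nonpos hB hne
    rw [inner_neg_left] at this
    exact mul_nonneg hr.le (by linarith)

omit [FiniteDimensional ℝ E] [MeasurableSpace E] [BorelSpace E] in
lemma exists_pos_smul_eq {a b : E} (ha : a ≠ 0) (hb : b ≠ 0)
    (h : ∀ v : E, 0 < inner ℝ v a → 0 ≤ inner ℝ v b) : ∃ r : ℝ, 0 < r ∧ b = r • a := by
  have haa : 0 < inner ℝ a a := real_inner_self_pos.2 ha
  let r : ℝ := inner ℝ a b / inner ℝ a a
  have hra : r * inner ℝ a a = inner ℝ a b := div_mul_cancel₀ _ haa.ne'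
  have hr : 0 ≤ r := div_nonneg (h a haa) haa.le
  let w := b - r • a
  have hwa : inner ℝ w a = 0 := by
    simp only [w, inner_sub_left, inner_smul_left, RCLike.conj_to_real]
    rw [hra, real_inner_comm, sub_self]
  have hwb : inner ℝ w b = inner ℝ w w := by
    have : b = w + r • a := by simp [w]
    rw [this, inner_add_right, inner_smul_right, hwa]
    simp
  have hw : inner ℝ w w ≤ 0 := by
    refine le_of_forall_pos_le_add fun ε hε => ?_
    by_cases hab : inner ℝ a b = 0
    · have := h (a - w) (by rw [inner_sub_left, hwa]; linarith)
      rw [inner_sub_left, hab, hwb] at this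
      linarith
    · have hab' : 0 < inner ℝ a b := lt_of_le_of_ne (h a haa) (Ne.symm hab)
      have := h ((ε / inner ℝ a b) • a - w) (by
        rw [inner_sub_left, hwa, inner_smul_left, RCLike.conj_to_real]; simp; positivity)
      rw [inner_sub_left, hwb, inner_smul_left, RCLike.conj_to_real, div_mul_cancel₀ _ hab] at this
      linarith
  have hw0 : w = 0 := real_inner_self_nonpos.1 hw
  have hb' : b = r • a := sub_eq_zero.1 hw0
  refine ⟨r, lt_of_le_of_ne hr fun h0 => hb ?_, hb'⟩
  rw [hb', ← h0, zero_smul]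

/-- Parallel half-spaces are the only optimizers in Borell's inequality for `0 < ρ < 1`. -/
theorem exists_halfspaces_of_eq {ρ : ℝ} (h₀ : 0 < ρ) (h₂ : ρ < 1) {A B : Set E}
    (hA : MeasurableSet A) (hB : MeasurableSet B)
    (hA0 : stdGaussian E A ≠ 0) (hA1 : stdGaussian E A ≠ 1)
    (hB0 : stdGaussian E B ≠ 0) (hB1 : stdGaussian E B ≠ 1)
    (heq : (correlatedPair (stdGaussian E) ρ).real (A ×ˢ B) =
      J ρ ((stdGaussian E).real A) ((stdGaussian E).real B)) :
    ∃ u : E, ‖u‖ = 1 ∧ ∃ c d : ℝ, A =ᵐ[stdGaussian E] {x | c ≤ inner ℝ u x} ∧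
      B =ᵐ[stdGaussian E] {x | d ≤ inner ℝ u x} := by
  have tA : translations A ≠ ⊤ := fun h => (measure_of_translations_eq_top hA h).elim hA0 hA1
  have tB : translations B ≠ ⊤ := fun h => (measure_of_translations_eq_top hB h).elim hB0 hB1
  have hd : ∀ e : E, ‖e‖ = 1 → Descends A e ∨ Descends B (-e) := fun e he =>
    descends_or_descends h₀ h₂ hA hB heq he
  have hd' : ∀ e : E, ‖e‖ = 1 → Descends B e ∨ Descends A (-e) := fun e he => by
    simpa [or_comm] using hd (-e) (by rwa [norm_neg])
  have ha := setIntegral_id_ne_zero hA tA tB hd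
  have hb := setIntegral_id_ne_zero hB tB tA hd'
  have hAB := fun v => mem_translations_of_inner_pos hA hB hd (v := v)
  have hBA := fun v => mem_translations_of_inner_pos hB hA hd' (v := v)
  generalize ∫ x in A, x ∂(stdGaussian E) = a at *
  generalize ∫ x in B, x ∂(stdGaussian E) = b at *
  obtain ⟨r, hr, rfl⟩ := exists_pos_smul_eq ha hb fun v hv => (hAB v hv).2
  have hu : ∀ v, 0 < inner ℝ (‖a‖⁻¹ • a) v → 0 < inner ℝ v a := by
    intro v hv
    rw [inner_smul_left, RCLike.conj_to_real, real_inner_comm] at hv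
    exact pos_of_mul_pos_right hv (by positivity)
  obtain ⟨c, hc⟩ := exists_ae_eq_halfspace hA (norm_smul_inv_norm ha) hA0 hA1 fun v hv =>
    (hBA v (by rw [inner_smul_right]; exact mul_pos hr (hu v hv))).1
  obtain ⟨d, hd⟩ := exists_ae_eq_halfspace hB (norm_smul_inv_norm ha) hB0 hB1 fun v hv =>
    (hAB v (hu v hv)).1
  exact ⟨_, norm_smul_inv_norm ha, c, d, hc, hd⟩

end EqualityCase

/-! ### Subgraphs and the functional equality case -/

section Subgraph

variable {E : Type*} [NormedAddCommGroup E] [InnerProductSpace ℝ E] [FiniteDimensional ℝ E]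
  [MeasurableSpace E] [BorelSpace E]

/-- The region below the graph of `Φ⁻¹ ∘ f`; its Gaussian measure is the mean of `f`. -/
def subgraph (f : E → ℝ) : Set (E × ℝ) := {p | p.2 ∈ lowerRay (f p.1)}

omit [NormedAddCommGroup E] [InnerProductSpace ℝ E] [FiniteDimensional ℝ E] [BorelSpace E] in
lemma measurableSet_subgraph {f : E → ℝ} (hf : Measurable f) : MeasurableSet (subgraph f) :=
  measurableSet_le (measurable_coe_real_ereal.comp measurable_snd)
    (measurable_PhiInv.comp (hf.comp measurable_fst))

lemma real_subgraph {f : E → ℝ} (hf : Measurable f) (hf' : ∀ x, f x ∈ Icc (0 : ℝ) 1) :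
    ((stdGaussian E).prod N₁).real (subgraph f) = ∫ x, f x ∂(stdGaussian E) := by
  rw [measureReal_prod_eq_integral _ _ (measurableSet_subgraph hf)]
  have e (x : E) : Prod.mk x ⁻¹' subgraph f = lowerRay (f x) := rfl
  simp_rw [e, real_lowerRay (hf' _)]

lemma real_subgraph_prod (ρ : ℝ) {f g : E → ℝ} (hf : Measurable f) (hg : Measurable g) :
    (correlatedPair ((stdGaussian E).prod N₁) ρ).real (subgraph f ×ˢ subgraph g) =
      ∫ z, J ρ (f z.1) (g z.2) ∂(correlatedPair (stdGaussian E) ρ) := by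
  have mp := measurePreserving_correlatedPair_prod (stdGaussian E) N₁ ρ
  have hm := (measurableSet_subgraph hf).prod (measurableSet_subgraph hg)
  rw [← mp.measureReal_preimage hm.nullMeasurableSet,
    measureReal_prod_eq_integral _ _ (mp.measurable hm)]
  rfl

/-- A set on the line which is a ray towards `-∞` cannot be a ray towards `+∞`. -/
lemma not_ae_lowerRay_iff_le {p t : ℝ} : ¬ ∀ᵐ s ∂N₁, s ∈ lowerRay p ↔ t ≤ s := by
  intro h
  have h' : ∀ᵐ s : ℝ, s ∈ lowerRay p ↔ t ≤ s :=
    (gaussianReal_absolutelyContinuous' 0 one_ne_zero) h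
  have h1 : ∃ᵐ s : ℝ, s ∈ Ioi t := by rw [frequently_ae_mem_iff]; simp
  have h2 : ∃ᵐ s : ℝ, s ∈ Iio t := by rw [frequently_ae_mem_iff]; simp
  obtain ⟨s, hs, hs'⟩ := (h1.and_eventually h').exists
  obtain ⟨r, hr, hr'⟩ := (h2.and_eventually h').exists
  rw [mem_Ioi] at hs
  rw [mem_Iio] at hr
  have hsm : (s : EReal) ≤ PhiInv p := hs'.2 hs.le
  have : r ∈ lowerRay p := (EReal.coe_le_coe_iff.2 (hr.trans hs).le).trans hsm
  exact absurd (hr'.1 this) (not_le.2 hr)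

lemma ae_eq_of_subgraph_iff {f : E → ℝ} (hf' : ∀ x, f x ∈ Icc (0 : ℝ) 1) {a : E} {r c : ℝ}
    (h : ∀ᵐ p ∂((stdGaussian E).prod N₁), p ∈ subgraph f ↔ c ≤ inner ℝ a p.1 + r * p.2) :
    (r = 0 → ∀ᵐ x ∂(stdGaussian E),
      f x = {x | c ≤ inner ℝ a x}.indicator (fun _ => (1 : ℝ)) x) ∧
    (r ≠ 0 → r < 0 ∧ ∀ᵐ x ∂(stdGaussian E),
      f x = Phi (inner ℝ ((-r)⁻¹ • a) x - (-r)⁻¹ * c)) := by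
  classical
  have hx := Measure.ae_ae_of_ae_prod h
  have key : ∀ x, ∀ S : Set ℝ, (∀ᵐ s ∂N₁, s ∈ lowerRay (f x) ↔ s ∈ S) → f x = (N₁).real S := by
    intro x S hS
    rw [← real_lowerRay (hf' x)]
    exact measureReal_congr (hS.mono fun s hs => propext hs)
  constructor
  · rintro rfl
    filter_upwards [hx] with x hx
    by_cases hc : c ≤ inner ℝ a x
    · rw [indicator_of_mem (by exact hc), key x univ (hx.mono fun s hs => ?_)]
      · simp
      · refine hs.trans ?_
        simp [hc]
    · rw [indicator_of_notMem (by exact hc), key x ∅ (hx.mono fun s hs => ?_)]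
      · simp
      · refine hs.trans ?_
        simpa using hc
  · intro hr
    rcases hr.lt_or_gt with hr | hr
    · refine ⟨hr, ?_⟩
      filter_upwards [hx] with x hx
      refine key x (Iic _) (hx.mono fun s hs => hs.trans ?_)
      have hr' : 0 < -r := by linarith
      rw [mem_Iic, inner_smul_left, RCLike.conj_to_real, ← mul_sub, ← div_eq_inv_mul,
        le_div_iff₀ hr']
      constructor <;> intro h <;> linarith
    · obtain ⟨x, hx⟩ := hx.exists
      refine absurd (hx.mono fun s hs => hs.trans ?_)
        (not_ae_lowerRay_iff_le (p := f x) (t := (c - inner ℝ a x) / r))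
      rw [div_le_iff₀ hr]
      constructor <;> intro h <;> linarith

/-- Equality in the functional Borell inequality for `0 < ρ < 1`. -/
theorem functional_equality_of_pos {ρ : ℝ} (h₀ : 0 < ρ) (h₂ : ρ < 1) {f g : E → ℝ}
    (hf : Measurable f) (hg : Measurable g) (hf' : ∀ x, f x ∈ Icc (0 : ℝ) 1)
    (hg' : ∀ x, g x ∈ Icc (0 : ℝ) 1)
    (hf0 : ¬ ∀ᵐ x ∂(stdGaussian E), f x = 0) (hf1 : ¬ ∀ᵐ x ∂(stdGaussian E), f x = 1)
    (hg0 : ¬ ∀ᵐ x ∂(stdGaussian E), g x = 0) (hg1 : ¬ ∀ᵐ x ∂(stdGaussian E), g x = 1)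
    (heq : ∫ z, J ρ (f z.1) (g z.2) ∂(correlatedPair (stdGaussian E) ρ) =
      J ρ (∫ x, f x ∂(stdGaussian E)) (∫ x, g x ∂(stdGaussian E))) :
    (∃ p q : ℝ, (∀ᵐ x ∂(stdGaussian E), f x = p) ∧ (∀ᵐ x ∂(stdGaussian E), g x = q)) ∨
    (∃ a : E, a ≠ 0 ∧ ∃ c d : ℝ,
      ((∀ᵐ x ∂(stdGaussian E), f x = Phi (inner ℝ a x - c)) ∧
        (∀ᵐ x ∂(stdGaussian E), g x = Phi (inner ℝ a x - d))) ∨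
      ((∀ᵐ x ∂(stdGaussian E), f x = {x | c ≤ inner ℝ a x}.indicator (fun _ => (1 : ℝ)) x) ∧
        (∀ᵐ x ∂(stdGaussian E), g x = {x | d ≤ inner ℝ a x}.indicator (fun _ => (1 : ℝ)) x))) := by
  have mp := measurePreserving_ofLp_stdGaussian (E := E) ℝ
  rw [stdGaussian_real] at mp
  have mpc := measurePreserving_correlatedPair_map
    (WithLp.linearEquiv 2 ℝ (E × ℝ)).toLinearMap mp ρ
  have hfm := measurableSet_subgraph hf
  have hgm := measurableSet_subgraph hg
  have nontriv : ∀ {k : E → ℝ}, Measurable k → (∀ x, k x ∈ Icc (0 : ℝ) 1) →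
      (¬ ∀ᵐ x ∂(stdGaussian E), k x = 0) → (¬ ∀ᵐ x ∂(stdGaussian E), k x = 1) →
      stdGaussian (WithLp 2 (E × ℝ)) (WithLp.ofLp ⁻¹' subgraph k) ≠ 0 ∧
      stdGaussian (WithLp 2 (E × ℝ)) (WithLp.ofLp ⁻¹' subgraph k) ≠ 1 := by
    intro k hk hk' h0 h1
    have i : Integrable k (stdGaussian E) := integrable_of_mem_Icc hk hk'
    rw [mp.measure_preimage (measurableSet_subgraph hk).nullMeasurableSet]
    constructor
    · intro h
      refine h0 ?_
      have hm := real_subgraph hk hk'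
      rw [measureReal_def, h, ENNReal.toReal_zero] at hm
      exact (integral_eq_zero_iff_of_nonneg (fun x => (hk' x).1) i).1 hm.symm
    · intro h
      refine h1 ?_
      have hm := real_subgraph hk hk'
      rw [measureReal_def, h, ENNReal.toReal_one] at hm
      have : ∫ x, (1 - k x) ∂(stdGaussian E) = 0 := by
        rw [integral_sub (integrable_const _) i, ← hm]; simp
      filter_upwards [(integral_eq_zero_iff_of_nonneg (fun x => sub_nonneg.2 (hk' x).2)
        ((integrable_const _).sub i)).1 this] with x hx
      exact (sub_eq_zero.1 hx).symm
  rw [← real_subgraph_prod ρ hf hg, ← real_subgraph hf hf', ← real_subgraph hg hg',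
    ← mpc.measureReal_preimage (hfm.prod hgm).nullMeasurableSet,
    ← mp.measureReal_preimage hfm.nullMeasurableSet,
    ← mp.measureReal_preimage hgm.nullMeasurableSet] at heq
  obtain ⟨u, hu, c, d, hc, hd⟩ := exists_halfspaces_of_eq h₀ h₂ (mp.measurable hfm)
    (mp.measurable hgm) (nontriv hf hf' hf0 hf1).1 (nontriv hf hf' hf0 hf1).2
    (nontriv hg hg' hg0 hg1).1 (nontriv hg hg' hg0 hg1).2 heq
  have transfer : ∀ {k : E → ℝ} {c : ℝ}, Measurable k →
      (WithLp.ofLp ⁻¹' subgraph k : Set (WithLp 2 (E × ℝ)))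
        =ᵐ[stdGaussian (WithLp 2 (E × ℝ))] {x | c ≤ inner ℝ u x} →
      ∀ᵐ p ∂((stdGaussian E).prod N₁), p ∈ subgraph k ↔ c ≤ inner ℝ u.fst p.1 + u.snd * p.2 := by
    intro k c hk h
    rw [← mp.map_eq, ae_map_iff mp.measurable.aemeasurable]
    · filter_upwards [h.mem_iff] with x hx
      refine hx.trans ?_
      rw [WithLp.prod_inner_apply]
      simp [mul_comm]
    · exact (measurableSet_subgraph hk).iff (measurableSet_le measurable_const (by fun_prop))
  have hF := ae_eq_of_subgraph_iff hf' (transfer hf hc)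
  have hG := ae_eq_of_subgraph_iff hg' (transfer hg hd)
  by_cases hr : u.snd = 0
  · have ha : u.fst ≠ 0 := by
      intro ha
      have := WithLp.prod_norm_sq_eq_of_L2 u
      rw [hu, ha, hr] at this
      simp at this
    exact Or.inr ⟨u.fst, ha, c, d, Or.inr ⟨hF.1 hr, hG.1 hr⟩⟩
  · have hr' := (hF.2 hr).1
    by_cases ha : u.fst = 0
    · left
      have h1 := (hF.2 hr).2
      have h2 := (hG.2 hr).2
      simp only [ha, smul_zero, inner_zero_left] at h1 h2
      exact ⟨_, _, h1, h2⟩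
    · refine Or.inr ⟨(-u.snd)⁻¹ • u.fst, ?_, _, _, Or.inl ⟨(hF.2 hr).2, (hG.2 hr).2⟩⟩
      exact smul_ne_zero (inv_ne_zero (neg_ne_zero.2 hr)) ha

end Subgraph

/-! ### Negative correlation -/

section Reflection

lemma measurePreserving_correlatedPair_neg_right {E : Type*} [NormedAddCommGroup E]
    [NormedSpace ℝ E] [MeasurableSpace E] [BorelSpace E] [SecondCountableTopology E]
    [CompleteSpace E] {γ : Measure E} [IsGaussian γ] (hγ : γ[id] = 0) (ρ : ℝ) :
    MeasurePreserving (fun z => (z.1, -z.2)) (correlatedPair γ ρ) (correlatedPair γ (-ρ)) := by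
  have h1 := measurePreserving_correlate γ ρ
  have h2 := (measurePreserving_correlate γ (-ρ)).comp
    ((MeasurePreserving.id γ).prod (measurePreserving_neg_gaussian hγ))
  refine ⟨by fun_prop, ?_⟩
  rw [← h1.map_eq, Measure.map_map (by fun_prop) h1.measurable, ← h2.map_eq]
  congr 1
  ext p
  · simp
  · simp; abel

lemma J_eq_sub_J_neg {ρ : ℝ} (h₁ : -1 < ρ) (h₂ : ρ < 1) {x y : ℝ} (hx : x ∈ Icc (0 : ℝ) 1)
    (hy : y ∈ Icc (0 : ℝ) 1) : J ρ x y = x - J (-ρ) x (1 - y) := by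
  have mp := measurePreserving_correlatedPair_neg_right integral_id_stdNormal ρ
  have m1 := measurePreserving_correlatedPair_fst N₁ ρ
  have m2 := measurePreserving_correlatedPair_snd integral_id_stdNormal h₁.le h₂.le
  have hX := measurableSet_lowerRay x
  have hY := measurableSet_lowerRay y
  have e1 : (correlatedPair N₁ ρ).real (Prod.fst ⁻¹' lowerRay x) = x := by
    rw [m1.measureReal_preimage hX.nullMeasurableSet, real_lowerRay hx]
  have e2 := measureReal_inter_add_sdiff (μ := correlatedPair N₁ ρ)
    (s := Prod.fst ⁻¹' lowerRay x) (measurable_snd hY)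
  rw [e1] at e2
  have e3 : (correlatedPair N₁ ρ).real (Prod.fst ⁻¹' lowerRay x \ Prod.snd ⁻¹' lowerRay y) =
      J (-ρ) x (1 - y) := by
    rw [J_eq, ← mp.measureReal_preimage
      (hX.prod (measurableSet_lowerRay (1 - y))).nullMeasurableSet]
    refine measureReal_congr ?_
    -- the two sets differ only where the second coordinate equals the quantile `Φ⁻¹ y`
    have hnull : ∀ᵐ t ∂N₁, ((t : ℝ) : EReal) ≠ PhiInv y := by
      have : ∀ᵐ t ∂N₁, t ≠ (PhiInv y).toReal := by
        rw [ae_iff]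
        simp
      filter_upwards [this] with t ht h
      exact ht (by rw [← h, EReal.toReal_coe])
    filter_upwards [m2.quasiMeasurePreserving.ae hnull] with z hz
    refine propext (and_congr_right fun _ => ?_)
    change ¬ ((z.2 : EReal) ≤ PhiInv y) ↔ ((-z.2 : ℝ) : EReal) ≤ PhiInv (1 - y)
    rw [PhiInv_one_sub hy, EReal.coe_neg, EReal.neg_le_neg_iff, not_le]
    exact ⟨le_of_lt, fun h => lt_of_le_of_ne h hz.symm⟩
  rw [J_eq, ← e3, eq_sub_iff_add_eq]
  exact e2

end Reflection

/-! ### All nonzero correlations -/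

section AllCorrelations

variable {E : Type*} [NormedAddCommGroup E] [InnerProductSpace ℝ E] [FiniteDimensional ℝ E]
  [MeasurableSpace E] [BorelSpace E]

lemma ae_inner_ne {a : E} (ha : a ≠ 0) (c : ℝ) : ∀ᵐ x ∂(stdGaussian E), inner ℝ a x ≠ c := by
  have h : ∀ᵐ t ∂N₁, t ≠ ‖a‖⁻¹ * c := by
    rw [ae_iff]; simp
  filter_upwards [(map_inner_stdGaussian
    (norm_smul_inv_norm (𝕜 := ℝ) ha)).quasiMeasurePreserving.ae h]
    with x hx hc
  rw [← hc] at hx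
  refine hx ?_
  rw [inner_smul_left]
  rfl

lemma one_sub_Phi_neg (t : ℝ) : 1 - Phi (-t) = Phi t := by
  have h := (measurePreserving_neg_gaussian integral_id_stdNormal).measureReal_preimage
    (measurableSet_Iic (a := -t)).nullMeasurableSet
  have e : (fun x : ℝ => -x) ⁻¹' Iic (-t) = Ici t := by ext; simp
  rw [e] at h
  rw [Phi, ← h, ← probReal_compl_eq_one_sub measurableSet_Ici, compl_Ici,
    measureReal_congr Iio_ae_eq_Iic, Phi]

/-- The equality case of the functional Borell inequality for every nonzero correlation; a
negative correlation is reduced to a positive one by replacing `g` with `y ↦ 1 - g (-y)`. -/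
theorem functional_equality {ρ : ℝ} (h₁ : -1 < ρ) (h₂ : ρ < 1) (h₀ : ρ ≠ 0) {f g : E → ℝ}
    (hf : Measurable f) (hg : Measurable g) (hf' : ∀ x, f x ∈ Icc (0 : ℝ) 1)
    (hg' : ∀ x, g x ∈ Icc (0 : ℝ) 1)
    (hf0 : ¬ ∀ᵐ x ∂(stdGaussian E), f x = 0) (hf1 : ¬ ∀ᵐ x ∂(stdGaussian E), f x = 1)
    (hg0 : ¬ ∀ᵐ x ∂(stdGaussian E), g x = 0) (hg1 : ¬ ∀ᵐ x ∂(stdGaussian E), g x = 1)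
    (heq : ∫ z, J ρ (f z.1) (g z.2) ∂(correlatedPair (stdGaussian E) ρ) =
      J ρ (∫ x, f x ∂(stdGaussian E)) (∫ x, g x ∂(stdGaussian E))) :
    (∃ p q : ℝ, (∀ᵐ x ∂(stdGaussian E), f x = p) ∧ (∀ᵐ x ∂(stdGaussian E), g x = q)) ∨
    (∃ a : E, a ≠ 0 ∧ ∃ c d : ℝ,
      ((∀ᵐ x ∂(stdGaussian E), f x = Phi (inner ℝ a x - c)) ∧
        (∀ᵐ x ∂(stdGaussian E), g x = Phi (inner ℝ a x - d))) ∨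
      ((∀ᵐ x ∂(stdGaussian E), f x = {x | c ≤ inner ℝ a x}.indicator (fun _ => (1 : ℝ)) x) ∧
        (∀ᵐ x ∂(stdGaussian E), g x = {x | d ≤ inner ℝ a x}.indicator (fun _ => (1 : ℝ)) x))) := by
  classical
  rcases h₀.lt_or_gt with hρ | hρ
  swap
  · exact functional_equality_of_pos hρ h₂ hf hg hf' hg' hf0 hf1 hg0 hg1 heq
  have mneg := measurePreserving_neg_gaussian (integral_id_stdGaussian (E := E))
  have back : ∀ {p : E → Prop}, (∀ᵐ x ∂(stdGaussian E), p x) → ∀ᵐ x ∂(stdGaussian E), p (-x) :=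
    fun h => mneg.quasiMeasurePreserving.ae h
  let h : E → ℝ := fun y => 1 - g (-y)
  have hgh (y : E) : g y = 1 - h (-y) := by simp [h]
  have hh : Measurable h := measurable_const.sub (hg.comp measurable_neg)
  have hh' : ∀ x, h x ∈ Icc (0 : ℝ) 1 := fun x => by
    have := hg' (-x)
    exact ⟨sub_nonneg.2 this.2, sub_le_self _ this.1⟩
  have hh0 : ¬ ∀ᵐ x ∂(stdGaussian E), h x = 0 := fun hc => hg1 <| by
    filter_upwards [back hc] with x hx
    rw [hgh, hx, sub_zero]
  have hh1 : ¬ ∀ᵐ x ∂(stdGaussian E), h x = 1 := fun hc => hg0 <| by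
    filter_upwards [back hc] with x hx
    rw [hgh, hx, sub_self]
  have ig := integrable_of_mem_Icc (μ := stdGaussian E) hg hg'
  have ih := integrable_of_mem_Icc (μ := stdGaussian E) hh hh'
  have hint : ∫ x, g x ∂(stdGaussian E) = 1 - ∫ x, h x ∂(stdGaussian E) := by
    have e : ∫ x, h (-x) ∂(stdGaussian E) = ∫ x, h x ∂(stdGaussian E) :=
      integral_comp_measurePreserving mneg ih.aestronglyMeasurable
    simp_rw [hgh]
    have ih' : Integrable (fun x => h (-x)) (stdGaussian E) :=
      mneg.integrable_comp_of_integrable ih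
    rw [integral_sub (integrable_const _) ih', e]
    simp
  have heq' : ∫ z, J (-ρ) (f z.1) (h z.2) ∂(correlatedPair (stdGaussian E) (-ρ)) =
      J (-ρ) (∫ x, f x ∂(stdGaussian E)) (∫ x, h x ∂(stdGaussian E)) := by
    rw [J_eq_sub_J_neg h₁ h₂ (integral_mem_Icc hf hf') (integral_mem_Icc hg hg'), hint,
      sub_sub_cancel] at heq
    have mf := measurePreserving_correlatedPair_fst (stdGaussian E) ρ
    have mp := measurePreserving_correlatedPair_neg_right (integral_id_stdGaussian (E := E)) ρ
    have iJ := integrable_J_comp (μ := correlatedPair (stdGaussian E) (-ρ)) (-ρ)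
      (hf.comp measurable_fst) (hh.comp measurable_snd)
    have i1 := integrable_of_mem_Icc (μ := stdGaussian E) hf hf'
    have e1 : ∀ z : E × E, J ρ (f z.1) (g z.2) = f z.1 - J (-ρ) (f z.1) (h (-z.2)) := fun z => by
      rw [J_eq_sub_J_neg h₁ h₂ (hf' _) (hg' _)]
      simp [h]
    have e2 : ∫ z, f z.1 ∂(correlatedPair (stdGaussian E) ρ) = ∫ x, f x ∂(stdGaussian E) :=
      integral_comp_measurePreserving mf i1.aestronglyMeasurable
    have e3 : ∫ z, J (-ρ) (f z.1) (h (-z.2)) ∂(correlatedPair (stdGaussian E) ρ) =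
        ∫ z, J (-ρ) (f z.1) (h z.2) ∂(correlatedPair (stdGaussian E) (-ρ)) :=
      integral_comp_measurePreserving mp iJ.aestronglyMeasurable
    have i2 : Integrable (fun z : E × E => f z.1) (correlatedPair (stdGaussian E) ρ) :=
      mf.integrable_comp_of_integrable i1
    have i3 : Integrable (fun z : E × E => J (-ρ) (f z.1) (h (-z.2)))
        (correlatedPair (stdGaussian E) ρ) := mp.integrable_comp_of_integrable iJ
    simp_rw [e1] at heq
    rw [integral_sub i2 i3, e2, e3] at heq
    linarith
  rcases functional_equality_of_pos (neg_pos.2 hρ) (by linarith) hf hh hf' hh' hf0 hf1 hh0 hh1 heq'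
    with ⟨p, q, hp, hq⟩ | ⟨a, ha, c, d, ⟨hc, hd⟩ | ⟨hc, hd⟩⟩
  · refine Or.inl ⟨p, 1 - q, hp, ?_⟩
    filter_upwards [back hq] with x hx
    rw [hgh, hx]
  · refine Or.inr ⟨a, ha, c, -d, Or.inl ⟨hc, ?_⟩⟩
    filter_upwards [back hd] with x hx
    rw [hgh, hx, inner_neg_right, ← one_sub_Phi_neg (inner ℝ a x - -d)]
    congr 2
    ring
  · refine Or.inr ⟨a, ha, c, -d, Or.inr ⟨hc, ?_⟩⟩
    filter_upwards [back hd, ae_inner_ne ha (-d)] with x hx hne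
    rw [hgh, hx]
    simp only [indicator_apply, Set.mem_ofPred_eq, inner_neg_right]
    rcases hne.lt_or_gt with hlt | hlt
    · rw [if_pos (by linarith), if_neg (by linarith)]; simp
    · rw [if_neg (by linarith), if_pos (by linarith)]; simp

/-- Half-spaces orthogonal to a common direction attain Borell's bound. -/
lemma correlatedPair_real_preimage_lowerRay (ρ : ℝ) {u : E} (hu : ‖u‖ = 1) (p q : ℝ) :
    (correlatedPair (stdGaussian E) ρ).real
      ({x | inner ℝ u x ∈ lowerRay p} ×ˢ {x | inner ℝ u x ∈ lowerRay q}) = J ρ p q := by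
  have mp := measurePreserving_correlatedPair_map (innerₛₗ ℝ u) (map_inner_stdGaussian hu) ρ
  exact mp.measureReal_preimage
    ((measurableSet_lowerRay p).prod (measurableSet_lowerRay q)).nullMeasurableSet

lemma setOf_inner_le_eq_lowerRay {u : E} (hu : ‖u‖ = 1) {A : Set E} {t : ℝ}
    (h : A =ᵐ[stdGaussian E] {x | inner ℝ u x ≤ t}) :
    A =ᵐ[stdGaussian E] {x | inner ℝ u x ∈ lowerRay ((stdGaussian E).real A)} := by
  have e : (stdGaussian E).real A = Phi t := by
    rw [measureReal_congr h]
    exact (map_inner_stdGaussian hu).measureReal_preimage measurableSet_Iic.nullMeasurableSet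
  have e' : lowerRay (Phi t) = Iic t := by
    ext s; simp [lowerRay, PhiInv_Phi]
  rw [e, e']
  exact h

lemma correlatedPair_real_congr {ρ : ℝ} (h₁ : -1 < ρ) (h₂ : ρ < 1) {A A' B B' : Set E}
    (hA : A =ᵐ[stdGaussian E] A') (hB : B =ᵐ[stdGaussian E] B') :
    (correlatedPair (stdGaussian E) ρ).real (A ×ˢ B) =
      (correlatedPair (stdGaussian E) ρ).real (A' ×ˢ B') := by
  have m1 := measurePreserving_correlatedPair_fst (stdGaussian E) ρ
  have m2 := measurePreserving_correlatedPair_snd (integral_id_stdGaussian (E := E)) h₁.le h₂.le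
  refine measureReal_congr ?_
  filter_upwards [m1.quasiMeasurePreserving.ae hA.mem_iff,
    m2.quasiMeasurePreserving.ae hB.mem_iff] with z h h'
  exact propext (and_congr h h')

lemma real_eq_J_of_ae_eq_halfspaces {ρ : ℝ} (h₁ : -1 < ρ) (h₂ : ρ < 1) {A B : Set E} {a : E}
    (ha : a ≠ 0) {c d : ℝ} (hA : A =ᵐ[stdGaussian E] {x | c ≤ inner ℝ a x})
    (hB : B =ᵐ[stdGaussian E] {x | d ≤ inner ℝ a x}) :
    (correlatedPair (stdGaussian E) ρ).real (A ×ˢ B) =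
      J ρ ((stdGaussian E).real A) ((stdGaussian E).real B) := by
  have hu : ‖-(‖a‖⁻¹ • a)‖ = 1 := by rw [norm_neg]; exact norm_smul_inv_norm ha
  have hn : 0 < ‖a‖⁻¹ := inv_pos.2 (norm_pos_iff.2 ha)
  have e (c : ℝ) : {x : E | c ≤ inner ℝ a x} =
      {x | inner ℝ (-(‖a‖⁻¹ • a)) x ≤ -(‖a‖⁻¹ * c)} := by
    ext x
    simp only [Set.mem_ofPred_eq, inner_neg_left, inner_smul_left, RCLike.conj_to_real,
      neg_le_neg_iff]
    exact (mul_le_mul_iff_right₀ hn).symm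
  rw [e] at hA hB
  rw [correlatedPair_real_congr h₁ h₂ (setOf_inner_le_eq_lowerRay hu hA)
    (setOf_inner_le_eq_lowerRay hu hB), correlatedPair_real_preimage_lowerRay ρ hu]

/-- The equality case of Borell's inequality for every nonzero correlation. -/
theorem ae_eq_halfspaces_of_real_eq_J {ρ : ℝ} (h₁ : -1 < ρ) (h₂ : ρ < 1) (h₀ : ρ ≠ 0)
    {A B : Set E} (hA : MeasurableSet A) (hB : MeasurableSet B)
    (hA0 : stdGaussian E A ≠ 0) (hA1 : stdGaussian E A ≠ 1)
    (hB0 : stdGaussian E B ≠ 0) (hB1 : stdGaussian E B ≠ 1)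
    (heq : (correlatedPair (stdGaussian E) ρ).real (A ×ˢ B) =
      J ρ ((stdGaussian E).real A) ((stdGaussian E).real B)) :
    ∃ a : E, a ≠ 0 ∧ ∃ c d : ℝ, A =ᵐ[stdGaussian E] {x | c ≤ inner ℝ a x} ∧
      B =ᵐ[stdGaussian E] {x | d ≤ inner ℝ a x} := by
  classical
  have n0 : ∀ {S : Set E}, stdGaussian E S ≠ 0 →
      ¬ ∀ᵐ x ∂(stdGaussian E), S.indicator (fun _ => (1 : ℝ)) x = 0 := by
    intro S hS h
    refine hS (measure_mono_null (fun x hx => ?_) h)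
    simp [hx]
  have n1 : ∀ {S : Set E}, MeasurableSet S → stdGaussian E S ≠ 1 →
      ¬ ∀ᵐ x ∂(stdGaussian E), S.indicator (fun _ => (1 : ℝ)) x = 1 := by
    intro S hSm hS h
    refine hS ((prob_compl_eq_zero_iff hSm).1 (measure_mono_null (fun x hx => ?_) h))
    have hx' : x ∉ S := hx
    simp [hx']
  have hI : ∀ {S : Set E}, MeasurableSet S →
      ∫ x, S.indicator (fun _ => (1 : ℝ)) x ∂(stdGaussian E) = (stdGaussian E).real S := by
    intro S hS
    rw [integral_indicator_const _ hS]; simp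
  have hset : ∀ {S T : Set E}, (∀ᵐ x ∂(stdGaussian E), S.indicator (fun _ => (1 : ℝ)) x =
      T.indicator (fun _ => (1 : ℝ)) x) → S =ᵐ[stdGaussian E] T := by
    intro S T h
    filter_upwards [h] with x hx
    refine propext ?_
    change x ∈ S ↔ x ∈ T
    by_cases h1 : x ∈ S <;> by_cases h2 : x ∈ T <;> simp_all
  rw [← integral_J_indicator _ ρ hA hB, ← hI hA, ← hI hB] at heq
  rcases functional_equality h₁ h₂ h₀ (measurable_const.indicator hA)
    (measurable_const.indicator hB) (indicator_mem_Icc A) (indicator_mem_Icc B) (n0 hA0)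
    (n1 hA hA1) (n0 hB0) (n1 hB hB1) heq
    with ⟨p, q, hp, -⟩ | ⟨a, ha, c, d, ⟨hc, -⟩ | ⟨hc, hd⟩⟩
  · obtain ⟨x, hx⟩ := hp.exists
    by_cases hxA : x ∈ A
    · rw [indicator_of_mem hxA] at hx
      exact absurd (hx ▸ hp) (n1 hA hA1)
    · rw [indicator_of_notMem hxA] at hx
      exact absurd (hx ▸ hp) (n0 hA0)
  · obtain ⟨x, hx⟩ := hc.exists
    have hP := Phi_mem (inner ℝ a x - c)
    rw [← hx] at hP
    by_cases hxA : x ∈ A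
    · simp [hxA] at hP
    · simp [hxA] at hP
  · exact ⟨a, ha, c, d, hset hc, hset hd⟩

omit [FiniteDimensional ℝ E] [MeasurableSpace E] [BorelSpace E] in
lemma inner_smul_normSq {a : E} (ha : a ≠ 0) (c : ℝ) : inner ℝ a ((c / ‖a‖ ^ 2) • a) = c := by
  rw [inner_smul_right, real_inner_self_eq_norm_sq]
  exact div_mul_cancel₀ _ (by simpa using ha)

end AllCorrelations

section Euclidean

lemma halfSpace_eq {n : ℕ} (a b : EuclideanSpace ℝ (Fin n)) :
    halfSpace a b = {x | inner ℝ a b ≤ inner ℝ a x} := by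
  ext x
  simp [halfSpace, inner_sub_right]

lemma correlatedGaussian_borellHalfSpace {n : ℕ} (hn : 0 < n) (ρ : ℝ)
    (A B : Set (EuclideanSpace ℝ (Fin n))) :
    (correlatedGaussian n ρ).real (borellHalfSpace hn A ×ˢ borellHalfSpace hn B) =
      J ρ ((gammaN n).real A) ((gammaN n).real B) := by
  have hu : ‖EuclideanSpace.single (⟨0, hn⟩ : Fin n) (1 : ℝ)‖ = 1 := by simp
  rw [← correlatedPair_real_preimage_lowerRay ρ hu]
  simp only [EuclideanSpace.inner_single_left, map_one, one_mul]
  rfl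

end Euclidean

end GaussianStability

end

theorem theorem3 (n : ℕ) (ρ : ℝ) (hρ₁ : -1 < ρ) (hρ₂ : ρ < 1) (hρ₀ : ρ ≠ 0) :
    (∀ f g : EuclideanSpace ℝ (Fin n) → ℝ, Measurable f → Measurable g →
      (∀ x, f x ∈ Set.Icc (0 : ℝ) 1) → (∀ x, g x ∈ Set.Icc (0 : ℝ) 1) →
      (¬ ∀ᵐ x ∂(GaussianStability.gammaN n), f x = 0) →
      (¬ ∀ᵐ x ∂(GaussianStability.gammaN n), f x = 1) →
      (¬ ∀ᵐ x ∂(GaussianStability.gammaN n), g x = 0) →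
      (¬ ∀ᵐ x ∂(GaussianStability.gammaN n), g x = 1) →
      (∫ z, GaussianStability.J ρ (f z.1) (g z.2) ∂(GaussianStability.correlatedGaussian n ρ)) =
        GaussianStability.J ρ (∫ x, f x ∂(GaussianStability.gammaN n))
          (∫ x, g x ∂(GaussianStability.gammaN n)) →
      (∃ p q : ℝ, (∀ᵐ x ∂(GaussianStability.gammaN n), f x = p) ∧
        (∀ᵐ x ∂(GaussianStability.gammaN n), g x = q)) ∨
      (∃ a b d : EuclideanSpace ℝ (Fin n), a ≠ 0 ∧
        (((∀ᵐ x ∂(GaussianStability.gammaN n),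
            f x = GaussianStability.Phi (inner ℝ a (x - b))) ∧
          (∀ᵐ x ∂(GaussianStability.gammaN n),
            g x = GaussianStability.Phi (inner ℝ a (x - d)))) ∨
         ((∀ᵐ x ∂(GaussianStability.gammaN n),
            f x = (GaussianStability.halfSpace a b).indicator (fun _ => (1 : ℝ)) x) ∧
          (∀ᵐ x ∂(GaussianStability.gammaN n),
            g x = (GaussianStability.halfSpace a d).indicator (fun _ => (1 : ℝ)) x))))) ∧
    (∀ (hn : 0 < n) (A₁ A₂ : Set (EuclideanSpace ℝ (Fin n))),
      MeasurableSet A₁ → MeasurableSet A₂ →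
      0 < GaussianStability.gammaN n A₁ → GaussianStability.gammaN n A₁ < 1 →
      0 < GaussianStability.gammaN n A₂ → GaussianStability.gammaN n A₂ < 1 →
      ((GaussianStability.correlatedGaussian n ρ).real (A₁ ×ˢ A₂) =
          (GaussianStability.correlatedGaussian n ρ).real
            (GaussianStability.borellHalfSpace hn A₁ ×ˢ GaussianStability.borellHalfSpace hn A₂) ↔
        ∃ a b d : EuclideanSpace ℝ (Fin n), a ≠ 0 ∧
          A₁ =ᵐ[GaussianStability.gammaN n] GaussianStability.halfSpace a b ∧
          A₂ =ᵐ[GaussianStability.gammaN n] GaussianStability.halfSpace a d)) := by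
  constructor
  · intro f g hf hg hf' hg' hf0 hf1 hg0 hg1 heq
    rcases GaussianStability.functional_equality hρ₁ hρ₂ hρ₀ hf hg hf' hg' hf0 hf1 hg0 hg1 heq
      with h | ⟨a, ha, c, d, h⟩
    · exact Or.inl h
    · refine Or.inr ⟨a, (c / ‖a‖ ^ 2) • a, (d / ‖a‖ ^ 2) • a, ha, ?_⟩
      simpa only [GaussianStability.halfSpace_eq, inner_sub_right,
        GaussianStability.inner_smul_normSq ha] using h
  · intro hn A₁ A₂ hA₁ hA₂ hA₁0 hA₁1 hA₂0 hA₂1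
    rw [GaussianStability.correlatedGaussian_borellHalfSpace]
    constructor
    · intro heq
      obtain ⟨a, ha, c, d, hc, hd⟩ := GaussianStability.ae_eq_halfspaces_of_real_eq_J hρ₁ hρ₂ hρ₀
        hA₁ hA₂ hA₁0.ne' hA₁1.ne hA₂0.ne' hA₂1.ne heq
      refine ⟨a, (c / ‖a‖ ^ 2) • a, (d / ‖a‖ ^ 2) • a, ha, ?_⟩
      rw [GaussianStability.halfSpace_eq, GaussianStability.halfSpace_eq,
        GaussianStability.inner_smul_normSq ha, GaussianStability.inner_smul_normSq ha]
      exact ⟨hc, hd⟩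
    · rintro ⟨a, b, d, ha, hb, hd⟩
      rw [GaussianStability.halfSpace_eq] at hb hd
      exact GaussianStability.real_eq_J_of_ae_eq_halfspaces hρ₁ hρ₂ ha hb hd
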